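/- **Notation.** Let $\mathbf m=(m_1,\dots,m_J)$, $\mathbf r=(r_1,\dots,r_J)$ be sequences of integers with $1\le r_j<m_j$, let $\boldsymbol\updelta=(\delta_1,\dots,\delta_J)$ be a sequence of nonzero integers, and let $L=\mathrm{lcm}(m_1,\dots,m_J)$. For integers $0\le h<k$ put $$\lambda_{m,r}(h,k)=\left\lceil\frac{rh}{\gcd(m,k)}\right\rceil,\qquad \lambda^*_{m,r}(h,k)=\lambda_{m,r}(h,k)-\frac{rh}{\gcd(m,k)},$$ $$\Omega=\sum_{j=1}^J\delta_j\Big(2m_j-12r_j+\frac{12r_j^2}{m_j}\Big),$$ $$\Delta(h,k)=-\sum_{j=1}^J\delta_j\Big(\frac{2\gcd^2(m_j,k)}{m_j}+\frac{12\gcd^2(m_j,k)}{m_j}\big(\lambda^*_{m_j,r_j}(h,k)^2-\lambda^*_{m_j,r_j}(h,k)\big)\Big).$$ Let $\mathcal L_{\le 0}$ be the set of pairs $(\varkappa,\ell)$ of integers with $1\le\ell\le L$, $0\le\varkappa<\ell$ and $\Delta(\varkappa,\ell)\le 0$. For $\gcd(h,k)=1$ let $\hbar_m(h,k)$ be an integer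 with $\hbar_m(h,k)\frac{mh}{\gcd(m,k)}\equiv-1\pmod{\frac{k}{\gcd(m,k)}}$, and put $$\omega_{h,k}=\exp\Big(-\pi i\sum_{j}\delta_j\, s\Big(\frac{m_jh}{\gcd(m_j,k)},\frac{k}{\gcd(m_j,k)}\Big)\Big),$$ $$D_{h,k}=\exp\Big(\pi i\sum_{j}\delta_j\Big(\frac{r_jh}{k}-\frac{r_j\gcd(m_j,k)}{m_jk}+\frac{2r_j\gcd(m_j,k)\lambda^*_{m_j,r_j}(h,k)}{m_jk}+\frac{\hbar_{m_j}(h,k)\gcd(m_j,k)}{k}\big(\lambda^2_{m_j,r_j}(h,k)-\lambda_{m_j,r_j}(h,k)\big)\Big)\Big),$$ where $s(d,c)=\sum_{n \bmod c}((dn/c))((n/c))$ is the Dedekind sum, with $((x))=x-\lfloor x\rfloor-\frac12$ for $x\notin\mathbb Z$ and $((x))=0$ for $x\in\mathbb Z$. Let $$Z(\varsigma;\tau)=\prod_{\nu\ge0}\big(1-\zeta q^\nu\big)\big(1-\zeta^{-1}q^{\nu+1}\big),\qquad \zeta=e^{2\pi i\varsigma},\ q=e^{2\pi i\tau}.$$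 With $d=\gcd(m,k)$, $m'=m/d$, $k'=k/d$, $b=(\hbar_m(h,k)m'h+1)/k'$, put $$\gamma_{(m,h,k)}(\tau)=\frac{\hbar_m(h,k)\tau-b}{k'\tau-m'h},\qquad \gamma^*_{(m,h,k)}(\tau)=\frac{1}{k'\tau-m'h}.$$ Let $N\ge1$ and $\varrho=1/N^2$. For a fraction $h/k$ with $1\le k\le N$, $0\le h<k$, $\gcd(h,k)=1$, let $\xi_{h,k}=[-\theta'_{h,k},\theta''_{h,k}]$, where $\theta'_{h,k},\theta''_{h,k}$ are the distances from $h/k$ to its mediants with its left and right neighbours among the rational numbers with denominator at most $N$. Put $z=k(\varrho-i\phi)$ and $\tau=(h+iz)/k$. For $1\le\ell\le L$ and $0\le\varkappa<\ell$ let $$S_{\varkappa,\ell}=S_{\varkappa,\ell}(n,N)=\sum_{\substack{1\le k\le N\\ k\equiv\ell \,(\mathrm{mod}\, L)}}\ \sum_{\substack{0\le h<k,\ \gcd(h,k)=1\\ h\equiv\varkappa\,(\mathrm{mod}\,\ell)}} e^{-\frac{2\pi inh}{k}}(-1)^{\sum_j\delta_j\lambda_{m_j,r_j}(h,k)}\,\omega_{h,k}^2\,D_{h,k}$$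 $$\times\int_{\xi_{h,k}}\exp\Big(\frac{\pi}{12k}\big(\Omega z+\Delta(\varkappa,\ell)z^{-1}\big)\Big)\prod_{j=1}^JZ\big(r_j\tau\gamma^*_{(m_j,h,k)}(m_j\tau)+\lambda_{m_j,r_j}(h,k)\gamma_{(m_j,h,k)}(m_j\tau);\gamma_{(m_j,h,k)}(m_j\tau)\big)^{\delta_j}e^{-2\pi in\phi}e^{2\pi n\varrho}\,d\phi .$$ (The empty sum, for $N=0$, is $0$.) **Theorem.** There is a constant $C$, depending only on $\mathbf m,\mathbf r,\boldsymbol\updelta$, such that for all $(\varkappa,\ell)\in\mathcal L_{\le0}$ and all positive integers $n>-\Omega/24$: 1. for all integers $N\ge1$, $\displaystyle |S_{\varkappa,\ell}(n,N)|\le C\exp\Big(\frac{2\pi}{N^2}\Big(n+\frac{\Omega}{24}\Big)\Big)$; 2. $S_{\varkappa,\ell}(n,N)\to0$ as $N\to\infty$ (with $n$ fixed); 3. if $N=\big\lfloor\sqrt{2\pi(n+\Omega/24)}\big\rfloor$, then $|S_{\varkappa,\ell}(n,N)|\le C$. -/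

import Mathlib

open Complex Filter Topology
open scoped Real

namespace FareyProduct

noncomputable section

/-! ### The arithmetic data attached to a fraction `h / k` -/

/-- `λ_{m,r}(h,k) = ⌈r h / gcd(m,k)⌉`. -/
def lam (m r h k : ℕ) : ℤ := ⌈((r : ℝ) * h) / (Nat.gcd m k : ℝ)⌉

/-- `λ*_{m,r}(h,k) = λ_{m,r}(h,k) - r h / gcd(m,k)`. -/
def lamStar (m r h k : ℕ) : ℝ := (lam m r h k : ℝ) - ((r : ℝ) * h) / (Nat.gcd m k : ℝ)

/-- An integer `ħ_m(h,k)` with `ħ_m(h,k) * (m h / gcd(m,k)) ≡ -1` modulo `k / gcd(m,k)`,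
see `hbar_spec`. -/
def hbar (m h k : ℕ) : ℤ :=
  ((-(((m / Nat.gcd m k * h : ℕ) : ZMod (k / Nat.gcd m k)))⁻¹).val : ℤ)

/-- `Ω = ∑ j, δ_j (2 m_j - 12 r_j + 12 r_j² / m_j)`. -/
def Omega {J : ℕ} (m r : Fin J → ℕ) (δ : Fin J → ℤ) : ℝ :=
  ∑ j, (δ j : ℝ) * (2 * (m j : ℝ) - 12 * (r j : ℝ) + 12 * (r j : ℝ) ^ 2 / (m j : ℝ))

/-- `Δ(h,k) = -∑ j, δ_j (2 gcd²(m_j,k) / m_j + (12 gcd²(m_j,k) / m_j) (λ*² - λ*))`. -/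
def Delta {J : ℕ} (m r : Fin J → ℕ) (δ : Fin J → ℤ) (h k : ℕ) : ℝ :=
  -∑ j, (δ j : ℝ) *
    (2 * (Nat.gcd (m j) k : ℝ) ^ 2 / (m j : ℝ) +
      12 * (Nat.gcd (m j) k : ℝ) ^ 2 / (m j : ℝ) *
        (lamStar (m j) (r j) h k ^ 2 - lamStar (m j) (r j) h k))

/-- The sawtooth function `((x))`. -/
def sawtooth (x : ℝ) : ℝ :=
  open scoped Classical in if ∃ a : ℤ, (a : ℝ) = x then 0 else x - (⌊x⌋ : ℝ) - 1 / 2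

/-- The Dedekind sum `s(d,c)`, the sum over residues modulo `c` of `((d n / c)) ((n / c))`. -/
def dedekindSum (d c : ℕ) : ℝ :=
  ∑ n ∈ Finset.range c, sawtooth ((d : ℝ) * n / c) * sawtooth ((n : ℝ) / c)

/-- `ω_{h,k} = exp(-π i ∑ j, δ_j s(m_j h / gcd(m_j,k), k / gcd(m_j,k)))`. -/
def omega {J : ℕ} (m : Fin J → ℕ) (δ : Fin J → ℤ) (h k : ℕ) : ℂ :=
  cexp (-(π : ℂ) * I * ((∑ j, (δ j : ℝ) *
    dedekindSum (m j / Nat.gcd (m j) k * h) (k / Nat.gcd (m j) k) : ℝ) : ℂ))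

/-- The root of unity `Д_{h,k}`. -/
def De {J : ℕ} (m r : Fin J → ℕ) (δ : Fin J → ℤ) (h k : ℕ) : ℂ :=
  cexp ((π : ℂ) * I * ((∑ j, (δ j : ℝ) *
    ((r j : ℝ) * h / k - (r j : ℝ) * (Nat.gcd (m j) k : ℝ) / ((m j : ℝ) * k)
      + 2 * (r j : ℝ) * (Nat.gcd (m j) k : ℝ) * lamStar (m j) (r j) h k / ((m j : ℝ) * k)
      + (hbar (m j) h k : ℝ) * (Nat.gcd (m j) k : ℝ) / k *
          ((lam (m j) (r j) h k : ℝ) ^ 2 - (lam (m j) (r j) h k : ℝ))) : ℝ) : ℂ))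

/-- `L = lcm(m_1, …, m_J)`. -/
def modulus {J : ℕ} (m : Fin J → ℕ) : ℕ := Finset.univ.lcm m

/-- The set `𝓛_{≤ 0}` of pairs `(ϰ, ℓ)` with `1 ≤ ℓ ≤ L`, `0 ≤ ϰ < ℓ` and `Δ(ϰ,ℓ) ≤ 0`. -/
def minorPairs {J : ℕ} (m r : Fin J → ℕ) (δ : Fin J → ℤ) : Set (ℕ × ℕ) :=
  {p | 1 ≤ p.2 ∧ p.2 ≤ modulus m ∧ p.1 < p.2 ∧ Delta m r δ p.1 p.2 ≤ 0}

/-! ### The infinite product and its transformation data -/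

/-- `(a; q)_∞ = ∏_{n ≥ 0} (1 - a q^n)`. -/
def qPoch (a q : ℂ) : ℂ := ∏' n : ℕ, (1 - a * q ^ n)

/-- `Ж(ς; τ) = (ζ, ζ⁻¹ q; q)_∞` with `ζ = exp(2π i ς)` and `q = exp(2π i τ)`. -/
def Zh (ς τ : ℂ) : ℂ :=
  qPoch (cexp (2 * π * I * ς)) (cexp (2 * π * I * τ)) *
    qPoch ((cexp (2 * π * I * ς))⁻¹ * cexp (2 * π * I * τ)) (cexp (2 * π * I * τ))

/-- The matrix `γ_{(m,h,k)}`, with rows `(ħ, -b)` and `(k', -m' h)`, where `m' = m / gcd(m,k)`,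
`k' = k / gcd(m,k)`, `b = (ħ m' h + 1) / k'`. It has determinant one, see `gammaMat_det`. -/
def gammaMat (m h k : ℕ) : Matrix (Fin 2) (Fin 2) ℤ :=
  !![hbar m h k,
      -((hbar m h k * ((m / Nat.gcd m k * h : ℕ) : ℤ) + 1) / ((k / Nat.gcd m k : ℕ) : ℤ));
    ((k / Nat.gcd m k : ℕ) : ℤ), -((m / Nat.gcd m k * h : ℕ) : ℤ)]

/-- The Möbius action `γ(τ) = (a τ + b) / (c τ + d)`. -/
def moebius (A : Matrix (Fin 2) (Fin 2) ℤ) (τ : ℂ) : ℂ :=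
  ((A 0 0 : ℂ) * τ + (A 0 1 : ℂ)) / ((A 1 0 : ℂ) * τ + (A 1 1 : ℂ))

/-- `γ*(τ) = 1 / (c τ + d)`. -/
def moebiusStar (A : Matrix (Fin 2) (Fin 2) ℤ) (τ : ℂ) : ℂ :=
  1 / ((A 1 0 : ℂ) * τ + (A 1 1 : ℂ))

/-- `∏ j, Ж^{δ_j}(r_j τ γ*(m_j τ) + λ_{m_j,r_j}(h,k) γ(m_j τ); γ(m_j τ))`, where
`γ = γ_{(m_j,h,k)}`. -/
def zhProd {J : ℕ} (m r : Fin J → ℕ) (δ : Fin J → ℤ) (h k : ℕ) (τ : ℂ) : ℂ :=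
  ∏ j, Zh
    ((r j : ℂ) * τ * moebiusStar (gammaMat (m j) h k) ((m j : ℂ) * τ) +
      (lam (m j) (r j) h k : ℂ) * moebius (gammaMat (m j) h k) ((m j : ℂ) * τ))
    (moebius (gammaMat (m j) h k) ((m j : ℂ) * τ)) ^ δ j

/-! ### Farey arcs -/

/-- The right neighbour of `x` among the fractions of order `N`, i.e. the least fraction with
denominator at most `N` that exceeds `x` (see `fareyNext_isLeast`): the least fraction `a / b > x`
for a given `b` has `a = ⌊x b⌋ + 1`. -/
def fareyNext (N : ℕ) (x : ℚ) : ℚ :=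
  (insert 1 (Finset.Icc 1 N)).inf' (Finset.insert_nonempty _ _)
    fun b : ℕ => ((⌊x * b⌋ + 1 : ℤ) : ℚ) / b

/-- The left neighbour of `x` among the fractions of order `N`, i.e. the greatest fraction with
denominator at most `N` that is less than `x` (see `fareyPrev_isGreatest`). -/
def fareyPrev (N : ℕ) (x : ℚ) : ℚ :=
  (insert 1 (Finset.Icc 1 N)).sup' (Finset.insert_nonempty _ _)
    fun b : ℕ => ((⌈x * b⌉ - 1 : ℤ) : ℚ) / b

/-- The mediant `(a + c) / (b + d)` of two fractions `a / b`, `c / d` in lowest terms. -/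
def mediant (p q : ℚ) : ℚ := ((p.num + q.num : ℤ) : ℚ) / ((p.den + q.den : ℕ) : ℚ)

/-- `θ'_{h,k}`, the distance from `h / k` to its mediant with the left neighbour. -/
def thetaLeft (N h k : ℕ) : ℝ :=
  (((h : ℚ) / k - mediant (fareyPrev N ((h : ℚ) / k)) ((h : ℚ) / k) : ℚ) : ℝ)

/-- `θ''_{h,k}`, the distance from `h / k` to its mediant with the right neighbour. -/
def thetaRight (N h k : ℕ) : ℝ :=
  ((mediant ((h : ℚ) / k) (fareyNext N ((h : ℚ) / k)) - (h : ℚ) / k : ℚ) : ℝ)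

/-- `ϱ = 1 / N²`. -/
def rho (N : ℕ) : ℝ := 1 / (N : ℝ) ^ 2

/-- `z = k (ϱ - i φ)`. -/
def zVar (N k : ℕ) (φ : ℝ) : ℂ := (k : ℂ) * ((rho N : ℂ) - I * (φ : ℂ))

/-- `τ = (h + i z) / k`. -/
def tauVar (N h k : ℕ) (φ : ℝ) : ℂ := ((h : ℂ) + I * zVar N k φ) / (k : ℂ)

/-- The integral over the Farey arc `ξ_{h,k} = [-θ'_{h,k}, θ''_{h,k}]`, with `D` in the place
of `Δ`. -/
def arcIntegral {J : ℕ} (m r : Fin J → ℕ) (δ : Fin J → ℤ) (D : ℝ) (n N h k : ℕ) : ℂ :=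
  ∫ φ in (-thetaLeft N h k)..(thetaRight N h k),
    cexp ((π : ℂ) / (12 * (k : ℂ)) *
        ((Omega m r δ : ℂ) * zVar N k φ + (D : ℂ) * (zVar N k φ)⁻¹)) *
      zhProd m r δ h k (tauVar N h k φ) *
      cexp (-2 * π * I * (n : ℂ) * (φ : ℂ)) * cexp (2 * π * (n : ℂ) * (rho N : ℂ))

/-- `S_{ϰ,ℓ}`, the contribution to the `n`-th coefficient of the Farey arcs of order `N` around
the fractions `h / k` with `k ≡ ℓ (mod L)` and `h ≡ ϰ (mod ℓ)`. -/
def S {J : ℕ} (m r : Fin J → ℕ) (δ : Fin J → ℤ) (ϰ ℓ n N : ℕ) : ℂ :=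
  ∑ k ∈ (Finset.Icc 1 N).filter (fun k => k ≡ ℓ [MOD modulus m]),
    ∑ h ∈ (Finset.range k).filter (fun h => Nat.gcd h k = 1 ∧ h ≡ ϰ [MOD ℓ]),
      cexp (-2 * π * I * (n : ℂ) * (h : ℂ) / (k : ℂ)) *
        (-1 : ℂ) ^ (∑ j, δ j * lam (m j) (r j) h k) *
        omega m δ h k ^ 2 * De m r δ h k *
        arcIntegral m r δ (Delta m r δ ϰ ℓ) n N h k

/-! ### Checks that the choices above have the defining properties -/

theorem hbar_spec (m h k : ℕ) (hk : 0 < k) (hhk : Nat.gcd h k = 1) :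
    hbar m h k * ((m / Nat.gcd m k * h : ℕ) : ℤ) ≡ -1 [ZMOD ((k / Nat.gcd m k : ℕ) : ℤ)] := by
  have hg : 0 < Nat.gcd m k := Nat.gcd_pos_of_pos_right _ hk
  have hpos : 0 < k / Nat.gcd m k := Nat.div_pos (Nat.gcd_le_right _ hk) hg
  have : NeZero (k / Nat.gcd m k) := ⟨hpos.ne'⟩
  have hc1 : Nat.Coprime (m / Nat.gcd m k) (k / Nat.gcd m k) := Nat.coprime_div_gcd_div_gcd hg
  have hc2 : Nat.Coprime h (k / Nat.gcd m k) :=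
    Nat.Coprime.coprime_dvd_right (Nat.div_dvd_of_dvd (Nat.gcd_dvd_right m k)) hhk
  have hc : Nat.Coprime (m / Nat.gcd m k * h) (k / Nat.gcd m k) := Nat.Coprime.mul_left hc1 hc2
  have hinv := ZMod.coe_mul_inv_eq_one _ hc
  rw [← ZMod.intCast_eq_intCast_iff, Int.cast_mul, Int.cast_natCast, hbar, Int.cast_natCast,
    ZMod.natCast_zmod_val, neg_mul, mul_comm, hinv, Int.cast_neg, Int.cast_one]

theorem gammaMat_det (m h k : ℕ) (hk : 0 < k) (hhk : Nat.gcd h k = 1) :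
    (gammaMat m h k).det = 1 := by
  have hd : ((k / Nat.gcd m k : ℕ) : ℤ) ∣
      hbar m h k * ((m / Nat.gcd m k * h : ℕ) : ℤ) + 1 := by
    have := (hbar_spec m h k hk hhk).symm.dvd
    simpa using this
  rw [gammaMat, Matrix.det_fin_two_of]
  have := Int.ediv_mul_cancel hd
  linarith

theorem fareyNext_isLeast (N : ℕ) (hN : 1 ≤ N) (x : ℚ) :
    IsLeast {q : ℚ | x < q ∧ q.den ≤ N} (fareyNext N x) := by
  have hins : insert 1 (Finset.Icc 1 N) = Finset.Icc 1 N :=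
    Finset.insert_eq_of_mem (Finset.mem_Icc.2 ⟨le_refl _, hN⟩)
  constructor
  · obtain ⟨b, hb, he⟩ := Finset.exists_mem_eq_inf' (Finset.insert_nonempty 1 (Finset.Icc 1 N))
      (fun b : ℕ => ((⌊x * b⌋ + 1 : ℤ) : ℚ) / b)
    rw [hins, Finset.mem_Icc] at hb
    have hb0 : (0 : ℚ) < b := by exact_mod_cast hb.1
    unfold fareyNext
    rw [Set.mem_ofPred_eq, he]
    refine ⟨?_, ?_⟩
    · rw [lt_div_iff₀ hb0]
      push_cast
      exact Int.lt_floor_add_one _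
    · have h1 : (((((⌊x * b⌋ + 1 : ℤ) : ℚ) / b).den : ℕ) : ℤ) ∣ (b : ℤ) := by
        have := Rat.den_dvd (⌊x * b⌋ + 1) (b : ℤ)
        simpa [Rat.divInt_eq_div] using this
      exact (Nat.le_of_dvd hb.1 (by exact_mod_cast h1)).trans hb.2
  · rintro q ⟨hq, hqN⟩
    have hmem : q.den ∈ insert 1 (Finset.Icc 1 N) := by
      rw [hins]; exact Finset.mem_Icc.2 ⟨q.pos, hqN⟩
    refine (Finset.inf'_le _ hmem).trans ?_
    have hd0 : (0 : ℚ) < q.den := by exact_mod_cast q.pos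
    rw [div_le_iff₀ hd0, Rat.mul_den_eq_num]
    have h2 : x * q.den < q.num := by
      rw [← Rat.mul_den_eq_num q]
      exact mul_lt_mul_of_pos_right hq hd0
    have h3 : ⌊x * q.den⌋ < q.num := Int.floor_lt.2 h2
    exact_mod_cast h3

theorem fareyPrev_isGreatest (N : ℕ) (hN : 1 ≤ N) (x : ℚ) :
    IsGreatest {q : ℚ | q < x ∧ q.den ≤ N} (fareyPrev N x) := by
  have hins : insert 1 (Finset.Icc 1 N) = Finset.Icc 1 N :=
    Finset.insert_eq_of_mem (Finset.mem_Icc.2 ⟨le_refl _, hN⟩)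
  constructor
  · obtain ⟨b, hb, he⟩ := Finset.exists_mem_eq_sup' (Finset.insert_nonempty 1 (Finset.Icc 1 N))
      (fun b : ℕ => ((⌈x * b⌉ - 1 : ℤ) : ℚ) / b)
    rw [hins, Finset.mem_Icc] at hb
    have hb0 : (0 : ℚ) < b := by exact_mod_cast hb.1
    unfold fareyPrev
    rw [Set.mem_ofPred_eq, he]
    refine ⟨?_, ?_⟩
    · rw [div_lt_iff₀ hb0]
      push_cast
      have := Int.ceil_lt_add_one (x * b)
      linarith
    · have h1 : (((((⌈x * b⌉ - 1 : ℤ) : ℚ) / b).den : ℕ) : ℤ) ∣ (b : ℤ) := by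
        have := Rat.den_dvd (⌈x * b⌉ - 1) (b : ℤ)
        simpa [Rat.divInt_eq_div] using this
      exact (Nat.le_of_dvd hb.1 (by exact_mod_cast h1)).trans hb.2
  · rintro q ⟨hq, hqN⟩
    have hmem : q.den ∈ insert 1 (Finset.Icc 1 N) := by
      rw [hins]; exact Finset.mem_Icc.2 ⟨q.pos, hqN⟩
    refine le_trans ?_ (Finset.le_sup' (fun b : ℕ => ((⌈x * b⌉ - 1 : ℤ) : ℚ) / b) hmem)
    have hd0 : (0 : ℚ) < q.den := by exact_mod_cast q.pos
    rw [le_div_iff₀ hd0, Rat.mul_den_eq_num]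
    have h2 : (q.num : ℚ) < x * q.den := by
      rw [← Rat.mul_den_eq_num q]
      exact mul_lt_mul_of_pos_right hq hd0
    have h3 : q.num < ⌈x * q.den⌉ := Int.lt_ceil.2 h2
    have h4 : q.num ≤ ⌈x * q.den⌉ - 1 := by omega
    exact_mod_cast h4

end

end FareyProduct

namespace FareyProduct

/-! ### Elementary estimates for the divisor function and for greatest common divisors -/

/-! Assertions 1 and 3 need only absolute values. An arc at h/k has length at most 2/(kN). On it
Re(1/z) > 0, so Δ ≤ 0 makes exp(πΔ/(12kz)) harmless, the other exponentials have norm exp(2π(n +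
Ω/24)/N²), and the product of the factors Z is bounded uniformly in h, k and N. Summing over fewer
than N² pairs, k numerators for each denominator k, gives `exists_norm_S_le`. For N = ⌊√X⌋ ≥ 1 with
X = 2π(n + Ω/24) one has X/N² ≤ 4.

Assertion 2 needs cancellation between the numerators of one denominator k. Put M = 24·lcm(m_j)·ℓ
and K = Mk, lift h to a unit modulo K, and let x be an inverse of -h modulo K. As long as h stays in
one class modulo M, the root of unity in front of the integral is a constant times e(-Ωh/(24k))
e(-Δx/(24k)) with Δ = Δ(h,k) constant (`exists_multiplier_eq`), and the product is a Lipschitz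
function of x/k + i/(kz) (`exists_zhProd_eq`). The ends of the arc depend only on x modulo k,
because the neighbours of h/k have denominators congruent to ±x (`thetaRight_eq`, `thetaLeft_eq`).
So each term is a(h)b(x), where a has bounded size and variation, and those of b are O(1/(kN)).

Expanding a and b into characters modulo K produces Kloosterman sums over the units in a class
modulo M. Kloosterman's fourth moment argument bounds them by K^(3/4+o(1)) times the gcd of K with
either frequency (`norm_kloosterman_unitsOver_le`), and the Fourier coefficients of functions of
bounded variation lose only divisor functions and logarithms. The result is a saving to K^(7/8),
provided that the pair of zero frequencies is absent, that is, (∑ a)(∑ b) = 0.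

This holds once k > α = n + Ω/24 (`sum_mul_sum_eq_zero`). Translation by k·ℓ/gcd(ℓ,k) multiplies a
by a constant phase, and translation by k∏ m_j/gcd(m_j,k) does the same to b. A nontrivial phase
kills the sum. If both phases are trivial, coprimality of the denominators makes α an integer with 0
< α < k, and a is then a geometric progression that sums to zero over each block of length k. Hence
the numerators of k contribute O(k^(-1/8)/N), and the average of k^(-1/8) over k ≤ N tends to zero.
-/

/-- Compare v + 1 with p^(vε) prime by prime. If p^ε ≥ 2 then v + 1 ≤ 2^v suffices; each of the
fewer than P exceptional primes costs one factor C₀. -/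
theorem exists_card_divisors_le {ε : ℝ} (hε : 0 < ε) :
    ∃ C : ℝ, 1 ≤ C ∧ ∀ n : ℕ, n ≠ 0 → (n.divisors.card : ℝ) ≤ C * (n : ℝ) ^ ε := by
  -- Chosen so that v + 1 ≤ C₀ (1 + vε log 2), whose bracket is at most 2^(vε).
  set C₀ : ℝ := 1 + 1 / (ε * Real.log 2) with hC₀
  have hl2 : 0 < Real.log 2 := Real.log_pos (by norm_num)
  have hel : 0 < ε * Real.log 2 := by positivity
  have hC₀1 : 1 ≤ C₀ := by rw [hC₀]; have := one_div_pos.2 hel; linarith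
  obtain ⟨P, hP⟩ := exists_nat_gt ((2 : ℝ) ^ (1 / ε))
  have small (v : ℕ) (p : ℕ) (hp : 2 ≤ p) : ((v : ℝ) + 1) ≤ C₀ * (p : ℝ) ^ (v * ε) := by
    have h1 : (2 : ℝ) ^ (v * ε) ≤ (p : ℝ) ^ (v * ε) :=
      Real.rpow_le_rpow (by norm_num) (by exact_mod_cast hp) (by positivity)
    have h2 : 1 + v * ε * Real.log 2 ≤ (2 : ℝ) ^ (v * ε) := by
      rw [Real.rpow_def_of_pos (by norm_num)]
      have := Real.add_one_le_exp (Real.log 2 * (v * ε))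
      linarith
    have h3 : (v : ℝ) + 1 ≤ C₀ * (1 + v * ε * Real.log 2) := by
      have : C₀ * (1 + v * ε * Real.log 2)
          = v + 1 + v * (ε * Real.log 2) + 1 / (ε * Real.log 2) := by
        rw [hC₀]; field_simp; ring
      rw [this]
      have : 0 ≤ (v : ℝ) * (ε * Real.log 2) := by positivity
      have := one_div_pos.2 hel
      linarith
    exact h3.trans (mul_le_mul_of_nonneg_left (h2.trans h1) (by linarith))
  have large (v : ℕ) (p : ℕ) (hp : P ≤ p) : ((v : ℝ) + 1) ≤ (p : ℝ) ^ (v * ε) := by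
    have h1 : (2 : ℝ) ≤ (p : ℝ) ^ ε := by
      have h2 : (2 : ℝ) ^ (1 / ε) ≤ p := hP.le.trans (by exact_mod_cast hp)
      have h3 := Real.rpow_le_rpow (by positivity) h2 hε.le
      rwa [← Real.rpow_mul (by norm_num), one_div_mul_cancel hε.ne', Real.rpow_one] at h3
    have h2 : (p : ℝ) ^ (v * ε) = ((p : ℝ) ^ ε) ^ v := by
      rw [mul_comm, Real.rpow_mul (by positivity), Real.rpow_natCast]
    rw [h2]
    have h3 : (2 : ℝ) ^ v ≤ ((p : ℝ) ^ ε) ^ v := pow_le_pow_left₀ (by norm_num) h1 v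
    have h4 : v + 1 ≤ 2 ^ v := Nat.lt_two_pow_self
    have h5 : ((v + 1 : ℕ) : ℝ) ≤ ((2 ^ v : ℕ) : ℝ) := by exact_mod_cast h4
    push_cast at h5
    linarith
  refine ⟨C₀ ^ P, one_le_pow₀ hC₀1, fun n hn => ?_⟩
  rw [Nat.card_divisors hn]
  push_cast
  have hnp : (n : ℝ) ^ ε = ∏ p ∈ n.primeFactors, (p : ℝ) ^ (n.factorization p * ε) := by
    conv_lhs => rw [← Nat.prod_factorization_pow_eq_self hn]
    rw [Finsupp.prod, Nat.support_factorization, Nat.cast_prod,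
      ← Real.finsetProd_rpow _ _ (fun i _ => by positivity)]
    refine Finset.prod_congr rfl fun p _ => ?_
    rw [Nat.cast_pow, Real.rpow_mul (by positivity), Real.rpow_natCast]
  have hstep : ∏ p ∈ n.primeFactors, ((n.factorization p : ℝ) + 1) ≤
      ∏ p ∈ n.primeFactors, ((if p < P then C₀ else 1) * (p : ℝ) ^ (n.factorization p * ε)) := by
    refine Finset.prod_le_prod (fun i _ => by positivity) fun p hp => ?_
    have hpp := Nat.prime_of_mem_primeFactors hp
    split_ifs with h
    · exact small _ _ hpp.two_le
    · rw [one_mul]; exact large _ _ (not_lt.1 h)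
  refine hstep.trans ?_
  rw [Finset.prod_mul_distrib, ← hnp]
  refine mul_le_mul_of_nonneg_right ?_ (by positivity)
  rw [Finset.prod_ite, Finset.prod_const, Finset.prod_const_one, mul_one]
  refine pow_le_pow_right₀ hC₀1 ?_
  calc _ ≤ (Finset.range P).card := Finset.card_le_card fun p hp => by
        simpa using (Finset.mem_filter.1 hp).2
    _ = P := Finset.card_range P

/-- At a prime power p^a the right side is p^(a-1)(p - 1)(a + 1), and 2(p - 1) ≥ p. This serves as a
lower bound for the number of units modulo K. -/
theorem le_totient_mul_card_divisors {n : ℕ} (hn : n ≠ 0) :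
    n ≤ n.totient * n.divisors.card := by
  rw [Nat.card_divisors hn, Nat.totient_eq_prod_factorization hn, Finsupp.prod,
    Nat.support_factorization, ← Finset.prod_mul_distrib]
  conv_lhs => rw [← Nat.prod_factorization_pow_eq_self hn, Finsupp.prod, Nat.support_factorization]
  refine Finset.prod_le_prod' fun p hp => ?_
  have hpp := Nat.prime_of_mem_primeFactors hp
  have hv : 1 ≤ n.factorization p :=
    hpp.factorization_pos_of_dvd hn (Nat.dvd_of_mem_primeFactors hp)
  obtain ⟨v, hv'⟩ : ∃ v, n.factorization p = v + 1 := ⟨_, (Nat.sub_add_cancel hv).symm⟩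
  rw [hv', Nat.add_sub_cancel, pow_succ, mul_assoc]
  refine Nat.mul_le_mul_left _ ?_
  obtain ⟨q, rfl⟩ : ∃ q, p = q + 2 := ⟨p - 2, by have := hpp.two_le; omega⟩
  have : q + 2 - 1 = q + 1 := by omega
  rw [this]
  nlinarith

theorem gcd_le_sum_divisors (n j : ℕ) (hn : n ≠ 0) :
    Nat.gcd j n ≤ ∑ d ∈ n.divisors, if d ∣ j then d else 0 := by
  have hmem : Nat.gcd j n ∈ n.divisors := Nat.mem_divisors.2 ⟨Nat.gcd_dvd_right _ _, hn⟩
  have := Finset.single_le_sum (f := fun d => if d ∣ j then d else 0) (fun _ _ => Nat.zero_le _) hmem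
  simpa [Nat.gcd_dvd_left] using this

/-- The gcd is one of the divisors in `gcd_le_sum_divisors`; after interchanging the sums, each d ∣
n contributes d for each of its n/d multiples. -/
theorem sum_gcd_le (n : ℕ) (hn : n ≠ 0) :
    ∑ j ∈ Finset.range n, Nat.gcd j n ≤ n * n.divisors.card := by
  calc ∑ j ∈ Finset.range n, Nat.gcd j n
      ≤ ∑ j ∈ Finset.range n, ∑ d ∈ n.divisors, (if d ∣ j then d else 0) :=
        Finset.sum_le_sum fun j _ => gcd_le_sum_divisors n j hn
    _ = ∑ d ∈ n.divisors, ∑ j ∈ Finset.range n, (if d ∣ j then d else 0) := Finset.sum_comm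
    _ ≤ ∑ d ∈ n.divisors, n := by
        refine Finset.sum_le_sum fun d hd => ?_
        have hdn := Nat.dvd_of_mem_divisors hd
        have hd0 : 0 < d := Nat.pos_of_mem_divisors hd
        rw [← Finset.sum_filter, Finset.sum_const, smul_eq_mul]
        have hcard : ((Finset.range n).filter (d ∣ ·)).card ≤ (Finset.range (n / d)).card := by
          refine Finset.card_le_card_of_injOn (· / d) (fun j hj => ?_) ?_
          · simp only [Finset.coe_filter, Finset.mem_range, Set.mem_ofPred_eq] at hj
            simp only [Finset.coe_range, Set.mem_Iio]
            exact Nat.div_lt_div_of_lt_of_dvd hdn hj.1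
          · intro a ha b hb hab
            simp only [Finset.coe_filter, Finset.mem_range, Set.mem_ofPred_eq] at ha hb
            have h1 := Nat.div_mul_cancel ha.2
            have h2 := Nat.div_mul_cancel hb.2
            simp only at hab
            rw [← h1, ← h2, hab]
        rw [Finset.card_range] at hcard
        calc _ ≤ n / d * d := Nat.mul_le_mul_right _ hcard
          _ ≤ n := Nat.div_mul_le_self n d
    _ = n * n.divisors.card := by rw [Finset.sum_const, smul_eq_mul, mul_comm]

theorem sum_gcd_div_le (n : ℕ) (hn : n ≠ 0) :
    ∑ j ∈ Finset.Icc 1 n, (Nat.gcd j n : ℝ) / j ≤ n.divisors.card * (1 + Real.log n) := by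
  have hharm : ∑ i ∈ Finset.Icc 1 n, (1 : ℝ) / i ≤ 1 + Real.log n := by
    have := harmonic_le_one_add_log n
    rw [harmonic_eq_sum_Icc] at this
    push_cast at this
    simpa [one_div] using this
  calc ∑ j ∈ Finset.Icc 1 n, (Nat.gcd j n : ℝ) / j
      ≤ ∑ j ∈ Finset.Icc 1 n, ∑ d ∈ n.divisors, (if d ∣ j then (d : ℝ) / j else 0) := by
        refine Finset.sum_le_sum fun j hj => ?_
        have h := gcd_le_sum_divisors n j hn
        have h' : (Nat.gcd j n : ℝ) ≤ ∑ d ∈ n.divisors, (if d ∣ j then (d : ℝ) else 0) := by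
          exact_mod_cast h
        calc (Nat.gcd j n : ℝ) / j
            ≤ (∑ d ∈ n.divisors, (if d ∣ j then (d : ℝ) else 0)) / j := by gcongr
          _ = _ := by
            rw [Finset.sum_div]
            refine Finset.sum_congr rfl fun d _ => ?_
            split_ifs <;> simp
    _ = ∑ d ∈ n.divisors, ∑ j ∈ Finset.Icc 1 n, (if d ∣ j then (d : ℝ) / j else 0) :=
        Finset.sum_comm
    _ ≤ ∑ d ∈ n.divisors, ∑ i ∈ Finset.Icc 1 n, (1 : ℝ) / i := by
        refine Finset.sum_le_sum fun d hd => ?_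
        have hd0 : 0 < d := Nat.pos_of_mem_divisors hd
        rw [← Finset.sum_filter]
        have hinj : Set.InjOn (· / d) ((Finset.Icc 1 n).filter (d ∣ ·) : Finset ℕ) := by
          intro a ha b hb hab
          simp only [Finset.coe_filter, Set.mem_ofPred_eq] at ha hb
          simp only at hab
          rw [← Nat.div_mul_cancel ha.2, ← Nat.div_mul_cancel hb.2, hab]
        have : ∑ j ∈ (Finset.Icc 1 n).filter (d ∣ ·), (d : ℝ) / j
            = ∑ i ∈ ((Finset.Icc 1 n).filter (d ∣ ·)).image (· / d), (1 : ℝ) / i := by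
          rw [Finset.sum_image hinj]
          refine Finset.sum_congr rfl fun j hj => ?_
          obtain ⟨hj1, i, rfl⟩ := Finset.mem_filter.1 hj
          rw [Nat.mul_div_cancel_left _ hd0]
          have : (d : ℝ) ≠ 0 := by positivity
          push_cast
          rw [one_div, div_mul_eq_div_div, div_self this, one_div]
        rw [this]
        refine Finset.sum_le_sum_of_subset_of_nonneg (fun i hi => ?_) fun _ _ _ => by positivity
        obtain ⟨j, hj, rfl⟩ := Finset.mem_image.1 hi
        obtain ⟨hj1, hj2⟩ := Finset.mem_filter.1 hj
        rw [Finset.mem_Icc] at hj1 ⊢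
        exact ⟨Nat.div_pos (Nat.le_of_dvd hj1.1 hj2) hd0, (Nat.div_le_self _ _).trans hj1.2⟩
    _ ≤ ∑ d ∈ n.divisors, (1 + Real.log n) := Finset.sum_le_sum fun _ _ => hharm
    _ = _ := by rw [Finset.sum_const, nsmul_eq_mul]


/-! ### Kloosterman sums over the units in a residue class -/

open ZMod in
/-- The Kloosterman sum `∑ ψ(α u + β u⁻¹)` over a set of units modulo `K`. -/
noncomputable def kloosterman {K : ℕ} [NeZero K] (U : Finset (ZMod K)ˣ) (α β : ZMod K) : ℂ :=
  ∑ u ∈ U, stdAddChar (α * (u : ZMod K) + β * ((u⁻¹ : (ZMod K)ˣ) : ZMod K))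

section

variable {K : ℕ} [NeZero K]

theorem conj_stdAddChar (x : ZMod K) :
    (starRingEnd ℂ) (ZMod.stdAddChar x) = ZMod.stdAddChar (-x) :=
  (AddChar.map_neg_eq_conj _ _).symm

theorem sum_stdAddChar_mul (b : ZMod K) :
    ∑ x : ZMod K, ZMod.stdAddChar (x * b) = if b = 0 then (K : ℂ) else 0 := by
  rw [AddChar.sum_mulShift b (ZMod.isPrimitive_stdAddChar K), ZMod.card]
  split_ifs <;> simp

/-- Parseval in two variables: after expanding the square, orthogonality in α and in β leaves only
the pairs of indices at which both p and q agree. -/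
theorem sum_norm_sq_exponential_sum {ι : Type*} (s : Finset ι) (p q : ι → ZMod K) :
    ∑ α : ZMod K, ∑ β : ZMod K, ‖∑ i ∈ s, ZMod.stdAddChar (α * p i + β * q i)‖ ^ 2 =
      (K : ℝ) ^ 2 * ((s ×ˢ s).filter fun ij => p ij.1 = p ij.2 ∧ q ij.1 = q ij.2).card := by
  classical
  have key : ∀ α β : ZMod K, ((‖∑ i ∈ s, ZMod.stdAddChar (α * p i + β * q i)‖ ^ 2 : ℝ) : ℂ) =
      ∑ ij ∈ s ×ˢ s, ZMod.stdAddChar (α * (p ij.1 - p ij.2)) *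
        ZMod.stdAddChar (β * (q ij.1 - q ij.2)) := by
    intro α β
    push_cast
    rw [← Complex.mul_conj', map_sum, Finset.sum_mul_sum, ← Finset.sum_product']
    refine Finset.sum_congr rfl fun ij _ => ?_
    rw [conj_stdAddChar, ← AddChar.map_add_eq_mul, ← AddChar.map_add_eq_mul]
    congr 1
    ring
  have : ((∑ α : ZMod K, ∑ β : ZMod K,
      ‖∑ i ∈ s, ZMod.stdAddChar (α * p i + β * q i)‖ ^ 2 : ℝ) : ℂ) =
      (((K : ℝ) ^ 2 * ((s ×ˢ s).filter fun ij =>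
        p ij.1 = p ij.2 ∧ q ij.1 = q ij.2).card : ℝ) : ℂ) := by
    rw [Complex.ofReal_sum]
    simp_rw [Complex.ofReal_sum, key]
    calc _ = ∑ ij ∈ s ×ˢ s, (∑ α : ZMod K, ZMod.stdAddChar (α * (p ij.1 - p ij.2))) *
          (∑ β : ZMod K, ZMod.stdAddChar (β * (q ij.1 - q ij.2))) := by
          simp_rw [Finset.sum_mul_sum]
          rw [Finset.sum_comm]
          conv_rhs => rw [Finset.sum_comm]
          rw [Finset.sum_comm]
          refine Finset.sum_congr rfl fun α _ => ?_
          rw [Finset.sum_comm]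
      _ = ∑ ij ∈ s ×ˢ s, if p ij.1 = p ij.2 ∧ q ij.1 = q ij.2 then (K : ℂ) ^ 2 else 0 := by
          refine Finset.sum_congr rfl fun ij _ => ?_
          rw [sum_stdAddChar_mul, sum_stdAddChar_mul]
          simp only [sub_eq_zero]
          by_cases h1 : p ij.1 = p ij.2 <;> by_cases h2 : q ij.1 = q ij.2 <;> simp [h1, h2, sq]
      _ = _ := by
          rw [← Finset.sum_filter, Finset.sum_const, nsmul_eq_mul]
          push_cast
          ring
  exact_mod_cast this

/-- Every solution is a multiple of K/g modulo K. -/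
theorem card_mul_eq_zero_le (c : ZMod K) :
    (Finset.univ.filter fun y : ZMod K => c * y = 0).card ≤ Nat.gcd c.val K := by
  have hK : 0 < K := Nat.pos_of_ne_zero (NeZero.ne K)
  set g := Nat.gcd c.val K with hg
  have hg0 : 0 < g := Nat.gcd_pos_of_pos_right _ hK
  have hgK : g ∣ K := Nat.gcd_dvd_right _ _
  have hdiv : ∀ y : ZMod K, c * y = 0 → K / g ∣ y.val := by
    intro y hy
    have h1 : K ∣ c.val * y.val := by
      rw [← ZMod.natCast_eq_zero_iff]
      push_cast
      simpa using hy
    have h2 : K / g ∣ c.val / g * y.val := by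
      have : c.val * y.val = g * (c.val / g * y.val) := by
        rw [← mul_assoc, Nat.mul_div_cancel' (Nat.gcd_dvd_left _ _)]
      rw [this] at h1
      exact (Nat.div_dvd_iff_dvd_mul hgK hg0).2 h1
    exact (Nat.coprime_div_gcd_div_gcd hg0).symm.dvd_of_dvd_mul_left h2
  have hKg : 0 < K / g := Nat.div_pos (Nat.le_of_dvd hK hgK) hg0
  calc _ ≤ (Finset.range g).card := by
        refine Finset.card_le_card_of_injOn (fun y => y.val / (K / g)) (fun y hy => ?_) ?_
        · simp only [Finset.coe_filter, Finset.mem_univ, true_and, Set.mem_ofPred_eq] at hy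
          simp only [Finset.coe_range, Set.mem_Iio]
          rw [Nat.div_lt_iff_lt_mul hKg, Nat.mul_div_cancel' hgK]
          exact ZMod.val_lt y
        · intro a ha b hb hab
          simp only [Finset.coe_filter, Finset.mem_univ, true_and, Set.mem_ofPred_eq] at ha hb
          simp only at hab
          apply ZMod.val_injective K
          rw [← Nat.div_mul_cancel (hdiv a ha), ← Nat.div_mul_cancel (hdiv b hb), hab]
    _ = g := Finset.card_range g

/-- For given x and t there are at most gcd(xt, K) ≤ gcd(x, K) gcd(t, K) values of y, so the count
is bounded by the square of a sum of gcds. -/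
theorem card_triple_mul_eq_zero_le :
    (Finset.univ.filter fun p : ZMod K × ZMod K × ZMod K => p.1 * p.2.1 * p.2.2 = 0).card ≤
      (K * K.divisors.card) ^ 2 := by
  have hK : K ≠ 0 := NeZero.ne K
  have hval : ∑ x : ZMod K, Nat.gcd x.val K ≤ K * K.divisors.card := by
    refine le_trans (le_of_eq ?_) (sum_gcd_le K hK)
    refine Finset.sum_nbij (fun x => x.val) (fun x _ => Finset.mem_range.2 (ZMod.val_lt x))
      (fun a _ b _ h => ZMod.val_injective K h) (fun j hj => ?_) fun _ _ => rfl
    simp only [Finset.coe_range, Set.mem_Iio] at hj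
    exact ⟨(j : ZMod K), by simp, ZMod.val_cast_of_lt hj⟩
  calc _ = ∑ x : ZMod K, ∑ t : ZMod K,
        (Finset.univ.filter fun y : ZMod K => x * t * y = 0).card := by
        simp_rw [Finset.card_filter]
        rw [Fintype.sum_prod_type]
        refine Finset.sum_congr rfl fun x _ => ?_
        rw [Fintype.sum_prod_type]
    _ ≤ ∑ x : ZMod K, ∑ t : ZMod K, Nat.gcd x.val K * Nat.gcd t.val K := by
        refine Finset.sum_le_sum fun x _ => Finset.sum_le_sum fun t _ => ?_
        refine (card_mul_eq_zero_le _).trans ?_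
        have h0 : 0 < K := Nat.pos_of_ne_zero hK
        refine Nat.le_of_dvd (Nat.mul_pos (Nat.gcd_pos_of_pos_right _ h0)
          (Nat.gcd_pos_of_pos_right _ h0)) ?_
        rw [ZMod.val_mul, (Nat.mod_modEq (x.val * t.val) K).gcd_eq, Nat.gcd_comm]
        have := Nat.gcd_mul_right_dvd_mul_gcd K x.val t.val
        simpa [Nat.gcd_comm] using this
    _ = (∑ x : ZMod K, Nat.gcd x.val K) ^ 2 := by rw [sq, Finset.sum_mul_sum]
    _ ≤ _ := Nat.pow_le_pow_left hval 2

/-- Clearing denominators in 1/a + 1/b = 1/c + 1/d and using a + b = c + d gives (a + b)(c - a)(d -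
a) = 0. The triple of these factors determines 2a, hence a up to the choice of one bit (which half
of [0, K) contains it), and then b, c, d. No primality of K is needed. -/
theorem card_additive_quadruples_le (U : Finset (ZMod K)ˣ) :
    (((U ×ˢ U) ×ˢ (U ×ˢ U)).filter fun p : ((ZMod K)ˣ × (ZMod K)ˣ) × ((ZMod K)ˣ × (ZMod K)ˣ) =>
      ((p.1.1 : ZMod K) + p.1.2 = p.2.1 + p.2.2) ∧
      (((p.1.1⁻¹ : (ZMod K)ˣ) : ZMod K) + ((p.1.2⁻¹ : (ZMod K)ˣ) : ZMod K) =
        ((p.2.1⁻¹ : (ZMod K)ˣ) : ZMod K) + ((p.2.2⁻¹ : (ZMod K)ˣ) : ZMod K))).card ≤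
      2 * (K * K.divisors.card) ^ 2 := by
  classical
  calc _ ≤ ((Finset.univ : Finset Bool) ×ˢ (Finset.univ.filter
        fun p : ZMod K × ZMod K × ZMod K => p.1 * p.2.1 * p.2.2 = 0)).card := by
        refine Finset.card_le_card_of_injOn (fun p => (decide (2 * (p.1.1 : ZMod K).val < K),
          ((p.1.1 : ZMod K) + p.1.2, (p.2.1 : ZMod K) - p.1.1, (p.2.2 : ZMod K) - p.1.1)))
          ?_ ?_
        · rintro ⟨⟨a, b⟩, ⟨c, d⟩⟩ hp
          simp only [Finset.coe_filter, Finset.mem_product, Set.mem_ofPred_eq] at hp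
          obtain ⟨-, h1, h2⟩ := hp
          simp only [Finset.coe_product, Finset.coe_univ, Finset.coe_filter, Set.mem_prod,
            Set.mem_univ, true_and, Finset.mem_univ, Set.mem_ofPred_eq]
          have ha := a.mul_inv
          have hb := b.mul_inv
          have hc := c.mul_inv
          have hd := d.mul_inv
          set a' : ZMod K := ((a⁻¹ : (ZMod K)ˣ) : ZMod K)
          set b' : ZMod K := ((b⁻¹ : (ZMod K)ˣ) : ZMod K)
          set c' : ZMod K := ((c⁻¹ : (ZMod K)ˣ) : ZMod K)
          set d' : ZMod K := ((d⁻¹ : (ZMod K)ˣ) : ZMod K)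
          have e1 : ((a : ZMod K) + b) * (c * d) = (c + d) * (a * b) := by
            have l : (a' + b') * (a * b * c * d) = ((a : ZMod K) + b) * (c * d) := by
              linear_combination (b * c * d : ZMod K) * ha + (a * c * d : ZMod K) * hb
            have r : (c' + d') * (a * b * c * d) = ((c : ZMod K) + d) * (a * b) := by
              linear_combination (a * b * d : ZMod K) * hc + (a * b * c : ZMod K) * hd
            rw [← l, ← r, h2]
          linear_combination e1 + (a : ZMod K) ^ 2 * h1
        · rintro ⟨⟨a, b⟩, ⟨c, d⟩⟩ hp ⟨⟨a₁, b₁⟩, ⟨c₁, d₁⟩⟩ hp₁ h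
          simp only [Finset.coe_filter, Finset.mem_product, Set.mem_ofPred_eq] at hp hp₁
          simp only [Prod.mk.injEq] at h
          obtain ⟨h0, hx, ht, hy⟩ := h
          have h2a : 2 * (a : ZMod K) = 2 * (a₁ : ZMod K) := by
            linear_combination hx - ht - hy - hp.2.1 + hp₁.2.1
          have haa : (a : ZMod K) = a₁ := by
            apply ZMod.val_injective K
            have hl := ZMod.val_lt (a : ZMod K)
            have hl₁ := ZMod.val_lt (a₁ : ZMod K)
            have hm : ((2 * (a : ZMod K).val : ℕ) : ZMod K) = ((2 * (a₁ : ZMod K).val : ℕ) : ZMod K) := by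
              push_cast
              simpa using h2a
            rw [ZMod.natCast_eq_natCast_iff'] at hm
            have hiff : 2 * (a : ZMod K).val < K ↔ 2 * (a₁ : ZMod K).val < K := by
              simpa using h0
            by_cases hs : 2 * (a : ZMod K).val < K
            · have hs₁ := hiff.1 hs
              rw [Nat.mod_eq_of_lt hs, Nat.mod_eq_of_lt hs₁] at hm
              omega
            · have hs₁ := fun h => hs (hiff.2 h)
              rw [Nat.mod_eq_sub_mod (not_lt.1 hs), Nat.mod_eq_sub_mod (not_lt.1 hs₁),
                Nat.mod_eq_of_lt (by omega), Nat.mod_eq_of_lt (by omega)] at hm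
              omega
          have hbb : (b : ZMod K) = b₁ := by linear_combination hx - haa
          have hcc : (c : ZMod K) = c₁ := by linear_combination ht + haa
          have hdd : (d : ZMod K) = d₁ := by linear_combination hy + haa
          rw [Units.ext haa, Units.ext hbb, Units.ext hcc, Units.ext hdd]
    _ = 2 * (Finset.univ.filter
        fun p : ZMod K × ZMod K × ZMod K => p.1 * p.2.1 * p.2.2 = 0).card := by
        rw [Finset.card_product, Finset.card_univ, Fintype.card_bool]
    _ ≤ _ := Nat.mul_le_mul_left _ card_triple_mul_eq_zero_le

/-- The square of a Kloosterman sum is an exponential sum over pairs of units, so its second moment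
counts additive quadruples. -/
theorem sum_norm_kloosterman_pow_four_le (U : Finset (ZMod K)ˣ) :
    ∑ α : ZMod K, ∑ β : ZMod K, ‖kloosterman U α β‖ ^ 4 ≤
      (K : ℝ) ^ 2 * (2 * (K * K.divisors.card) ^ 2) := by
  classical
  have h : ∀ α β : ZMod K, ‖kloosterman U α β‖ ^ 4 = ‖∑ i ∈ U ×ˢ U, ZMod.stdAddChar
      (α * ((i.1 : ZMod K) + (i.2 : ZMod K)) +
        β * (((i.1⁻¹ : (ZMod K)ˣ) : ZMod K) + ((i.2⁻¹ : (ZMod K)ˣ) : ZMod K)))‖ ^ 2 := by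
    intro α β
    have : ∑ i ∈ U ×ˢ U, ZMod.stdAddChar (α * ((i.1 : ZMod K) + (i.2 : ZMod K)) +
        β * (((i.1⁻¹ : (ZMod K)ˣ) : ZMod K) + ((i.2⁻¹ : (ZMod K)ˣ) : ZMod K))) =
        kloosterman U α β * kloosterman U α β := by
      rw [kloosterman, Finset.sum_mul_sum, ← Finset.sum_product']
      refine Finset.sum_congr rfl fun i _ => ?_
      rw [← AddChar.map_add_eq_mul]
      congr 1
      ring
    rw [this, norm_mul]
    ring
  simp_rw [h]
  rw [sum_norm_sq_exponential_sum]
  refine mul_le_mul_of_nonneg_left ?_ (by positivity)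
  exact_mod_cast card_additive_quadruples_le U

theorem kloosterman_mul (U : Finset (ZMod K)ˣ) (v : (ZMod K)ˣ) (hv : ∀ u, v * u ∈ U ↔ u ∈ U)
    (α β : ZMod K) :
    kloosterman U (α * v) (β * ((v⁻¹ : (ZMod K)ˣ) : ZMod K)) = kloosterman U α β := by
  refine Finset.sum_nbij (fun u => v * u) (fun u hu => (hv u).2 hu)
    (fun a _ b _ h => mul_left_cancel h) (fun u hu => ⟨v⁻¹ * u, ?_, by simp⟩) fun u _ => ?_
  · have := hv (v⁻¹ * u)
    rw [mul_inv_cancel_left] at this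
    exact this.1 hu
  · congr 1
    simp only [mul_inv, Units.val_mul]
    ring

/-- Kloosterman's device: by `kloosterman_mul` the sum has the same value along the orbit (αv,
βv⁻¹), v ∈ H, so the fourth moment contains this value once for every point of the orbit. A point is
hit at most g times, since two parameters with the same image differ by a solution of αy = 0, and
their inverses by a solution of βy = 0. -/
theorem card_mul_norm_kloosterman_pow_four_le (U H : Finset (ZMod K)ˣ)
    (hH : ∀ v ∈ H, ∀ u, v * u ∈ U ↔ u ∈ U) (α β : ZMod K) (g : ℕ)
    (hg : g = Nat.gcd α.val K ∨ g = Nat.gcd β.val K) :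
    (H.card : ℝ) * ‖kloosterman U α β‖ ^ 4 ≤
      g * ((K : ℝ) ^ 2 * (2 * (K * K.divisors.card) ^ 2)) := by
  classical
  set orb : (ZMod K)ˣ → ZMod K × ZMod K :=
    fun v => (α * v, β * ((v⁻¹ : (ZMod K)ˣ) : ZMod K)) with horb
  have hfib : ∀ p : ZMod K × ZMod K, (H.filter fun v => orb v = p).card ≤ g := by
    intro p
    rcases (H.filter fun v => orb v = p).eq_empty_or_nonempty with he | ⟨v₀, hv₀⟩
    · simp [he]
    have h0 := (Finset.mem_filter.1 hv₀).2
    rcases hg with rfl | rfl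
    · refine le_trans ?_ (card_mul_eq_zero_le α)
      refine Finset.card_le_card_of_injOn (fun v => (v : ZMod K) - v₀) (fun v hv => ?_) ?_
      · have h1 := (Finset.mem_filter.1 hv).2
        simp only [Finset.coe_filter, Finset.mem_univ, true_and, Set.mem_ofPred_eq]
        have : α * (v : ZMod K) = α * v₀ := congrArg Prod.fst (h1.trans h0.symm)
        rw [mul_sub, this, sub_self]
      · intro a _ b _ hab
        exact Units.ext (sub_left_injective hab)
    · refine le_trans ?_ (card_mul_eq_zero_le β)
      refine Finset.card_le_card_of_injOn
        (fun v => ((v⁻¹ : (ZMod K)ˣ) : ZMod K) - ((v₀⁻¹ : (ZMod K)ˣ) : ZMod K)) (fun v hv => ?_) ?_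
      · have h1 := (Finset.mem_filter.1 hv).2
        simp only [Finset.coe_filter, Finset.mem_univ, true_and, Set.mem_ofPred_eq]
        have : β * ((v⁻¹ : (ZMod K)ˣ) : ZMod K) = β * ((v₀⁻¹ : (ZMod K)ˣ) : ZMod K) :=
          congrArg Prod.snd (h1.trans h0.symm)
        rw [mul_sub, this, sub_self]
      · intro a _ b _ hab
        exact inv_injective (Units.ext (sub_left_injective hab))
  calc (H.card : ℝ) * ‖kloosterman U α β‖ ^ 4
      = ∑ v ∈ H, ‖kloosterman U (orb v).1 (orb v).2‖ ^ 4 := by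
        rw [Finset.sum_congr rfl fun v hv => by rw [horb, kloosterman_mul U v (hH v hv) α β],
          Finset.sum_const, nsmul_eq_mul]
    _ = ∑ p : ZMod K × ZMod K, ∑ v ∈ H.filter (fun v => orb v = p),
          ‖kloosterman U (orb v).1 (orb v).2‖ ^ 4 :=
        (Finset.sum_fiberwise H orb _).symm
    _ = ∑ p : ZMod K × ZMod K, ((H.filter fun v => orb v = p).card : ℝ) *
          ‖kloosterman U p.1 p.2‖ ^ 4 := by
        refine Finset.sum_congr rfl fun p _ => ?_
        rw [Finset.sum_congr rfl fun v hv => by rw [(Finset.mem_filter.1 hv).2],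
          Finset.sum_const, nsmul_eq_mul]
    _ ≤ ∑ p : ZMod K × ZMod K, (g : ℝ) * ‖kloosterman U p.1 p.2‖ ^ 4 := by
        refine Finset.sum_le_sum fun p _ => mul_le_mul_of_nonneg_right ?_ (by positivity)
        exact_mod_cast hfib p
    _ = g * ∑ α : ZMod K, ∑ β : ZMod K, ‖kloosterman U α β‖ ^ 4 := by
        rw [← Finset.mul_sum, Fintype.sum_prod_type]
    _ ≤ _ := mul_le_mul_of_nonneg_left (sum_norm_kloosterman_pow_four_le U) (by positivity)

/-- The units modulo `K` that reduce to `w` modulo `M`. -/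
noncomputable def unitsOver {M : ℕ} (hMK : M ∣ K) (w : (ZMod M)ˣ) : Finset (ZMod K)ˣ :=
  Finset.univ.filter fun u => ZMod.unitsMap hMK u = w

theorem mem_unitsOver {M : ℕ} (hMK : M ∣ K) (w : (ZMod M)ˣ) (u : (ZMod K)ˣ) :
    u ∈ unitsOver hMK w ↔ ZMod.unitsMap hMK u = w := by
  simp [unitsOver]

theorem card_unitsOver {M : ℕ} [NeZero M] (hMK : M ∣ K) (w : (ZMod M)ˣ) :
    (unitsOver hMK w).card = (unitsOver hMK (1 : (ZMod M)ˣ)).card :=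
  MonoidHom.card_fiber_eq_of_mem_range (ZMod.unitsMap hMK)
    (ZMod.unitsMap_surjective hMK w) (ZMod.unitsMap_surjective hMK 1)

theorem totient_le_mul_card_unitsOver {M : ℕ} [NeZero M] (hMK : M ∣ K) :
    K.totient ≤ M * (unitsOver hMK (1 : (ZMod M)ˣ)).card := by
  classical
  rw [← ZMod.card_units_eq_totient, ← Finset.card_univ,
    Finset.card_eq_sum_card_fiberwise (f := ZMod.unitsMap hMK) (t := Finset.univ)
      (fun _ _ => Finset.mem_univ _)]
  calc _ = ∑ _w : (ZMod M)ˣ, (unitsOver hMK (1 : (ZMod M)ˣ)).card :=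
        Finset.sum_congr rfl fun w _ => by rw [← card_unitsOver hMK w, unitsOver]
    _ = Fintype.card (ZMod M)ˣ * (unitsOver hMK (1 : (ZMod M)ˣ)).card := by
        rw [Finset.sum_const, smul_eq_mul, Finset.card_univ]
    _ ≤ _ := Nat.mul_le_mul_right _ (by
        rw [ZMod.card_units_eq_totient]; exact Nat.totient_le M)

/-- The units congruent to 1 modulo M stabilise the class of w, and there are at least φ(K)/M ≥ K/(M
d(K)) of them. The gcd may be taken with either frequency, whichever is nonzero. -/
theorem norm_kloosterman_unitsOver_le {M : ℕ} [NeZero M] (hMK : M ∣ K) (w : (ZMod M)ˣ)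
    (α β : ZMod K) (g : ℕ) (hg : g = Nat.gcd α.val K ∨ g = Nat.gcd β.val K) :
    ‖kloosterman (unitsOver hMK w) α β‖ ≤
      (2 * M * (K : ℝ) ^ 3 * (K.divisors.card : ℝ) ^ 3) ^ ((1 : ℝ) / 4) * g := by
  have hK0 : (0 : ℝ) < K := by exact_mod_cast Nat.pos_of_ne_zero (NeZero.ne K)
  have hd0 : (0 : ℝ) < K.divisors.card := by
    exact_mod_cast Finset.card_pos.2 ⟨1, Nat.one_mem_divisors.2 (NeZero.ne K)⟩
  set X := ‖kloosterman (unitsOver hMK w) α β‖ with hX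
  have h1 := card_mul_norm_kloosterman_pow_four_le (unitsOver hMK w) (unitsOver hMK 1)
    (fun v hv u => by
      rw [mem_unitsOver] at hv
      rw [mem_unitsOver, mem_unitsOver, map_mul, hv, one_mul]) α β g hg
  have h2 : (K.totient : ℝ) ≤ M * (unitsOver hMK (1 : (ZMod M)ˣ)).card := by
    exact_mod_cast totient_le_mul_card_unitsOver hMK
  have h3 : (K : ℝ) ≤ K.totient * K.divisors.card := by
    exact_mod_cast le_totient_mul_card_divisors (NeZero.ne K)
  have hX0 : 0 ≤ X := norm_nonneg _
  have hg1 : (1 : ℝ) ≤ g := by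
    have h0 : 0 < K := Nat.pos_of_ne_zero (NeZero.ne K)
    have : 0 < g := by
      rcases hg with rfl | rfl <;> exact Nat.gcd_pos_of_pos_right _ h0
    exact_mod_cast this
  have h4 : (K : ℝ) * X ^ 4 ≤ K * (2 * M * (K : ℝ) ^ 3 * (K.divisors.card : ℝ) ^ 3 * g) := by
    calc (K : ℝ) * X ^ 4 ≤ K.totient * K.divisors.card * X ^ 4 := by gcongr
      _ ≤ M * (unitsOver hMK (1 : (ZMod M)ˣ)).card * K.divisors.card * X ^ 4 := by gcongr
      _ = M * K.divisors.card * ((unitsOver hMK (1 : (ZMod M)ˣ)).card * X ^ 4) := by ring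
      _ ≤ M * K.divisors.card *
          (g * ((K : ℝ) ^ 2 * (2 * (K * K.divisors.card) ^ 2))) := by gcongr
      _ = _ := by ring
  -- Weakening g to g⁴ only makes the fourth root tidy.
  have h5 : X ^ 4 ≤ 2 * M * (K : ℝ) ^ 3 * (K.divisors.card : ℝ) ^ 3 * g ^ 4 := by
    refine (le_of_mul_le_mul_left h4 hK0).trans ?_
    refine mul_le_mul_of_nonneg_left ?_ (by positivity)
    exact le_self_pow₀ hg1 (by norm_num)
  have h6 : ((2 * M * (K : ℝ) ^ 3 * (K.divisors.card : ℝ) ^ 3) ^ ((1 : ℝ) / 4) * g) ^ 4 =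
      2 * M * (K : ℝ) ^ 3 * (K.divisors.card : ℝ) ^ 3 * g ^ 4 := by
    rw [mul_pow, ← Real.rpow_natCast, ← Real.rpow_mul (by positivity)]
    norm_num
  exact le_of_pow_le_pow_left₀ (by norm_num) (by positivity) (h5.trans h6.ge)

end


/-! ### Bilinear sums over units and inverses -/

/-- The cyclic total variation of a function on `ℤ / K`. -/
noncomputable def cyclicVariation {K : ℕ} [NeZero K] (f : ZMod K → ℂ) : ℝ :=
  ∑ x : ZMod K, ‖f (x + 1) - f x‖

/-- The norm is 2 sin(πa/K), and Jordan's inequality sin t ≥ 2t/π applies to whichever of a and K -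
a is at most K/2. -/
theorem four_le_mul_norm_exp_sub_one {a K : ℕ} (ha : 0 < a) (haK : a < K) :
    4 ≤ K * (1 / (a : ℝ) + 1 / ((K : ℝ) - a)) * ‖cexp (2 * π * I * (a / K)) - 1‖ := by
  have ha0 : (0 : ℝ) < a := by exact_mod_cast ha
  have hKa : (0 : ℝ) < (K : ℝ) - a := by
    have : (a : ℝ) < K := by exact_mod_cast haK
    linarith
  have hK0 : (0 : ℝ) < K := by linarith
  have hnorm : ‖cexp (2 * π * I * (a / K)) - 1‖ = 2 * Real.sin (π * a / K) := by
    have : (2 * π * I * (a / K) : ℂ) = I * ((2 * π * a / K : ℝ) : ℂ) := by push_cast; ring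
    rw [this, Complex.norm_exp_I_mul_ofReal_sub_one]
    have h2 : 2 * π * a / K / 2 = π * a / K := by ring
    rw [h2, Real.norm_of_nonneg]
    refine mul_nonneg (by norm_num) (Real.sin_nonneg_of_nonneg_of_le_pi (by positivity) ?_)
    rw [div_le_iff₀ hK0]
    nlinarith [Real.pi_pos]
  rw [hnorm]
  rcases le_total (2 * (a : ℝ)) K with h | h
  · have hs : 2 / π * (π * a / K) ≤ Real.sin (π * a / K) := by
      refine Real.mul_le_sin (by positivity) ?_
      rw [div_le_iff₀ hK0]
      nlinarith [Real.pi_pos]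
    have e : 2 / π * (π * a / K) = 2 * a / K := by field_simp
    rw [e] at hs
    have h1 : (0 : ℝ) < 1 / ((K : ℝ) - a) := by positivity
    calc (4 : ℝ) = K * (1 / a) * (2 * (2 * a / K)) := by field_simp; norm_num
      _ ≤ K * (1 / (a : ℝ) + 1 / ((K : ℝ) - a)) * (2 * Real.sin (π * a / K)) := by
        gcongr
        linarith
  · have hs : 2 / π * (π * ((K : ℝ) - a) / K) ≤ Real.sin (π * ((K : ℝ) - a) / K) := by
      refine Real.mul_le_sin (by positivity) ?_
      rw [div_le_iff₀ hK0]
      nlinarith [Real.pi_pos]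
    have e : 2 / π * (π * ((K : ℝ) - a) / K) = 2 * ((K : ℝ) - a) / K := by field_simp
    have e' : Real.sin (π * ((K : ℝ) - a) / K) = Real.sin (π * a / K) := by
      rw [← Real.sin_pi_sub]
      congr 1
      field_simp
      ring
    rw [e, e'] at hs
    have h1 : (0 : ℝ) < 1 / (a : ℝ) := by positivity
    calc (4 : ℝ) = K * (1 / ((K : ℝ) - a)) * (2 * (2 * ((K : ℝ) - a) / K)) := by
          field_simp; norm_num
      _ ≤ K * (1 / (a : ℝ) + 1 / ((K : ℝ) - a)) * (2 * Real.sin (π * a / K)) := by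
        gcongr
        linarith

/-! ### Fourier expansion of functions of bounded variation on ℤ/K -/

section

variable {K : ℕ} [NeZero K]

/-- The weights that bound the Fourier coefficients of functions of bounded variation. -/
noncomputable def fourierWeight (α : ZMod K) : ℝ :=
  if α = 0 then 1 else (1 / 4) * (1 / (α.val : ℝ) + 1 / ((K : ℝ) - α.val))

theorem fourierWeight_nonneg (α : ZMod K) : 0 ≤ fourierWeight α := by
  unfold fourierWeight
  split_ifs
  · norm_num
  · have : (α.val : ℝ) ≤ K := by exact_mod_cast (ZMod.val_lt α).le
    have : 0 ≤ (K : ℝ) - α.val := by linarith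
    positivity

theorem stdAddChar_eq_cexp (α : ZMod K) :
    ZMod.stdAddChar α = cexp (2 * π * I * ((α.val : ℕ) / K)) := by
  have h := ZMod.stdAddChar_coe (N := K) (α.val : ℤ)
  rw [Int.cast_natCast, ZMod.natCast_zmod_val] at h
  rw [h]
  congr 1
  push_cast
  ring

theorem sum_zmod_val {R : Type*} [AddCommMonoid R] (F : ℕ → R) :
    ∑ α : ZMod K, F α.val = ∑ j ∈ Finset.range K, F j := by
  refine Finset.sum_nbij (fun x => x.val) (fun x _ => Finset.mem_range.2 (ZMod.val_lt x))
    (fun a _ b _ h => ZMod.val_injective K h) (fun j hj => ?_) fun _ _ => rfl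
  simp only [Finset.coe_range, Set.mem_Iio] at hj
  exact ⟨(j : ZMod K), by simp, ZMod.val_cast_of_lt hj⟩

open ZMod in
-- Summation by parts: multiplying the transform by e(α/K) - 1 gives the transform of the difference
-- f(x + 1) - f(x), which is at most the variation. At α = 0 only the size of f is available.
theorem norm_dft_le (f : ZMod K → ℂ) (A : ℝ) (hA : ∀ x, ‖f x‖ ≤ A) (hV : cyclicVariation f ≤ A)
    (α : ZMod K) : ‖𝓕 f α‖ ≤ A * (K * fourierWeight α) := by
  rw [fourierWeight]
  split_ifs with h
  · rw [h, dft_apply_zero, mul_one]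
    refine (norm_sum_le _ _).trans ((Finset.sum_le_sum fun x _ => hA x).trans ?_)
    rw [Finset.sum_const, Finset.card_univ, ZMod.card, nsmul_eq_mul, mul_comm]
  · have hA0 : 0 ≤ A := (norm_nonneg _).trans (hA 0)
    have h1 : (stdAddChar α - 1) * 𝓕 f α =
        ∑ j : ZMod K, stdAddChar (-(j * α)) * (f (j + 1) - f j) := by
      have e : ∑ j : ZMod K, stdAddChar (-(j * α)) * f (j + 1) = stdAddChar α * 𝓕 f α := by
        rw [dft_apply, Finset.mul_sum]
        refine Fintype.sum_equiv (Equiv.addRight 1) _ _ fun j => ?_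
        rw [smul_eq_mul, ← mul_assoc, ← AddChar.map_add_eq_mul]
        simp only [Equiv.coe_addRight]
        congr 2
        ring
      rw [sub_mul, one_mul, ← e, dft_apply, ← Finset.sum_sub_distrib]
      refine Finset.sum_congr rfl fun j _ => ?_
      rw [smul_eq_mul, mul_sub]
    have h2 : ‖stdAddChar α - 1‖ * ‖𝓕 f α‖ ≤ A := by
      rw [← norm_mul, h1]
      refine (norm_sum_le _ _).trans (le_trans (le_of_eq ?_) hV)
      refine Finset.sum_congr rfl fun j _ => ?_
      rw [norm_mul, AddChar.norm_apply, one_mul]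
    have hpos : 0 < α.val := Nat.pos_of_ne_zero ((ZMod.val_ne_zero α).2 h)
    have h3 := four_le_mul_norm_exp_sub_one hpos (ZMod.val_lt α)
    have h4 := stdAddChar_eq_cexp α
    rw [← h4] at h3
    set W : ℝ := 1 / (α.val : ℝ) + 1 / ((K : ℝ) - α.val) with hW
    have hW0 : 0 ≤ W := by
      have : (α.val : ℝ) ≤ K := by exact_mod_cast (ZMod.val_lt α).le
      have : 0 ≤ (K : ℝ) - α.val := by linarith
      positivity
    have h5 : 4 * ‖𝓕 f α‖ ≤ K * W * A := by
      calc 4 * ‖𝓕 f α‖ ≤ (K * W * ‖stdAddChar α - 1‖) * ‖𝓕 f α‖ := by gcongr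
        _ = K * W * (‖stdAddChar α - 1‖ * ‖𝓕 f α‖) := by ring
        _ ≤ _ := by gcongr
    nlinarith

/-- The reflection j ↦ K - j preserves gcd(j, K) and exchanges the two halves of the weight, so both
reduce to `sum_gcd_div_le`. -/
theorem sum_fourierWeight_mul_gcd_le :
    ∑ α : ZMod K, (if α = 0 then 0 else fourierWeight α * (Nat.gcd α.val K : ℝ)) ≤
      (1 / 2) * (K.divisors.card * (1 + Real.log K)) := by
  have hK : 0 < K := Nat.pos_of_ne_zero (NeZero.ne K)
  have h1 : ∑ α : ZMod K, (if α = 0 then 0 else fourierWeight α * (Nat.gcd α.val K : ℝ)) =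
      ∑ j ∈ Finset.Ico 1 K, (1 / 4) * (1 / (j : ℝ) + 1 / ((K : ℝ) - j)) * (Nat.gcd j K : ℝ) := by
    calc _ = ∑ α : ZMod K, (fun j : ℕ => if j = 0 then (0 : ℝ) else
          (1 / 4) * (1 / (j : ℝ) + 1 / ((K : ℝ) - j)) * (Nat.gcd j K : ℝ)) α.val := by
          refine Finset.sum_congr rfl fun α _ => ?_
          by_cases h : α = 0
          · simp [h]
          · simp only [h, if_false, fourierWeight, ZMod.val_eq_zero]
      _ = _ := by
          refine (sum_zmod_val (K := K) (fun j : ℕ => if j = 0 then (0 : ℝ) else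
            (1 / 4) * (1 / (j : ℝ) + 1 / ((K : ℝ) - j)) * (Nat.gcd j K : ℝ))).trans ?_
          rw [Finset.range_eq_Ico, Finset.sum_eq_sum_Ico_succ_bot hK]
          simp only [if_true, zero_add]
          refine Finset.sum_congr rfl fun j hj => ?_
          rw [if_neg (by have := (Finset.mem_Ico.1 hj).1; omega)]
  have h2 : ∑ j ∈ Finset.Ico 1 K, (Nat.gcd j K : ℝ) / ((K : ℝ) - j) =
      ∑ j ∈ Finset.Ico 1 K, (Nat.gcd j K : ℝ) / j := by
    refine Finset.sum_nbij' (fun j => K - j) (fun j => K - j) ?_ ?_ ?_ ?_ ?_ <;>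
      intro j hj <;> rw [Finset.mem_Ico] at hj
    · rw [Finset.mem_Ico]; omega
    · rw [Finset.mem_Ico]; omega
    · omega
    · omega
    · rw [Nat.cast_sub hj.2.le]
      congr 2
      rw [Nat.gcd_comm (K - j), Nat.gcd_self_sub_right hj.2.le, Nat.gcd_comm]
  have h3 : ∑ j ∈ Finset.Ico 1 K, (Nat.gcd j K : ℝ) / j ≤ K.divisors.card * (1 + Real.log K) := by
    refine le_trans ?_ (sum_gcd_div_le K hK.ne')
    refine Finset.sum_le_sum_of_subset_of_nonneg (fun j hj => ?_) fun _ _ _ => by positivity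
    rw [Finset.mem_Ico] at hj
    exact Finset.mem_Icc.2 ⟨hj.1, hj.2.le⟩
  rw [h1]
  calc _ = (1 / 4) * (∑ j ∈ Finset.Ico 1 K, (Nat.gcd j K : ℝ) / j +
        ∑ j ∈ Finset.Ico 1 K, (Nat.gcd j K : ℝ) / ((K : ℝ) - j)) := by
        rw [← Finset.sum_add_distrib, Finset.mul_sum]
        exact Finset.sum_congr rfl fun j _ => by ring
    _ ≤ _ := by rw [h2]; linarith

theorem sum_fourierWeight_le :
    ∑ α : ZMod K, fourierWeight α ≤ 1 + (1 / 2) * (K.divisors.card * (1 + Real.log K)) := by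
  have hK : 0 < K := Nat.pos_of_ne_zero (NeZero.ne K)
  have h : ∀ α : ZMod K, fourierWeight α ≤ (if α = 0 then 1 else 0) +
      (if α = 0 then 0 else fourierWeight α * (Nat.gcd α.val K : ℝ)) := by
    intro α
    by_cases h0 : α = 0
    · simp [h0, fourierWeight]
    · have : (1 : ℝ) ≤ Nat.gcd α.val K := by
        exact_mod_cast Nat.gcd_pos_of_pos_right _ hK
      simp only [h0, if_false, zero_add]
      exact le_mul_of_one_le_right (fourierWeight_nonneg α) this
  refine (Finset.sum_le_sum fun α _ => h α).trans ?_
  rw [Finset.sum_add_distrib, Finset.sum_ite_eq' Finset.univ (0 : ZMod K)]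
  simp only [Finset.mem_univ, if_true]
  linarith [sum_fourierWeight_mul_gcd_le (K := K)]

open ZMod in
theorem sum_mul_inv_eq (U : Finset (ZMod K)ˣ) (a b : ZMod K → ℂ) :
    ∑ u ∈ U, a u * b ((u⁻¹ : (ZMod K)ˣ) : ZMod K) =
      ((K : ℂ)⁻¹) ^ 2 * ∑ α : ZMod K, ∑ β : ZMod K, 𝓕 a α * 𝓕 b β * kloosterman U α β := by
  have inv (f : ZMod K → ℂ) (x : ZMod K) :
      f x = (K : ℂ)⁻¹ * ∑ α : ZMod K, stdAddChar (α * x) * 𝓕 f α := by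
    have := invDFT_apply (𝓕 f) x
    rw [LinearEquiv.symm_apply_apply] at this
    simpa [smul_eq_mul] using this
  calc _ = ∑ u ∈ U, ((K : ℂ)⁻¹) ^ 2 * ∑ α : ZMod K, ∑ β : ZMod K, 𝓕 a α * 𝓕 b β *
        stdAddChar (α * (u : ZMod K) + β * ((u⁻¹ : (ZMod K)ˣ) : ZMod K)) := by
        refine Finset.sum_congr rfl fun u _ => ?_
        rw [inv a u, inv b, mul_mul_mul_comm, ← sq, Finset.sum_mul_sum]
        congr 1
        refine Finset.sum_congr rfl fun α _ => Finset.sum_congr rfl fun β _ => ?_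
        rw [AddChar.map_add_eq_mul]
        ring
    _ = _ := by
        rw [← Finset.mul_sum, Finset.sum_comm]
        congr 1
        refine Finset.sum_congr rfl fun α _ => ?_
        rw [Finset.sum_comm]
        refine Finset.sum_congr rfl fun β _ => ?_
        rw [kloosterman, Finset.mul_sum]

open ZMod in
-- After Fourier inversion in both factors, each pair of frequencies other than (0, 0) has a nonzero
-- member whose gcd with K controls the Kloosterman sum. The hypothesis `h0` removes (0, 0), where
-- the sum has no cancellation.
theorem norm_sum_unitsOver_mul_inv_le {M : ℕ} [NeZero M] (hMK : M ∣ K) (w : (ZMod M)ˣ)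
    (a b : ZMod K → ℂ) (A B : ℝ) (ha : ∀ x, ‖a x‖ ≤ A) (hva : cyclicVariation a ≤ A)
    (hb : ∀ x, ‖b x‖ ≤ B) (hvb : cyclicVariation b ≤ B)
    (h0 : (∑ x, a x) * ∑ x, b x = 0) :
    ‖∑ u ∈ unitsOver hMK w, a u * b ((u⁻¹ : (ZMod K)ˣ) : ZMod K)‖ ≤
      2 * A * B * (2 * M * (K : ℝ) ^ 3 * (K.divisors.card : ℝ) ^ 3) ^ ((1 : ℝ) / 4) *
        (K.divisors.card * (1 + Real.log K)) ^ 2 := by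
  have hK : 0 < K := Nat.pos_of_ne_zero (NeZero.ne K)
  have hK0 : (0 : ℝ) < K := by exact_mod_cast hK
  have hA : 0 ≤ A := (norm_nonneg _).trans (ha 0)
  have hB : 0 ≤ B := (norm_nonneg _).trans (hb 0)
  have hd1 : (1 : ℝ) ≤ K.divisors.card := by
    exact_mod_cast Finset.card_pos.2 ⟨1, Nat.one_mem_divisors.2 (NeZero.ne K)⟩
  have hl1 : 0 ≤ Real.log K := Real.log_natCast_nonneg K
  set T : ℝ := (2 * M * (K : ℝ) ^ 3 * (K.divisors.card : ℝ) ^ 3) ^ ((1 : ℝ) / 4) with hT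
  have hT0 : 0 ≤ T := by positivity
  set X : ℝ := K.divisors.card * (1 + Real.log K) with hX
  have hX1 : 1 ≤ X := by rw [hX]; nlinarith
  -- The gcd is attached to a nonzero frequency only; at zero it would equal K and ruin the bound.
  set v : ZMod K → ℝ := fun α => if α = 0 then 0 else fourierWeight α * (Nat.gcd α.val K : ℝ)
    with hv
  have hw0 := fourierWeight_nonneg (K := K)
  have hv0 : ∀ α, 0 ≤ v α := fun α => by
    simp only [hv]
    split_ifs
    · exact le_rfl
    · exact mul_nonneg (hw0 α) (by positivity)
  have hterm : ∀ α β : ZMod K, ‖𝓕 a α * 𝓕 b β * kloosterman (unitsOver hMK w) α β‖ ≤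
      A * B * (K : ℝ) ^ 2 * T * (v α * fourierWeight β + fourierWeight α * v β) := by
    intro α β
    rw [norm_mul, norm_mul]
    have h1 := norm_dft_le a A ha hva α
    have h2 := norm_dft_le b B hb hvb β
    have h12 : ‖𝓕 a α‖ * ‖𝓕 b β‖ ≤
        A * (K * fourierWeight α) * (B * (K * fourierWeight β)) :=
      mul_le_mul h1 h2 (norm_nonneg _) ((norm_nonneg _).trans h1)
    have hcoef : 0 ≤ A * (K * fourierWeight α) * (B * (K * fourierWeight β)) :=
      (mul_nonneg (norm_nonneg _) (norm_nonneg _)).trans h12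
    have hAB : 0 ≤ A * B * (K : ℝ) ^ 2 * T := by positivity
    by_cases hα : α = 0
    · by_cases hβ : β = 0
      · have hz : ‖𝓕 a α‖ * ‖𝓕 b β‖ = 0 := by
          rw [hα, hβ, dft_apply_zero, dft_apply_zero, ← norm_mul, h0, norm_zero]
        rw [hz, zero_mul]
        exact mul_nonneg hAB (add_nonneg (mul_nonneg (hv0 _) (hw0 _)) (mul_nonneg (hw0 _) (hv0 _)))
      · have h3 := norm_kloosterman_unitsOver_le hMK w α β _ (Or.inr rfl)
        refine (mul_le_mul h12 h3 (norm_nonneg _) hcoef).trans ?_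
        have e : v β = fourierWeight β * (Nat.gcd β.val K : ℝ) := by simp [hv, hβ]
        have : 0 ≤ A * B * (K : ℝ) ^ 2 * T * (v α * fourierWeight β) :=
          mul_nonneg hAB (mul_nonneg (hv0 _) (hw0 _))
        rw [mul_add, e]
        refine le_trans (le_of_eq ?_) (le_add_of_nonneg_left this)
        ring
    · have h3 := norm_kloosterman_unitsOver_le hMK w α β _ (Or.inl rfl)
      refine (mul_le_mul h12 h3 (norm_nonneg _) hcoef).trans ?_
      have e : v α = fourierWeight α * (Nat.gcd α.val K : ℝ) := by simp [hv, hα]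
      have : 0 ≤ A * B * (K : ℝ) ^ 2 * T * (fourierWeight α * v β) :=
        mul_nonneg hAB (mul_nonneg (hw0 _) (hv0 _))
      rw [mul_add, e]
      refine le_trans (le_of_eq ?_) (le_add_of_nonneg_right this)
      ring
  have hsum : ‖∑ α : ZMod K, ∑ β : ZMod K, 𝓕 a α * 𝓕 b β *
      kloosterman (unitsOver hMK w) α β‖ ≤
      A * B * (K : ℝ) ^ 2 * T * (2 * ((∑ α, v α) * ∑ β : ZMod K, fourierWeight β)) := by
    refine (norm_sum_le _ _).trans ((Finset.sum_le_sum fun α _ => (norm_sum_le _ _).trans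
      (Finset.sum_le_sum fun β _ => hterm α β)).trans (le_of_eq ?_))
    simp_rw [← Finset.mul_sum]
    congr 1
    rw [two_mul]
    nth_rw 2 [mul_comm]
    rw [Finset.sum_mul_sum, Finset.sum_mul_sum, ← Finset.sum_add_distrib]
    exact Finset.sum_congr rfl fun α _ => Finset.sum_add_distrib
  have hG : (∑ α, v α) * ∑ β : ZMod K, fourierWeight β ≤ X ^ 2 := by
    calc (∑ α, v α) * ∑ β : ZMod K, fourierWeight β ≤ ((1 / 2) * X) * (1 + (1 / 2) * X) := by
          refine mul_le_mul sum_fourierWeight_mul_gcd_le sum_fourierWeight_le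
            (Finset.sum_nonneg fun β _ => hw0 β) (by positivity)
      _ ≤ X ^ 2 := by nlinarith
  rw [sum_mul_inv_eq, norm_mul, norm_pow, norm_inv, Complex.norm_natCast]
  calc (K : ℝ)⁻¹ ^ 2 * _ ≤ (K : ℝ)⁻¹ ^ 2 * (A * B * (K : ℝ) ^ 2 * T *
        (2 * ((∑ α, v α) * ∑ β : ZMod K, fourierWeight β))) := by gcongr
    _ ≤ (K : ℝ)⁻¹ ^ 2 * (A * B * (K : ℝ) ^ 2 * T * (2 * X ^ 2)) := by gcongr
    _ = 2 * A * B * T * X ^ 2 := by field_simp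

end

/-- Power saving for bilinear sums over the inverses in a residue class. -/
theorem exists_norm_sum_unitsOver_mul_inv_le (M : ℕ) [NeZero M] :
    ∃ C : ℝ, 0 ≤ C ∧ ∀ (K : ℕ) [NeZero K] (hMK : M ∣ K) (w : (ZMod M)ˣ) (a b : ZMod K → ℂ)
      (A B : ℝ), (∀ x, ‖a x‖ ≤ A) → cyclicVariation a ≤ A → (∀ x, ‖b x‖ ≤ B) →
      cyclicVariation b ≤ B → (∑ x, a x) * ∑ x, b x = 0 →
      ‖∑ u ∈ unitsOver hMK w, a u * b ((u⁻¹ : (ZMod K)ˣ) : ZMod K)‖ ≤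
        C * A * B * (K : ℝ) ^ ((7 : ℝ) / 8) := by
  -- Three divisor functions and two logarithms cost five factors K^(1/64), and 3/4 + 5/64 < 7/8.
  obtain ⟨D, hD1, hD⟩ := exists_card_divisors_le (ε := 1 / 64) (by norm_num)
  refine ⟨2 * (2 * M) ^ ((1 : ℝ) / 4) * D ^ 3 * 65 ^ 2, by positivity, ?_⟩
  intro K _ hMK w a b A B ha hva hb hvb h0
  have hK : 0 < K := Nat.pos_of_ne_zero (NeZero.ne K)
  have hK1 : (1 : ℝ) ≤ K := by exact_mod_cast hK
  have hK0 : (0 : ℝ) < K := by linarith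
  have hA : 0 ≤ A := (norm_nonneg _).trans (ha 0)
  have hB : 0 ≤ B := (norm_nonneg _).trans (hb 0)
  have hd := hD K hK.ne'
  have hd1 : (1 : ℝ) ≤ K.divisors.card := by
    exact_mod_cast Finset.card_pos.2 ⟨1, Nat.one_mem_divisors.2 (NeZero.ne K)⟩
  have hl0 : 0 ≤ Real.log K := Real.log_natCast_nonneg K
  have hl : 1 + Real.log K ≤ 65 * (K : ℝ) ^ ((1 : ℝ) / 64) := by
    have h1 := Real.log_le_rpow_div hK0.le (ε := 1 / 64) (by norm_num)
    have h2 : 1 ≤ (K : ℝ) ^ ((1 : ℝ) / 64) := Real.one_le_rpow hK1 (by norm_num)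
    have h3 : (K : ℝ) ^ ((1 : ℝ) / 64) / (1 / 64) = 64 * (K : ℝ) ^ ((1 : ℝ) / 64) := by ring
    linarith
  refine (norm_sum_unitsOver_mul_inv_le hMK w a b A B ha hva hb hvb h0).trans ?_
  have hT : (2 * M * (K : ℝ) ^ 3 * (K.divisors.card : ℝ) ^ 3) ^ ((1 : ℝ) / 4) ≤
      (2 * M) ^ ((1 : ℝ) / 4) * (K : ℝ) ^ ((3 : ℝ) / 4) * K.divisors.card := by
    rw [Real.mul_rpow (by positivity) (by positivity), Real.mul_rpow (by positivity)
      (by positivity), ← Real.rpow_natCast, ← Real.rpow_natCast, ← Real.rpow_mul hK0.le,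
      ← Real.rpow_mul (by positivity)]
    have e : ((3 : ℕ) : ℝ) * (1 / 4) = 3 / 4 := by norm_num
    rw [e]
    refine mul_le_mul_of_nonneg_left ?_ (by positivity)
    calc (K.divisors.card : ℝ) ^ ((3 : ℝ) / 4) ≤ (K.divisors.card : ℝ) ^ (1 : ℝ) :=
          Real.rpow_le_rpow_of_exponent_le hd1 (by norm_num)
      _ = _ := Real.rpow_one _
  set κ : ℝ := (K : ℝ) ^ ((1 : ℝ) / 64) with hκ
  have hκ0 : 0 ≤ κ := by positivity
  have hexp : (K : ℝ) ^ ((3 : ℝ) / 4) * κ ^ 5 ≤ (K : ℝ) ^ ((7 : ℝ) / 8) := by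
    rw [hκ, ← Real.rpow_natCast, ← Real.rpow_mul hK0.le, ← Real.rpow_add hK0]
    exact Real.rpow_le_rpow_of_exponent_le hK1 (by norm_num)
  calc _ ≤ 2 * A * B * ((2 * M) ^ ((1 : ℝ) / 4) * (K : ℝ) ^ ((3 : ℝ) / 4) * K.divisors.card) *
        (K.divisors.card * (1 + Real.log K)) ^ 2 := by gcongr
    _ ≤ 2 * A * B * ((2 * M) ^ ((1 : ℝ) / 4) * (K : ℝ) ^ ((3 : ℝ) / 4) * (D * κ)) *
        ((D * κ) * (65 * κ)) ^ 2 := by gcongr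
    _ = 2 * (2 * M) ^ ((1 : ℝ) / 4) * D ^ 3 * 65 ^ 2 * A * B *
        ((K : ℝ) ^ ((3 : ℝ) / 4) * κ ^ 5) := by ring
    _ ≤ _ := by gcongr


/-! ### Dedekind sums -/

theorem sawtooth_natCast_div (n c : ℕ) (hc : 0 < c) :
    sawtooth ((n : ℝ) / c) = if c ∣ n then 0 else ((n % c : ℕ) : ℝ) / c - 1 / 2 := by
  have hc0 : (0 : ℝ) < c := by exact_mod_cast hc
  have hdm : (n : ℝ) = c * (n / c : ℕ) + (n % c : ℕ) := by
    exact_mod_cast (Nat.div_add_mod n c).symm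
  have hlt : ((n % c : ℕ) : ℝ) < c := by exact_mod_cast Nat.mod_lt n hc
  have hiff : (∃ a : ℤ, (a : ℝ) = (n : ℝ) / c) ↔ c ∣ n := by
    constructor
    · rintro ⟨a, ha⟩
      rw [eq_div_iff hc0.ne'] at ha
      have h1 : a * (c : ℤ) = n := by exact_mod_cast ha
      exact Int.natCast_dvd_natCast.1 ⟨a, by rw [← h1]; ring⟩
    · rintro ⟨a, rfl⟩
      exact ⟨a, by push_cast; field_simp⟩
  unfold sawtooth
  by_cases h : c ∣ n
  · rw [if_pos (hiff.2 h), if_pos h]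
  · rw [if_neg (fun h' => h (hiff.1 h')), if_neg h]
    have hfl : ⌊(n : ℝ) / c⌋ = ((n / c : ℕ) : ℤ) := by
      rw [Int.floor_eq_iff, Int.cast_natCast]
      constructor
      · rw [le_div_iff₀ hc0]
        have : (0 : ℝ) ≤ (n % c : ℕ) := by positivity
        linarith
      · rw [div_lt_iff₀ hc0]
        linarith
    rw [hfl]
    have : (n : ℝ) / c = (n / c : ℕ) + ((n % c : ℕ) : ℝ) / c := by
      field_simp
      linarith
    rw [this, Int.cast_natCast]
    ring

theorem dedekindSum_congr {c d d' : ℕ} (hc : 0 < c) (h : d ≡ d' [MOD c]) :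
    dedekindSum d c = dedekindSum d' c := by
  unfold dedekindSum
  refine Finset.sum_congr rfl fun n _ => ?_
  congr 1
  rw [← Nat.cast_mul, ← Nat.cast_mul, sawtooth_natCast_div _ _ hc, sawtooth_natCast_div _ _ hc]
  have hn : d * n ≡ d' * n [MOD c] := h.mul_right n
  have hd : c ∣ d * n ↔ c ∣ d' * n := by
    rw [Nat.dvd_iff_mod_eq_zero, Nat.dvd_iff_mod_eq_zero, hn]
  simp only [hd]
  rw [hn]

theorem sum_range_mul_mod {R : Type*} [AddCommMonoid R] {c d : ℕ} (hc : 0 < c)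
    (hd : Nat.Coprime d c) (F : ℕ → R) :
    ∑ n ∈ Finset.range c, F (d * n % c) = ∑ n ∈ Finset.range c, F n := by
  have hinj : Set.InjOn (fun n => d * n % c) (Finset.range c : Finset ℕ) := by
    intro a ha b hb hab
    rw [Finset.coe_range, Set.mem_Iio] at ha hb
    have h1 : d * a ≡ d * b [MOD c] := hab
    have h2 : a ≡ b [MOD c] := Nat.ModEq.cancel_left_of_coprime (Nat.coprime_comm.1 hd) h1
    exact Nat.ModEq.eq_of_lt_of_lt h2 ha hb
  rw [← Finset.sum_image (f := F) hinj]
  congr 1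
  refine Finset.eq_of_subset_of_card_le (fun j hj => ?_) ?_
  · obtain ⟨n, _, rfl⟩ := Finset.mem_image.1 hj
    exact Finset.mem_range.2 (Nat.mod_lt _ hc)
  · rw [Finset.card_image_of_injOn hinj]

theorem two_mul_sum_range_id (c : ℕ) :
    2 * ∑ n ∈ Finset.range c, (n : ℤ) = c * (c - 1) := by
  induction c with
  | zero => simp
  | succ c ih => rw [Finset.sum_range_succ, mul_add, ih]; push_cast; ring

theorem six_mul_sum_range_sq (c : ℕ) :
    6 * ∑ n ∈ Finset.range c, (n : ℤ) ^ 2 = c * (c - 1) * (2 * c - 1) := by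
  induction c with
  | zero => simp
  | succ c ih => rw [Finset.sum_range_succ, mul_add, ih]; push_cast; ring

/-- `12 c s(d,c)` is an integer, which is known modulo `12 c` up to the factor `d`. -/
theorem exists_twelve_mul_dedekindSum {c d : ℕ} (hc : 0 < c) (hd : Nat.Coprime d c) :
    ∃ T : ℤ, 12 * (c : ℝ) * dedekindSum d c = T ∧
      (12 * c : ℤ) ∣ d * T - (c - 1) * (((d : ℤ) ^ 2 + 1) * (2 * c - 1) - 3 * c * (2 * d - 1)) := by
  have hc0 : (0 : ℝ) < c := by exact_mod_cast hc
  have hcz : (c : ℤ) ≠ 0 := by exact_mod_cast hc.ne'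
  set S₁ := ∑ n ∈ Finset.range c, (n : ℤ) with hS₁
  set S₂ := ∑ n ∈ Finset.range c, (n : ℤ) ^ 2 with hS₂
  set F := ∑ n ∈ Finset.range c, ((d * n / c : ℕ) : ℤ) with hF
  set F₂ := ∑ n ∈ Finset.range c, ((d * n / c : ℕ) : ℤ) ^ 2 with hF₂
  set G := ∑ n ∈ Finset.range c, (n : ℤ) * ((d * n / c : ℕ) : ℤ) with hG
  have hr : ∀ n : ℕ, ((d * n % c : ℕ) : ℤ) = d * n - c * ((d * n / c : ℕ) : ℤ) := by
    intro n
    have : ((c * (d * n / c) + d * n % c : ℕ) : ℤ) = ((d * n : ℕ) : ℤ) := by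
      rw [Nat.div_add_mod]
    push_cast at this ⊢
    linarith
  -- The residues of dn modulo c are a permutation of 0, …, c - 1; comparing first and second
  -- moments gives `h1` and `h2`.
  have h1 : (d : ℤ) * S₁ - c * F = S₁ := by
    have := sum_range_mul_mod hc hd (fun n => (n : ℤ))
    simp_rw [hr, Finset.sum_sub_distrib, ← Finset.mul_sum] at this
    exact this
  have h2 : (d : ℤ) ^ 2 * S₂ - 2 * d * c * G + c ^ 2 * F₂ = S₂ := by
    have := sum_range_mul_mod hc hd (fun n => (n : ℤ) ^ 2)
    simp_rw [hr] at this
    refine Eq.trans ?_ this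
    rw [hS₂, hG, hF₂, Finset.mul_sum, Finset.mul_sum, Finset.mul_sum,
      ← Finset.sum_sub_distrib, ← Finset.sum_add_distrib]
    exact Finset.sum_congr rfl fun n _ => by ring
  have e1 : 2 * S₁ = c * (c - 1) := two_mul_sum_range_id c
  have e2 : 6 * S₂ = c * (c - 1) * (2 * c - 1) := six_mul_sum_range_sq c
  -- The parity of q² - q turns the unknown sum of squares of the quotients into the known F modulo
  -- 2; with the factor 6c in front, this fixes 12dG modulo 12c.
  obtain ⟨z, hz⟩ : ∃ z : ℤ, F₂ = F + 2 * z := by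
    have : (2 : ℤ) ∣ F₂ - F := by
      rw [hF, hF₂, ← Finset.sum_sub_distrib]
      refine Finset.dvd_sum fun n _ => ?_
      have h := Int.even_mul_pred_self ((d * n / c : ℕ) : ℤ)
      have e : ((d * n / c : ℕ) : ℤ) ^ 2 - ((d * n / c : ℕ) : ℤ) =
        ((d * n / c : ℕ) : ℤ) * (((d * n / c : ℕ) : ℤ) - 1) := by ring
      rw [e]
      exact h.two_dvd
    obtain ⟨z, hz⟩ := this
    exact ⟨z, by linarith⟩
  refine ⟨2 * d * (c - 1) * (2 * c - 1) - 12 * G - 3 * c * (c - 1), ?_, ?_⟩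
  -- With fractional part minus 1/2 in place of the sawtooth, only n = 0 changes: it gives 1/4
  -- instead of 0. Coprimality of d and c rules out other zeros.
  · have hs : dedekindSum d c = ∑ n ∈ Finset.range c,
        ((((d * n % c : ℕ) : ℤ) : ℝ) / c - 1 / 2) * ((n : ℝ) / c - 1 / 2) - 1 / 4 := by
      unfold dedekindSum
      have hsub : ∀ n ∈ Finset.range c, sawtooth ((d : ℝ) * n / c) * sawtooth ((n : ℝ) / c) =
          ((((d * n % c : ℕ) : ℤ) : ℝ) / c - 1 / 2) * ((n : ℝ) / c - 1 / 2) -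
            if n = 0 then 1 / 4 else 0 := by
        intro n hn
        have hnc := Finset.mem_range.1 hn
        rw [← Nat.cast_mul, sawtooth_natCast_div _ _ hc, sawtooth_natCast_div _ _ hc]
        by_cases h0 : n = 0
        · subst h0
          simp
          norm_num
        · have hcn : ¬ c ∣ n := fun h => h0 (Nat.eq_zero_of_dvd_of_lt h hnc)
          have hcd : ¬ c ∣ d * n := fun h => hcn (hd.symm.dvd_of_dvd_mul_left h)
          rw [if_neg hcn, if_neg hcd, if_neg h0, Nat.mod_eq_of_lt hnc, Int.cast_natCast]
          ring
      rw [Finset.sum_congr rfl hsub, Finset.sum_sub_distrib, Finset.sum_ite_eq',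
        if_pos (Finset.mem_range.2 hc)]
    have hexp : ∑ n ∈ Finset.range c,
        ((((d * n % c : ℕ) : ℤ) : ℝ) / c - 1 / 2) * ((n : ℝ) / c - 1 / 2) =
        ((d * S₂ - c * G : ℤ) : ℝ) / c ^ 2 - ((d * S₁ - c * F : ℤ) : ℝ) / (2 * c) -
          (S₁ : ℝ) / (2 * c) + c / 4 := by
      simp_rw [hr]
      have : (c : ℝ) / 4 = ∑ n ∈ Finset.range c, (1 / 4 : ℝ) := by
        rw [Finset.sum_const, Finset.card_range, nsmul_eq_mul]; ring
      rw [this, hS₂, hG, hS₁, hF]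
      push_cast
      rw [Finset.mul_sum, Finset.mul_sum, Finset.mul_sum, Finset.mul_sum,
        ← Finset.sum_sub_distrib, ← Finset.sum_sub_distrib, Finset.sum_div, Finset.sum_div,
        Finset.sum_div, ← Finset.sum_sub_distrib, ← Finset.sum_sub_distrib,
        ← Finset.sum_add_distrib]
      refine Finset.sum_congr rfl fun n _ => ?_
      field_simp
      ring
    rw [hs, hexp, h1]
    have e1' : 2 * (S₁ : ℝ) = c * (c - 1) := by exact_mod_cast e1
    have e2' : 6 * (S₂ : ℝ) = c * (c - 1) * (2 * c - 1) := by exact_mod_cast e2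
    have e1'' : (S₁ : ℝ) = c * (c - 1) / 2 := by linarith
    have e2'' : (S₂ : ℝ) = c * (c - 1) * (2 * c - 1) / 6 := by linarith
    push_cast
    rw [e1'', e2'']
    field_simp
    ring
  · refine ⟨-z, ?_⟩
    apply mul_left_cancel₀ hcz
    have h3 : 2 * F = (d - 1) * (c - 1) := by
      apply mul_left_cancel₀ hcz
      linear_combination (d - 1 : ℤ) * e1 - 2 * h1
    have h4 : c * (12 * d * G) = c * ((d ^ 2 - 1) * (c - 1) * (2 * c - 1) + 6 * c * F₂) := by
      linear_combination (d ^ 2 - 1 : ℤ) * e2 - 6 * h2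
    linear_combination (-1 : ℤ) * h4 - 6 * (c : ℤ) ^ 2 * hz - 3 * (c : ℤ) ^ 2 * h3

theorem int_modEq_of_mul_modEq_one {M D₁ D₂ a₁ a₂ : ℤ} (h₁ : D₁ * a₁ ≡ 1 [ZMOD M])
    (h₂ : D₂ * a₂ ≡ 1 [ZMOD M]) (h : D₁ ≡ D₂ [ZMOD M]) : a₁ ≡ a₂ [ZMOD M] :=
  calc a₁ = a₁ * 1 := (mul_one _).symm
    _ ≡ a₁ * (D₂ * a₂) [ZMOD M] := (h₂.symm).mul_left a₁
    _ ≡ a₁ * (D₁ * a₂) [ZMOD M] := (h.symm.mul_right a₂).mul_left a₁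
    _ = (D₁ * a₁) * a₂ := by ring
    _ ≡ 1 * a₂ [ZMOD M] := h₁.mul_right a₂
    _ = a₂ := one_mul _

theorem isCoprime_of_mul_modEq_neg_one {h x N : ℤ} (H : h * x ≡ -1 [ZMOD N]) : IsCoprime h N := by
  obtain ⟨z, hz⟩ := H.dvd
  exact ⟨-x, -z, by linear_combination hz⟩

/-- The variation of `s(m h, c)` with `h` in a residue class modulo a highly divisible `M`. -/
theorem dedekindSum_sub_dedekindSum {c m M : ℕ} (hc : 0 < c) (hm : 0 < m) (hM : 0 < M)
    (hmc : Nat.Coprime m c) (hmM : 12 * m ∣ M) {h₁ h₂ : ℕ} {x₁ x₂ : ℤ}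
    (H₁ : h₁ * x₁ ≡ -1 [ZMOD (M * c : ℕ)]) (H₂ : h₂ * x₂ ≡ -1 [ZMOD (M * c : ℕ)])
    (hh : (h₁ : ℤ) ≡ h₂ [ZMOD M]) :
    ∃ z : ℤ, dedekindSum (m * h₁) c - dedekindSum (m * h₂) c =
      m * ((h₁ : ℝ) - h₂) / (12 * c) - ((x₁ : ℝ) - x₂) / (12 * c * m) + z := by
  have : NeZero (M * c) := ⟨(Nat.mul_pos hM hc).ne'⟩
  -- The argument mh need not be invertible modulo M, because m ∣ M. Since s(mh, c) depends only on
  -- mh modulo c, m is replaced by some n ≡ m (mod c) that is prime to Mc; w is the quotient (n -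
  -- m)/c.
  obtain ⟨u, hu⟩ := ZMod.unitsMap_surjective (Dvd.intro_left M rfl : c ∣ M * c)
    (ZMod.unitOfCoprime m hmc)
  set n : ℕ := (u : ZMod (M * c)).val with hn
  have hnco : Nat.Coprime n (M * c) := ZMod.val_coe_unit_coprime u
  have hnm : n ≡ m [MOD c] := by
    rw [← ZMod.natCast_eq_natCast_iff]
    have h := congrArg (fun v : (ZMod c)ˣ => (v : ZMod c)) hu
    simp only [ZMod.unitsMap_val, ZMod.coe_unitOfCoprime] at h
    rw [← h, hn, ZMod.natCast_val]
  obtain ⟨w, hw⟩ : ∃ w : ℤ, (n : ℤ) = m + c * w := by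
    obtain ⟨w, hw⟩ := (Int.natCast_modEq_iff.2 hnm).symm.dvd
    exact ⟨w, by linarith⟩
  obtain ⟨M', rfl⟩ : ∃ M', M = 12 * m * M' := hmM
  -- With a inverse to nh modulo 12cM, the congruence for d·T can be solved for T modulo 12c. Modulo
  -- c, both ma and -x are inverses of h, so y = (ma + x)/c is an integer, and dividing that
  -- relation by c determines y modulo 12m.
  have inv : ∀ {h : ℕ} {x : ℤ}, (h : ℤ) * x ≡ -1 [ZMOD (12 * m * M' * c : ℕ)] →
      ∃ a T y : ℤ, (n * h : ℤ) * a ≡ 1 [ZMOD (12 * c * (12 * m * M'))] ∧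
        12 * (c : ℝ) * dedekindSum (m * h) c = T ∧
        (12 * c : ℤ) ∣ T - (c - 1) * (((n * h : ℤ) + a) * (2 * c - 1) - 6 * c + 3 * c * a) ∧
        m * a + x = c * y ∧ y ≡ - w * a [ZMOD 12 * m] := by
    intro h x H
    have hco : IsCoprime (h : ℤ) (12 * m * M' * c : ℕ) := isCoprime_of_mul_modEq_neg_one H
    have hDco : IsCoprime ((n * h : ℕ) : ℤ) (12 * m * M' * c : ℕ) := by
      push_cast
      have := (Nat.isCoprime_iff_coprime.2 hnco).mul_left hco
      exact_mod_cast this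
    have hDco' : IsCoprime ((n * h : ℕ) : ℤ) (12 * c * (12 * m * M')) := by
      have e1 : IsCoprime ((n * h : ℕ) : ℤ) 12 := by
        refine hDco.of_isCoprime_of_dvd_right ⟨m * M' * c, by push_cast; ring⟩
      have := e1.mul_right hDco
      push_cast at this ⊢
      convert this using 1
      ring
    obtain ⟨a, v, hav⟩ := hDco'
    have hDc : Nat.Coprime (n * h) c := by
      rw [← Nat.isCoprime_iff_coprime]
      exact hDco.of_isCoprime_of_dvd_right ⟨12 * m * M', by push_cast; ring⟩
    obtain ⟨T, hT, q, hq⟩ := exists_twelve_mul_dedekindSum hc hDc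
    obtain ⟨p, hp⟩ := H.dvd
    push_cast at hav hq hp
    have hcy : (c : ℤ) ∣ m * a + x := by
      have hco_c : IsCoprime (h : ℤ) c :=
        hco.of_isCoprime_of_dvd_right ⟨12 * m * M', by push_cast; ring⟩
      refine hco_c.symm.dvd_of_dvd_mul_left (y := (h : ℤ)) ⟨-w * h * a - 12 * (12 * m * M') * v - 12 * m * M' * p, ?_⟩
      linear_combination hav - hp - (h * a : ℤ) * hw
    obtain ⟨y, hy⟩ := hcy
    refine ⟨a, T, y, ?_, ?_, ?_, hy, ?_⟩
    · refine (Int.modEq_iff_dvd.2 ⟨v, ?_⟩)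
      linear_combination -hav
    · rw [← hT, dedekindSum_congr hc (hnm.mul_right h)]
    · refine ⟨a * q + m * M' * 12 * v * T -
        m * M' * 12 * v * ((c - 1) * (n * h * (2 * c - 1) - 6 * c)), ?_⟩
      linear_combination a * hq - (T - (c - 1) * (n * h * (2 * c - 1) - 6 * c)) * hav
    · have hcz : (c : ℤ) ≠ 0 := by exact_mod_cast hc.ne'
      have hco_m : IsCoprime (h : ℤ) (12 * m) :=
        hco.of_isCoprime_of_dvd_right ⟨M' * c, by push_cast; ring⟩
      refine Int.modEq_iff_dvd.2 (hco_m.symm.dvd_of_dvd_mul_left (y := (h : ℤ)) ⟨12 * M' * v + M' * p, ?_⟩)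
      apply mul_left_cancel₀ hcz
      linear_combination (-1 : ℤ) * hav + hp + (h * a : ℤ) * hw + (h : ℤ) * hy
  obtain ⟨a₁, T₁, y₁, ha₁, hT₁, ⟨q₁, hq₁⟩, hy₁, hw₁⟩ := inv H₁
  obtain ⟨a₂, T₂, y₂, ha₂, hT₂, ⟨q₂, hq₂⟩, hy₂, hw₂⟩ := inv H₂
  have hD : (n * h₁ : ℤ) ≡ n * h₂ [ZMOD (12 * m * M')] := by
    have := hh.mul_left (n : ℤ)
    exact_mod_cast this
  -- As h₁ ≡ h₂ modulo M, the auxiliary a agrees modulo M and y modulo 12m. The differences of a can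
  -- then be traded for those of x, up to an integer in the final formula.
  have ha : a₁ ≡ a₂ [ZMOD (12 * m * M')] :=
    int_modEq_of_mul_modEq_one (ha₁.of_dvd ⟨12 * c, by ring⟩) (ha₂.of_dvd ⟨12 * c, by ring⟩) hD
  have hy : y₁ ≡ y₂ [ZMOD 12 * m] :=
    hw₁.trans (((ha.of_dvd ⟨(M' : ℤ), by ring⟩).mul_left (-w)).trans hw₂.symm)
  obtain ⟨ea, hea⟩ := ha.symm.dvd
  obtain ⟨ey, hey⟩ := hy.symm.dvd
  obtain ⟨eh, heh⟩ := hh.symm.dvd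
  push_cast at heh
  set e : ℤ := 12 * m * M' with he
  have hT : T₁ - T₂ = m * (h₁ - h₂) + (a₁ - a₂) + 12 * c * (q₁ - q₂ + w * m * M' * eh +
      (2 * c - 3) * m * M' * (n * eh + ea) + 3 * (c - 1) * m * M' * ea) := by
    linear_combination hq₁ - hq₂ + (h₁ - h₂ : ℤ) * hw + (c : ℤ) * w * heh +
      (c : ℤ) * (2 * c - 3) * (n * heh + hea) + 3 * (c : ℤ) * (c - 1) * hea
  refine ⟨q₁ - q₂ + w * m * M' * eh +
      (2 * c - 3) * m * M' * (n * eh + ea) + 3 * (c - 1) * m * M' * ea + ey, ?_⟩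
  have hcr : (c : ℝ) ≠ 0 := by exact_mod_cast hc.ne'
  have hmr : (m : ℝ) ≠ 0 := by exact_mod_cast hm.ne'
  have s₁ : dedekindSum (m * h₁) c = T₁ / (12 * c) := by rw [← hT₁]; field_simp
  have s₂ : dedekindSum (m * h₂) c = T₂ / (12 * c) := by rw [← hT₂]; field_simp
  have hTr : (T₁ : ℝ) - T₂ = m * (h₁ - h₂) + (a₁ - a₂) + 12 * c * (q₁ - q₂ + w * m * M' * eh +
      (2 * c - 3) * m * M' * (n * eh + ea) + 3 * (c - 1) * m * M' * ea) := by exact_mod_cast hT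
  have hyr : (m : ℝ) * (a₁ - a₂) + (x₁ - x₂) = c * (12 * m * ey) := by
    have : (m : ℤ) * (a₁ - a₂) + (x₁ - x₂) = c * (12 * m * ey) := by
      linear_combination hy₁ - hy₂ + (c : ℤ) * hey
    exact_mod_cast this
  have har : (a₁ : ℝ) - a₂ = (c * (12 * m * ey) - (x₁ - x₂)) / m := by
    field_simp
    linarith
  rw [s₁, s₂, ← sub_div, hTr, har]
  push_cast
  field_simp
  ring


/-! ### The multiplier of a fraction -/

/-- `e(x) = exp(2π i x)`. -/
noncomputable def ex (x : ℝ) : ℂ := cexp (2 * π * I * (x : ℂ))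

theorem ex_add (x y : ℝ) : ex (x + y) = ex x * ex y := by
  rw [ex, ex, ex, ← Complex.exp_add]; congr 1; push_cast; ring

theorem norm_ex (x : ℝ) : ‖ex x‖ = 1 := by
  have : (2 * π * I * (x : ℂ)) = ((2 * π * x : ℝ) : ℂ) * I := by push_cast; ring
  rw [ex, this, Complex.norm_exp_ofReal_mul_I]

theorem ex_intCast (z : ℤ) : ex z = 1 := by
  rw [ex, Complex.exp_eq_one_iff]
  exact ⟨z, by push_cast; ring⟩

theorem ex_eq_ex {x y : ℝ} (z : ℤ) (h : x - y = z) : ex x = ex y := by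
  have : x = y + z := by linarith
  rw [this, ex_add, ex_intCast, mul_one]

theorem ex_eq_one_iff (x : ℝ) : ex x = 1 ↔ ∃ z : ℤ, x = z := by
  rw [ex, Complex.exp_eq_one_iff]
  have h2 : (2 * π * I : ℂ) ≠ 0 := by simp [Real.pi_ne_zero]
  constructor
  · rintro ⟨z, hz⟩
    refine ⟨z, ?_⟩
    have : (x : ℂ) = z := by
      apply mul_left_cancel₀ h2
      rw [hz]; ring
    exact_mod_cast this
  · rintro ⟨z, rfl⟩
    exact ⟨z, by push_cast; ring⟩

theorem ex_nat_mul (n : ℕ) (x : ℝ) : ex (n * x) = ex x ^ n := by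
  rw [ex, ex, ← Complex.exp_nat_mul]; congr 1; push_cast; ring

theorem neg_one_zpow_eq_ex (n : ℤ) : (-1 : ℂ) ^ n = ex (n / 2) := by
  rw [ex, ← Complex.exp_pi_mul_I, ← Complex.exp_int_mul]; congr 1; push_cast; ring

/-- The integer `gcd(m,k) λ*_{m,r}(h,k)`. -/
noncomputable def sig (m r h k : ℕ) : ℤ := (Nat.gcd m k : ℤ) * lam m r h k - r * h

theorem sig_nonneg (m r h k : ℕ) (hk : 0 < k) : 0 ≤ sig m r h k := by
  have hd : (0 : ℝ) < Nat.gcd m k := by exact_mod_cast Nat.gcd_pos_of_pos_right m hk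
  have hc := Int.le_ceil (((r : ℝ) * h) / (Nat.gcd m k : ℝ))
  rw [div_le_iff₀ hd, ← lam] at hc
  have hc' : (r : ℤ) * h ≤ lam m r h k * Nat.gcd m k := by exact_mod_cast hc
  unfold sig
  linarith

theorem sig_lt (m r h k : ℕ) (hk : 0 < k) : sig m r h k < Nat.gcd m k := by
  have hd : (0 : ℝ) < Nat.gcd m k := by exact_mod_cast Nat.gcd_pos_of_pos_right m hk
  have hc := Int.ceil_lt_add_one (((r : ℝ) * h) / (Nat.gcd m k : ℝ))
  rw [← sub_lt_iff_lt_add, lt_div_iff₀ hd, ← lam] at hc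
  have hc' : (lam m r h k - 1) * (Nat.gcd m k : ℤ) < r * h := by exact_mod_cast hc
  unfold sig
  linarith

theorem sig_eq_emod (m r h k : ℕ) (hk : 0 < k) : sig m r h k = (-(r * h : ℤ)) % Nat.gcd m k := by
  have : (-(r * h : ℤ)) % (Nat.gcd m k : ℤ) = sig m r h k % (Nat.gcd m k : ℤ) := by
    apply Int.ModEq.symm
    refine Int.modEq_iff_dvd.2 ⟨-lam m r h k, ?_⟩
    unfold sig
    ring
  rw [this, Int.emod_eq_of_lt (sig_nonneg m r h k hk) (sig_lt m r h k hk)]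

theorem lamStar_eq_sig_div (m r h k : ℕ) (hk : 0 < k) :
    lamStar m r h k = sig m r h k / (Nat.gcd m k : ℝ) := by
  have hd : (0 : ℝ) < Nat.gcd m k := by exact_mod_cast Nat.gcd_pos_of_pos_right m hk
  unfold lamStar sig
  push_cast
  field_simp

theorem sig_congr (m r : ℕ) {h h' k : ℕ} (hk : 0 < k)
    (hh : (h : ℤ) ≡ h' [ZMOD (Nat.gcd m k : ℕ)]) : sig m r h k = sig m r h' k := by
  rw [sig_eq_emod m r h k hk, sig_eq_emod m r h' k hk]
  exact (hh.mul_left _).neg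

theorem hbar_congr (m : ℕ) {h h' k : ℕ} (hh : h ≡ h' [MOD k]) : hbar m h k = hbar m h' k := by
  unfold hbar
  have : ((m / Nat.gcd m k * h : ℕ) : ZMod (k / Nat.gcd m k)) = (m / Nat.gcd m k * h' : ℕ) := by
    rw [ZMod.natCast_eq_natCast_iff]
    exact (hh.of_dvd (Nat.div_dvd_of_dvd (Nat.gcd_dvd_right m k))).mul_left _
  rw [this]

/-- The exponent of one factor of the multiplier `(-1)^λ Д`. -/
noncomputable def deExponent (m r h k : ℕ) : ℝ :=
  ((r : ℝ) * h / k - (r : ℝ) * (Nat.gcd m k : ℝ) / ((m : ℝ) * k)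
      + 2 * (r : ℝ) * (Nat.gcd m k : ℝ) * lamStar m r h k / ((m : ℝ) * k)
      + (hbar m h k : ℝ) * (Nat.gcd m k : ℝ) / k *
          ((lam m r h k : ℝ) ^ 2 - (lam m r h k : ℝ)) + lam m r h k) / 2

/-- A shift of h by ki keeps ħ and λ* and moves λ by rk'i. The resulting change is an integer for
parity reasons. This allows h to be replaced by lifts modulo Mk. -/
theorem deExponent_add_mul (m r h k i : ℕ) (hm : 0 < m) (hk : 0 < k) (hhk : Nat.gcd h k = 1) :
    ∃ z : ℤ, deExponent m r (h + k * i) k - deExponent m r h k = z := by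
  set d := Nat.gcd m k with hd
  have hd0 : 0 < d := Nat.gcd_pos_of_pos_right m hk
  obtain ⟨m', hm'⟩ : d ∣ m := Nat.gcd_dvd_left m k
  obtain ⟨k', hk'⟩ : d ∣ k := Nat.gcd_dvd_right m k
  have hk'0 : 0 < k' := Nat.pos_of_ne_zero (by rintro rfl; simp at hk'; omega)
  have hm'0 : 0 < m' := Nat.pos_of_ne_zero (by rintro rfl; simp at hm'; omega)
  have hmod : h + k * i ≡ h [MOD k] := by simp [Nat.ModEq]
  have hb := hbar_congr m hmod
  have hlam : lam m r (h + k * i) k = lam m r h k + r * k' * i := by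
    have hs := sig_congr m r hk (h := h + k * i) (h' := h)
      ((Int.natCast_modEq_iff.2 hmod).of_dvd (Int.natCast_dvd_natCast.2 (Nat.gcd_dvd_right m k)))
    unfold sig at hs
    rw [← hd] at hs
    have hdz : (d : ℤ) ≠ 0 := by exact_mod_cast hd0.ne'
    apply mul_left_cancel₀ hdz
    have hkz : (k : ℤ) = d * k' := by exact_mod_cast hk'
    push_cast at hs
    linear_combination hs + (r * i : ℤ) * hkz
  have hstar : lamStar m r (h + k * i) k = lamStar m r h k := by
    unfold lamStar
    rw [hlam, ← hd]
    have hkr : (k : ℝ) = d * k' := by exact_mod_cast hk'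
    have hdr : (d : ℝ) ≠ 0 := by positivity
    push_cast
    rw [hkr]
    field_simp
    ring
  set H := hbar m h k with hH
  set l := lam m r h k with hl
  have hspec := hbar_spec m h k hk hhk
  rw [← hd, Nat.div_eq_of_eq_mul_right hd0 hk', Nat.div_eq_of_eq_mul_right hd0 hm', ← hH] at hspec
  -- If k' is even, ħ is invertible modulo k' and hence odd.
  have hpar : (2 : ℤ) ∣ (1 + H) * (1 + k') := by
    rcases Int.even_or_odd (k' : ℤ) with hke | hko
    · obtain ⟨z, hz⟩ := hspec.dvd
      have hHo : Odd H := by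
        by_contra hne
        rw [Int.not_odd_iff_even] at hne
        have h1 : Even (H * ((m' * h : ℕ) : ℤ)) := hne.mul_right _
        have h2 : Even ((k' : ℤ) * z) := hke.mul_right _
        rw [← hz] at h2
        have h3 := h1.add h2
        rw [add_sub_cancel] at h3
        exact absurd h3 (by decide)
      exact ((odd_one.add_odd hHo).two_dvd).mul_right _
    · exact ((odd_one.add_odd hko).two_dvd).mul_left _
  obtain ⟨p, hp⟩ := hpar
  have hri : (2 : ℤ) ∣ (r * i : ℤ) * (1 + H * r * k' * i - H + k') := by
    have h1 : (2 : ℤ) ∣ (r * i : ℤ) * (r * i - 1) := (Int.even_mul_pred_self _).two_dvd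
    obtain ⟨q, hq⟩ := h1
    exact ⟨H * k' * q + r * i * p - r * i * H, by
      linear_combination (H * k' : ℤ) * hq + (r * i : ℤ) * hp⟩
  obtain ⟨q, hq⟩ := hri
  refine ⟨q + H * l * r * i, ?_⟩
  have hqr : (r * i : ℝ) * (1 + H * r * k' * i - H + k') = 2 * q := by exact_mod_cast hq
  have hkr : (k : ℝ) = d * k' := by exact_mod_cast hk'
  have hdr : (d : ℝ) ≠ 0 := by positivity
  have hk'r : (k' : ℝ) ≠ 0 := by positivity
  unfold deExponent
  rw [hstar, hb, hlam, ← hd, ← hl, ← hH]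
  have e1 : (H : ℝ) * d / k = H / k' := by rw [hkr]; field_simp
  have e2 : (r : ℝ) * ((h + k * i : ℕ) : ℝ) / k = r * h / k + r * i := by
    have : (k : ℝ) ≠ 0 := by positivity
    push_cast; field_simp
  rw [e1, e2]
  push_cast
  have hq' : (q : ℝ) = (r * i : ℝ) * (1 + H * r * k' * i - H + k') / 2 := by linarith
  rw [hq']
  field_simp
  ring

/-- The exponent of the multiplier in terms of an inverse `x` of `-h`. -/
theorem deExponent_eq {m r h k : ℕ} {x B y : ℤ} (hm : 0 < m) (hk : 0 < k)
    (hB : k * B = 1 + h * x)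
    (hy : ((k / Nat.gcd m k : ℕ) : ℤ) * y = (m / Nat.gcd m k : ℕ) * hbar m h k - x) :
    deExponent m r h k = r * h / (2 * k) - r ^ 2 * h / (2 * m * k) +
      ((sig m r h k : ℝ) ^ 2 - Nat.gcd m k * sig m r h k) * x / (2 * m * k) +
      B * (2 * sig m r h k * r + r ^ 2 * h - Nat.gcd m k * r) / (2 * m) +
      ((lam m r h k : ℝ) ^ 2 - lam m r h k) * y / (2 * (m / Nat.gcd m k : ℕ)) +
      lam m r h k / 2 := by
  have hd0 : 0 < Nat.gcd m k := Nat.gcd_pos_of_pos_right m hk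
  unfold deExponent
  rw [lamStar_eq_sig_div m r h k hk]
  have hsig : (Nat.gcd m k : ℝ) * lam m r h k = sig m r h k + r * h := by
    unfold sig; push_cast; ring
  set d := Nat.gcd m k with hd
  obtain ⟨m', hm'⟩ : d ∣ m := Nat.gcd_dvd_left m k
  obtain ⟨k', hk'⟩ : d ∣ k := Nat.gcd_dvd_right m k
  rw [Nat.div_eq_of_eq_mul_right hd0 hk', Nat.div_eq_of_eq_mul_right hd0 hm'] at hy
  rw [Nat.div_eq_of_eq_mul_right hd0 hm']
  have hk'0 : 0 < k' := Nat.pos_of_ne_zero (by rintro rfl; simp at hk'; omega)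
  have hm'0 : 0 < m' := Nat.pos_of_ne_zero (by rintro rfl; simp at hm'; omega)
  have hkr : (k : ℝ) = d * k' := by exact_mod_cast hk'
  have hmr : (m : ℝ) = d * m' := by exact_mod_cast hm'
  have hdr : (d : ℝ) ≠ 0 := by positivity
  have hk'r : (k' : ℝ) ≠ 0 := by positivity
  have hm'r : (m' : ℝ) ≠ 0 := by positivity
  have hBr : (B : ℝ) = (1 + h * x) / (d * k') := by
    have : (k : ℝ) * B = 1 + h * x := by exact_mod_cast hB
    rw [hkr] at this
    field_simp
    linarith
  have hyr : (y : ℝ) = (m' * hbar m h k - x) / k' := by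
    have : (k' : ℝ) * y = m' * hbar m h k - x := by exact_mod_cast hy
    field_simp
    linarith
  have hsr : (sig m r h k : ℝ) = d * lam m r h k - r * h := by linarith
  rw [hBr, hyr, hkr, hmr, hsr]
  generalize (lam m r h k : ℝ) = l
  generalize (hbar m h k : ℝ) = H
  clear_value d
  field_simp
  ring

/-- Modulo k', both m'ħ and x are inverses of -h. The quotient y lets the specific choice of ħ be
exchanged for an inverse x with better compatibility modulo M. -/
theorem exists_hbar_quotient {m h k : ℕ} {x : ℤ} (hk : 0 < k) (hx : h * x ≡ -1 [ZMOD k]) :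
    ∃ y : ℤ, ((k / Nat.gcd m k : ℕ) : ℤ) * y = (m / Nat.gcd m k : ℕ) * hbar m h k - x := by
  have hco : IsCoprime (h : ℤ) k := isCoprime_of_mul_modEq_neg_one hx
  have hspec := hbar_spec m h k hk (Nat.isCoprime_iff_coprime.1 hco)
  have hkd : ((k / Nat.gcd m k : ℕ) : ℤ) ∣ k :=
    Int.natCast_dvd_natCast.2 (Nat.div_dvd_of_dvd (Nat.gcd_dvd_right m k))
  have hco' : IsCoprime (h : ℤ) (k / Nat.gcd m k : ℕ) := hco.of_isCoprime_of_dvd_right hkd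
  have hdvd : ((k / Nat.gcd m k : ℕ) : ℤ) ∣ (m / Nat.gcd m k : ℕ) * hbar m h k - x := by
    refine hco'.symm.dvd_of_dvd_mul_left (y := (h : ℤ)) ?_
    have h1 := hspec.sub (hx.of_dvd hkd)
    rw [sub_self] at h1
    have h2 := Int.modEq_zero_iff_dvd.1 h1
    have e : (h : ℤ) * ((m / Nat.gcd m k : ℕ) * hbar m h k - x) =
        hbar m h k * ((m / Nat.gcd m k * h : ℕ) : ℤ) - h * x := by
      rw [Nat.cast_mul]
      ring
    rw [e]
    exact h2
  obtain ⟨y, hy⟩ := hdvd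
  exact ⟨y, hy.symm⟩

/-- Modulo m' the term m'H drops out and k' is invertible, so y is determined by x. -/
theorem hbar_quotient_congr {m k M : ℕ} {x₁ x₂ y₁ y₂ H₁ H₂ : ℤ} (hk : 0 < k)
    (hM : m ∣ M) (hx : x₁ ≡ x₂ [ZMOD M])
    (h₁ : ((k / Nat.gcd m k : ℕ) : ℤ) * y₁ = (m / Nat.gcd m k : ℕ) * H₁ - x₁)
    (h₂ : ((k / Nat.gcd m k : ℕ) : ℤ) * y₂ = (m / Nat.gcd m k : ℕ) * H₂ - x₂) :
    y₁ ≡ y₂ [ZMOD (m / Nat.gcd m k : ℕ)] := by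
  have hd0 : 0 < Nat.gcd m k := Nat.gcd_pos_of_pos_right m hk
  have hco : IsCoprime ((m / Nat.gcd m k : ℕ) : ℤ) (k / Nat.gcd m k : ℕ) :=
    Nat.isCoprime_iff_coprime.2 (Nat.coprime_div_gcd_div_gcd hd0)
  have hmM : ((m / Nat.gcd m k : ℕ) : ℤ) ∣ M :=
    Int.natCast_dvd_natCast.2 ((Nat.div_dvd_of_dvd (Nat.gcd_dvd_left m k)).trans hM)
  obtain ⟨z, hz⟩ := (hx.of_dvd hmM).dvd
  refine Int.modEq_iff_dvd.2 (hco.dvd_of_dvd_mul_left (y := ((k / Nat.gcd m k : ℕ) : ℤ))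
    ⟨H₂ - H₁ - z, ?_⟩)
  linear_combination h₂ - h₁ - hz


/-- The root of unity `(-1)^{∑ δ λ} ω² Д`. -/
noncomputable def multiplier {J : ℕ} (m r : Fin J → ℕ) (δ : Fin J → ℤ) (h k : ℕ) : ℂ :=
  (-1 : ℂ) ^ (∑ j, δ j * lam (m j) (r j) h k) * omega m δ h k ^ 2 * De m r δ h k

/-- The exponent of one factor of the multiplier. -/
noncomputable def multExponent (m r h k : ℕ) : ℝ :=
  deExponent m r h k - dedekindSum (m / Nat.gcd m k * h) (k / Nat.gcd m k)

theorem multiplier_eq_ex {J : ℕ} (m r : Fin J → ℕ) (δ : Fin J → ℤ) (h k : ℕ) :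
    multiplier m r δ h k = ex (∑ j, (δ j : ℝ) * multExponent (m j) (r j) h k) := by
  have h1 : omega m δ h k ^ 2 = ex (-∑ j, (δ j : ℝ) *
      dedekindSum (m j / Nat.gcd (m j) k * h) (k / Nat.gcd (m j) k)) := by
    rw [omega, ex, ← Complex.exp_nat_mul]
    congr 1
    push_cast
    ring
  rw [multiplier, neg_one_zpow_eq_ex, h1, ← ex_add]
  have h2 : ∀ R : ℝ, cexp ((π : ℂ) * I * (R : ℂ)) = ex (R / 2) := by
    intro R
    rw [ex]
    congr 1
    push_cast
    ring
  rw [De, h2, ← ex_add]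
  congr 1
  push_cast
  rw [← Finset.sum_neg_distrib, Finset.sum_div, Finset.sum_div, ← Finset.sum_add_distrib,
    ← Finset.sum_add_distrib]
  refine Finset.sum_congr rfl fun j _ => ?_
  rw [multExponent, deExponent]
  ring

theorem norm_multiplier {J : ℕ} (m r : Fin J → ℕ) (δ : Fin J → ℤ) (h k : ℕ) :
    ‖multiplier m r δ h k‖ = 1 := by rw [multiplier_eq_ex, norm_ex]

theorem multiplier_add_mul {J : ℕ} (m r : Fin J → ℕ) (δ : Fin J → ℤ) (h k i : ℕ)
    (hm : ∀ j, 0 < m j) (hk : 0 < k) (hhk : Nat.gcd h k = 1) :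
    multiplier m r δ (h + k * i) k = multiplier m r δ h k := by
  have key : ∀ j, ∃ z : ℤ, multExponent (m j) (r j) (h + k * i) k -
      multExponent (m j) (r j) h k = z := by
    intro j
    obtain ⟨z, hz⟩ := deExponent_add_mul (m j) (r j) h k i (hm j) hk hhk
    refine ⟨z, ?_⟩
    have hd0 : 0 < Nat.gcd (m j) k := Nat.gcd_pos_of_pos_right _ hk
    have hk' : 0 < k / Nat.gcd (m j) k := Nat.div_pos (Nat.gcd_le_right _ hk) hd0
    have hmod : h + k * i ≡ h [MOD k / Nat.gcd (m j) k] :=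
      Nat.ModEq.of_dvd (Nat.div_dvd_of_dvd (Nat.gcd_dvd_right (m j) k)) (by simp [Nat.ModEq])
    rw [multExponent, multExponent, dedekindSum_congr hk' (hmod.mul_left _), ← hz]
    ring
  choose z hz using key
  rw [multiplier_eq_ex, multiplier_eq_ex]
  refine ex_eq_ex (∑ j, δ j * z j) ?_
  rw [← Finset.sum_sub_distrib]
  push_cast
  exact Finset.sum_congr rfl fun j _ => by rw [← mul_sub, hz]

theorem lam_sub_lam {m r h₁ h₂ k M : ℕ} {s : ℤ} (hk : 0 < k) (hM : m ∣ M)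
    (hh : (h₁ : ℤ) - h₂ = M * s) :
    ((Nat.gcd m k : ℕ) : ℤ) * (lam m r h₁ k - lam m r h₂ k) = r * (M * s) ∧
      sig m r h₁ k = sig m r h₂ k := by
  have hs : sig m r h₁ k = sig m r h₂ k := by
    refine sig_congr m r hk (Int.ModEq.symm (Int.modEq_iff_dvd.2 ?_))
    rw [hh]
    exact (Int.natCast_dvd_natCast.2 ((Nat.gcd_dvd_left m k).trans hM)).mul_right s
  refine ⟨?_, hs⟩
  unfold sig at hs
  linear_combination hs + (r : ℤ) * hh

/-- In `deExponent_eq` the terms with B, y and λ have denominators 2m, 2m' and 2. With h and x fixed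
modulo M and B a multiple of M, these terms change by integers, and only those with k in the
denominator survive. -/
theorem deExponent_sub_deExponent {m r k M h₁ h₂ : ℕ} {x₁ x₂ : ℤ} (hm : 0 < m) (hk : 0 < k)
    (hmM : 24 * m ∣ M) (H₁ : h₁ * x₁ ≡ -1 [ZMOD (M * k : ℕ)])
    (H₂ : h₂ * x₂ ≡ -1 [ZMOD (M * k : ℕ)]) (hh : (h₁ : ℤ) ≡ h₂ [ZMOD M])
    (hxx : x₁ ≡ x₂ [ZMOD M]) :
    ∃ z : ℤ, deExponent m r h₁ k - deExponent m r h₂ k =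
      (((r : ℝ) / 2 - r ^ 2 / (2 * m)) * ((h₁ : ℝ) - h₂) +
        ((sig m r h₁ k : ℝ) ^ 2 - Nat.gcd m k * sig m r h₁ k) / (2 * m) *
          ((x₁ : ℝ) - x₂)) / k + z := by
  have hmM' : m ∣ M := (Dvd.intro_left 24 rfl).trans hmM
  have hkMk : (k : ℤ) ∣ ((M * k : ℕ) : ℤ) := ⟨M, by push_cast; ring⟩
  obtain ⟨y₁, hy₁⟩ := exists_hbar_quotient (m := m) hk (H₁.of_dvd hkMk)
  obtain ⟨y₂, hy₂⟩ := exists_hbar_quotient (m := m) hk (H₂.of_dvd hkMk)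
  obtain ⟨ey, hey⟩ := (hbar_quotient_congr hk hmM' hxx hy₁ hy₂).symm.dvd
  obtain ⟨b₁, hb₁⟩ := H₁.dvd
  obtain ⟨b₂, hb₂⟩ := H₂.dvd
  obtain ⟨s, hs⟩ := hh.symm.dvd
  obtain ⟨hl, hsig⟩ := lam_sub_lam (r := r) hk hmM' hs
  rw [deExponent_eq hm hk (B := -(M * b₁)) (by push_cast at hb₁; linear_combination hb₁) hy₁,
    deExponent_eq hm hk (B := -(M * b₂)) (by push_cast at hb₂; linear_combination hb₂) hy₂, ← hsig]
  have hd0 : 0 < Nat.gcd m k := Nat.gcd_pos_of_pos_right m hk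
  obtain ⟨M', rfl⟩ := hmM
  set d := Nat.gcd m k with hd
  obtain ⟨m', hm'⟩ : d ∣ m := Nat.gcd_dvd_left m k
  rw [Nat.div_eq_of_eq_mul_right hd0 hm'] at hey ⊢
  have hm'0 : 0 < m' := Nat.pos_of_ne_zero (by rintro rfl; simp at hm'; omega)
  have hmz : (m : ℤ) = d * m' := by exact_mod_cast hm'
  set l₁ := lam m r h₁ k with hl₁
  set l₂ := lam m r h₂ k with hl₂
  have hll : l₁ - l₂ = 24 * m' * M' * r * s := by
    have hdz : (d : ℤ) ≠ 0 := by exact_mod_cast hd0.ne'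
    apply mul_left_cancel₀ hdz
    push_cast at hl
    linear_combination hl + (24 * M' * r * s : ℤ) * hmz
  obtain ⟨p₂, hp₂⟩ : (2 : ℤ) ∣ l₂ * (l₂ - 1) := (Int.even_mul_pred_self l₂).two_dvd
  have hp : (l₁ ^ 2 - l₁) * y₁ - (l₂ ^ 2 - l₂) * y₂ = 2 * m' *
      (12 * M' * r * s * (l₁ + l₂ - 1) * y₁ + p₂ * ey) := by
    linear_combination (l₁ + l₂ - 1) * y₁ * hll + (l₂ ^ 2 - l₂) * hey + (m' : ℤ) * ey * hp₂
  set q₁ := 2 * sig m r h₁ k * r + (r : ℤ) ^ 2 * h₁ - d * r with hq₁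
  set q₂ := 2 * sig m r h₁ k * r + (r : ℤ) ^ 2 * h₂ - d * r with hq₂
  refine ⟨-(12 * M' * b₁ * q₁) + 12 * M' * b₂ * q₂ +
    (12 * M' * r * s * (l₁ + l₂ - 1) * y₁ + p₂ * ey) + 12 * m' * M' * r * s, ?_⟩
  have hpr : ((l₁ : ℝ) ^ 2 - l₁) * y₁ - ((l₂ : ℝ) ^ 2 - l₂) * y₂ = 2 * m' *
      (12 * M' * r * s * (l₁ + l₂ - 1) * y₁ + p₂ * ey) := by exact_mod_cast hp
  have hllr : (l₁ : ℝ) - l₂ = 24 * m' * M' * r * s := by exact_mod_cast hll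
  have hq₁r : (q₁ : ℝ) = 2 * sig m r h₁ k * r + (r : ℝ) ^ 2 * h₁ - d * r := by
    rw [hq₁]; push_cast; ring
  have hq₂r : (q₂ : ℝ) = 2 * sig m r h₁ k * r + (r : ℝ) ^ 2 * h₂ - d * r := by
    rw [hq₂]; push_cast; ring
  have hmr : (m : ℝ) ≠ 0 := by positivity
  have hm'r : (m' : ℝ) ≠ 0 := by positivity
  have hkr : (k : ℝ) ≠ 0 := by positivity
  have t₁ : (((-(((24 * m * M' : ℕ) : ℤ) * b₁) : ℤ)) : ℝ) *
      (2 * sig m r h₁ k * r + (r : ℝ) ^ 2 * h₁ - d * r) / (2 * m) = -(12 * M' * b₁ * q₁) := by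
    rw [hq₁r]; push_cast; field_simp; ring
  have t₂ : (((-(((24 * m * M' : ℕ) : ℤ) * b₂) : ℤ)) : ℝ) *
      (2 * sig m r h₁ k * r + (r : ℝ) ^ 2 * h₂ - d * r) / (2 * m) = -(12 * M' * b₂ * q₂) := by
    rw [hq₂r]; push_cast; field_simp; ring
  have t₃ : ((l₁ : ℝ) ^ 2 - l₁) * y₁ / (2 * m') = ((l₂ : ℝ) ^ 2 - l₂) * y₂ / (2 * m') +
      (12 * M' * r * s * (l₁ + l₂ - 1) * y₁ + p₂ * ey) := by
    field_simp
    linarith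
  rw [t₁, t₂, t₃]
  have t₄ : (l₁ : ℝ) = l₂ + 24 * m' * M' * r * s := by linarith
  push_cast
  generalize (sig m r h₁ k : ℝ) = σ
  generalize ((l₂ : ℝ) ^ 2 - l₂) * y₂ / (2 * m') = X
  generalize (12 * (M' : ℝ) * r * s * (l₁ + l₂ - 1) * y₁ + p₂ * ey) = Y
  rw [t₄]
  field_simp
  ring

theorem modEq_of_mul_modEq_neg_one {M : ℤ} {h₁ h₂ x₁ x₂ : ℤ} (H₁ : h₁ * x₁ ≡ -1 [ZMOD M])
    (H₂ : h₂ * x₂ ≡ -1 [ZMOD M]) (hh : h₁ ≡ h₂ [ZMOD M]) : x₁ ≡ x₂ [ZMOD M] := by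
  have e₁ : h₁ * -x₁ ≡ 1 [ZMOD M] := by simpa using H₁.neg
  have e₂ : h₂ * -x₂ ≡ 1 [ZMOD M] := by simpa using H₂.neg
  simpa using (int_modEq_of_mul_modEq_one e₁ e₂ hh).neg

/-- The Dedekind sum supplies the terms with 1/12. Together with those of `deExponent` the two
coefficients become the summands of -Ω/24 and -Δ/24 in `Omega_div_eq_sum` and `Delta_eq_sum_sig`. -/
theorem multExponent_sub_multExponent {m r k M h₁ h₂ : ℕ} {x₁ x₂ : ℤ} (hm : 0 < m) (hk : 0 < k)
    (hM : 0 < M) (hmM : 24 * m ∣ M) (H₁ : h₁ * x₁ ≡ -1 [ZMOD (M * k : ℕ)])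
    (H₂ : h₂ * x₂ ≡ -1 [ZMOD (M * k : ℕ)]) (hh : (h₁ : ℤ) ≡ h₂ [ZMOD M]) :
    ∃ z : ℤ, multExponent m r h₁ k - multExponent m r h₂ k =
      (-((m : ℝ) / 12 - r / 2 + r ^ 2 / (2 * m)) * ((h₁ : ℝ) - h₂) +
        ((Nat.gcd m k : ℝ) ^ 2 / (12 * m) +
          ((sig m r h₁ k : ℝ) ^ 2 - Nat.gcd m k * sig m r h₁ k) / (2 * m)) *
          ((x₁ : ℝ) - x₂)) / k + z := by
  have hxx : x₁ ≡ x₂ [ZMOD M] := modEq_of_mul_modEq_neg_one (H₁.of_dvd ⟨k, by push_cast; ring⟩)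
    (H₂.of_dvd ⟨k, by push_cast; ring⟩) hh
  obtain ⟨z₁, hz₁⟩ := deExponent_sub_deExponent (r := r) hm hk hmM H₁ H₂ hh hxx
  have hd0 : 0 < Nat.gcd m k := Nat.gcd_pos_of_pos_right m hk
  have hco := Nat.coprime_div_gcd_div_gcd (m := m) (n := k) hd0
  have hdm := Nat.div_mul_cancel (Nat.gcd_dvd_left m k)
  have hdk := Nat.div_mul_cancel (Nat.gcd_dvd_right m k)
  have hk'0 : 0 < k / Nat.gcd m k := Nat.div_pos (Nat.gcd_le_right _ hk) hd0
  have hm'0 : 0 < m / Nat.gcd m k := Nat.div_pos (Nat.gcd_le_left _ hm) hd0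
  have hdvd : ((M * (k / Nat.gcd m k) : ℕ) : ℤ) ∣ ((M * k : ℕ) : ℤ) :=
    Int.natCast_dvd_natCast.2 (Nat.mul_dvd_mul_left M (Nat.div_dvd_of_dvd (Nat.gcd_dvd_right m k)))
  have hmM12 : 12 * (m / Nat.gcd m k) ∣ M :=
    (Nat.mul_dvd_mul (by norm_num : 12 ∣ 24) (Nat.div_dvd_of_dvd (Nat.gcd_dvd_left m k))).trans hmM
  obtain ⟨z₂, hz₂⟩ := dedekindSum_sub_dedekindSum hk'0 hm'0 hM hco hmM12 (H₁.of_dvd hdvd)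
    (H₂.of_dvd hdvd) hh
  refine ⟨z₁ - z₂, ?_⟩
  rw [multExponent, multExponent, sub_sub_sub_comm, hz₁, hz₂]
  set d := Nat.gcd m k with hd
  set m' := m / d with hm'
  set k' := k / d with hk'
  have hmr : (m : ℝ) = m' * d := by exact_mod_cast hdm.symm
  have hkr : (k : ℝ) = k' * d := by exact_mod_cast hdk.symm
  have hdr : (d : ℝ) ≠ 0 := by positivity
  have hm'r : (m' : ℝ) ≠ 0 := by positivity
  have hk'r : (k' : ℝ) ≠ 0 := by positivity
  rw [hmr, hkr]
  push_cast
  generalize (sig m r h₁ k : ℝ) = σ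
  clear_value d m' k'
  field_simp
  ring

theorem Delta_eq_sum_sig {J : ℕ} (m r : Fin J → ℕ) (δ : Fin J → ℤ) {h k : ℕ} (hk : 0 < k) :
    -(Delta m r δ h k) / 24 = ∑ j, (δ j : ℝ) * ((Nat.gcd (m j) k : ℝ) ^ 2 / (12 * m j) +
      ((sig (m j) (r j) h k : ℝ) ^ 2 - Nat.gcd (m j) k * sig (m j) (r j) h k) / (2 * m j)) := by
  rw [Delta, neg_neg, Finset.sum_div]
  refine Finset.sum_congr rfl fun j _ => ?_
  rw [lamStar_eq_sig_div _ _ _ _ hk]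
  have : (Nat.gcd (m j) k : ℝ) ≠ 0 := by
    exact_mod_cast (Nat.gcd_pos_of_pos_right (m j) hk).ne'
  field_simp
  ring

theorem Delta_congr {J : ℕ} (m r : Fin J → ℕ) (δ : Fin J → ℤ) {h₁ h₂ k M : ℕ} (hk : 0 < k)
    (hM : ∀ j, m j ∣ M) (hh : (h₁ : ℤ) ≡ h₂ [ZMOD M]) :
    Delta m r δ h₁ k = Delta m r δ h₂ k := by
  unfold Delta
  congr 1
  refine Finset.sum_congr rfl fun j _ => ?_
  rw [lamStar_eq_sig_div _ _ _ _ hk, lamStar_eq_sig_div _ _ _ _ hk,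
    sig_congr (m j) (r j) hk (hh.of_dvd (Int.natCast_dvd_natCast.2
      ((Nat.gcd_dvd_left (m j) k).trans (hM j))))]

theorem Omega_div_eq_sum {J : ℕ} (m r : Fin J → ℕ) (δ : Fin J → ℤ) (hm : ∀ j, 0 < m j) :
    Omega m r δ / 24 = ∑ j, (δ j : ℝ) * ((m j : ℝ) / 12 - r j / 2 + r j ^ 2 / (2 * m j)) := by
  rw [Omega, Finset.sum_div]
  refine Finset.sum_congr rfl fun j _ => ?_
  have : (m j : ℝ) ≠ 0 := by exact_mod_cast (hm j).ne'
  field_simp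
  ring

/-- On the residue classes modulo a highly divisible `M`, the multiplier is an exponential that is
linear in `h` and in the inverse of `-h`. -/
theorem exists_multiplier_eq {J : ℕ} (m r : Fin J → ℕ) (δ : Fin J → ℤ) (hm : ∀ j, 0 < m j)
    {k M : ℕ} (hk : 0 < k) (hM : 0 < M) (hmM : ∀ j, 24 * m j ∣ M) :
    ∃ c : ℕ → ℂ, (∀ t, ‖c t‖ ≤ 1) ∧ ∀ (h : ℕ) (x : ℤ), h * x ≡ -1 [ZMOD (M * k : ℕ)] →
      multiplier m r δ h k =
        c (h % M) * (ex (-(Omega m r δ / 24) * h / k) * ex (-(Delta m r δ h k) / 24 * x / k)) := by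
  classical
  set lin : ℕ → ℤ → ℝ := fun h x => -(Omega m r δ / 24) * h / k + -(Delta m r δ h k) / 24 * x / k
    with hlin
  set P : ℕ → Prop := fun t => ∃ (h : ℕ) (x : ℤ), h * x ≡ -1 [ZMOD (M * k : ℕ)] ∧ h % M = t with hP
  -- The constant of a class is the multiplier at one chosen representative, stripped of its linear
  -- phase; a class without representatives gets the value 0.
  refine ⟨fun t => if H : P t then multiplier m r δ H.choose k *
    ex (-lin H.choose H.choose_spec.choose) else 0, fun t => ?_, fun h x H => ?_⟩
  · dsimp only
    split_ifs with H
    · rw [norm_mul, norm_multiplier, norm_ex, one_mul]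
    · simp
  · have hPt : P (h % M) := ⟨h, x, H, rfl⟩
    dsimp only
    rw [dif_pos hPt]
    set h₀ := hPt.choose with hh₀
    set x₀ := hPt.choose_spec.choose with hx₀
    obtain ⟨H₀, hmod⟩ := hPt.choose_spec.choose_spec
    rw [← hx₀, ← hh₀] at H₀
    rw [← hh₀] at hmod
    have hcong : (h : ℤ) ≡ h₀ [ZMOD M] := Int.natCast_modEq_iff.2 (Eq.symm hmod)
    have hdelta := Delta_congr m r δ hk (fun j => (Dvd.intro_left 24 rfl).trans (hmM j)) hcong
    have key : ∀ j, ∃ z : ℤ, multExponent (m j) (r j) h k - multExponent (m j) (r j) h₀ k = _ :=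
      fun j => multExponent_sub_multExponent (r := r j) (hm j) hk hM (hmM j) H H₀ hcong
    choose z hz using key
    rw [← ex_add, multiplier_eq_ex, multiplier_eq_ex, ← ex_add, ← ex_add]
    refine ex_eq_ex (∑ j, δ j * z j) ?_
    have e : ∑ j, (δ j : ℝ) * multExponent (m j) (r j) h k -
        ∑ j, (δ j : ℝ) * multExponent (m j) (r j) h₀ k = lin h x - lin h₀ x₀ +
          ((∑ j, δ j * z j : ℤ) : ℝ) := by
      rw [← Finset.sum_sub_distrib]
      simp_rw [← mul_sub, hz, hlin]
      rw [← hdelta, Delta_eq_sum_sig m r δ hk, Omega_div_eq_sum m r δ hm]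
      push_cast
      have e2 : ∀ A B : ℝ, -A * (h : ℝ) / k + B * x / k - (-A * h₀ / k + B * x₀ / k) =
          A * (-((h : ℝ) - h₀) / k) + B * (((x : ℝ) - x₀) / k) := fun A B => by ring
      rw [e2, Finset.sum_mul, Finset.sum_mul, ← Finset.sum_add_distrib, ← Finset.sum_add_distrib]
      refine Finset.sum_congr rfl fun j _ => ?_
      ring
    have e' : lin h x = -(Omega m r δ / 24) * h / k + -(Delta m r δ h k) / 24 * x / k := rfl
    linarith


/-! ### Bounds for the infinite product -/

theorem summable_norm_mul_pow {a q : ℂ} (hq : ‖q‖ < 1) : Summable fun n : ℕ => ‖-(a * q ^ n)‖ := by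
  simp_rw [norm_neg, norm_mul, norm_pow]
  exact (summable_geometric_of_lt_one (norm_nonneg _) hq).mul_left _

theorem multipliable_one_sub_mul_pow {a q : ℂ} (hq : ‖q‖ < 1) :
    Multipliable fun n : ℕ => 1 - a * q ^ n := by
  simpa [sub_eq_add_neg] using multipliable_one_add_of_summable (summable_norm_mul_pow (a := a) hq)

theorem qPoch_eq_mul {a q : ℂ} (hq : ‖q‖ < 1) : qPoch a q = (1 - a) * qPoch (a * q) q := by
  have h := multipliable_one_sub_mul_pow (a := a * q) hq
  have e : ∀ n : ℕ, 1 - a * q ^ (n + 1) = 1 - a * q * q ^ n := fun n => by ring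
  rw [qPoch, tprod_eq_zero_mul' (by simpa only [e] using h)]
  simp only [e, pow_zero, mul_one, qPoch]

theorem sum_pow_div_le {ρ : ℝ} (h0 : 0 ≤ ρ) (h1 : ρ < 1) (N : ℕ) :
    ∑ n ∈ Finset.range N, ρ ^ (n + 1) / (1 - ρ) ≤ 1 / (1 - ρ) ^ 2 := by
  have h2 : 0 < 1 - ρ := by linarith
  have hs := (summable_geometric_of_lt_one h0 h1).sum_le_tsum (Finset.range N)
    (fun n _ => pow_nonneg h0 n)
  rw [tsum_geometric_of_lt_one h0 h1] at hs
  calc ∑ n ∈ Finset.range N, ρ ^ (n + 1) / (1 - ρ)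
      ≤ ∑ n ∈ Finset.range N, ρ ^ n / (1 - ρ) := by
        refine Finset.sum_le_sum fun n _ => div_le_div_of_nonneg_right ?_ h2.le
        exact pow_le_pow_of_le_one h0 h1.le (Nat.le_succ n)
    _ ≤ 1 / (1 - ρ) ^ 2 := by
        rw [← Finset.sum_div, pow_two, ← div_div]
        refine div_le_div_of_nonneg_right ?_ h2.le
        rwa [one_div]

/-- For 0 ≤ t ≤ ρ one has 1 - t ≥ exp(-t/(1 - ρ)) and 1 + t ≤ exp(t/(1 - ρ)); with t = ρ^(n+1) both
bounds pass from the partial products to the limit. -/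
theorem qPoch_bounds {a q : ℂ} {ρ : ℝ} (h1 : ρ < 1) (ha : ‖a‖ ≤ ρ) (hq : ‖q‖ ≤ ρ) :
    Real.exp (-(1 / (1 - ρ) ^ 2)) ≤ ‖qPoch a q‖ ∧ ‖qPoch a q‖ ≤ Real.exp (1 / (1 - ρ) ^ 2) := by
  have h0 : 0 ≤ ρ := (norm_nonneg _).trans ha
  have h2 : 0 < 1 - ρ := by linarith
  have hlim := (multipliable_one_sub_mul_pow (a := a) (hq.trans_lt h1)).hasProd.tendsto_prod_nat.norm
  have hterm : ∀ n : ℕ, ‖a * q ^ n‖ ≤ ρ ^ (n + 1) := by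
    intro n
    rw [norm_mul, norm_pow, pow_succ']
    exact mul_le_mul ha (pow_le_pow_left₀ (norm_nonneg _) hq n) (by positivity) h0
  have hle : ∀ n : ℕ, ρ ^ (n + 1) ≤ ρ := fun n => by
    simpa using pow_le_pow_of_le_one h0 h1.le (Nat.succ_le_succ (Nat.zero_le n))
  constructor
  · refine ge_of_tendsto' hlim fun N => ?_
    rw [norm_prod]
    calc Real.exp (-(1 / (1 - ρ) ^ 2))
        ≤ Real.exp (∑ n ∈ Finset.range N, -(ρ ^ (n + 1) / (1 - ρ))) := by
          rw [Real.exp_le_exp, Finset.sum_neg_distrib, neg_le_neg_iff]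
          exact sum_pow_div_le h0 h1 N
      _ = ∏ n ∈ Finset.range N, Real.exp (-(ρ ^ (n + 1) / (1 - ρ))) := Real.exp_sum _ _
      _ ≤ _ := by
          refine Finset.prod_le_prod (fun n _ => (Real.exp_pos _).le) fun n _ => ?_
          set t := ρ ^ (n + 1) with ht
          have ht0 : 0 ≤ t := by positivity
          have htρ : t ≤ ρ := hle n
          have h3 : 1 - t ≤ ‖1 - a * q ^ n‖ := by
            have := norm_sub_norm_le (1 : ℂ) (a * q ^ n)
            rw [norm_one] at this
            linarith [hterm n]
          refine le_trans ?_ h3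
          rw [Real.exp_neg, inv_le_comm₀ (Real.exp_pos _) (by linarith)]
          have h4 := Real.add_one_le_exp (t / (1 - ρ))
          have h5 : (1 - t)⁻¹ = t / (1 - t) + 1 := by
            have : 1 - t ≠ 0 := by linarith
            field_simp
            ring
          have h6 : t / (1 - t) ≤ t / (1 - ρ) := div_le_div_of_nonneg_left ht0 h2 (by linarith)
          linarith
  · refine le_of_tendsto' hlim fun N => ?_
    rw [norm_prod]
    calc _ ≤ ∏ n ∈ Finset.range N, Real.exp (ρ ^ (n + 1) / (1 - ρ)) := by
          refine Finset.prod_le_prod (fun n _ => norm_nonneg _) fun n _ => ?_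
          have h3 : ‖1 - a * q ^ n‖ ≤ 1 + ρ ^ (n + 1) := by
            have := norm_sub_le (1 : ℂ) (a * q ^ n)
            rw [norm_one] at this
            linarith [hterm n]
          have h4 : ρ ^ (n + 1) ≤ ρ ^ (n + 1) / (1 - ρ) :=
            le_div_self (by positivity) h2 (by linarith)
          linarith [Real.add_one_le_exp (ρ ^ (n + 1) / (1 - ρ))]
      _ = Real.exp (∑ n ∈ Finset.range N, ρ ^ (n + 1) / (1 - ρ)) := (Real.exp_sum _ _).symm
      _ ≤ _ := Real.exp_le_exp.2 (sum_pow_div_le h0 h1 N)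

theorem differentiableOn_qPoch {U : Set ℂ} (hU : IsOpen U) {f g : ℂ → ℂ} {ρ : ℝ} (h0 : 0 ≤ ρ)
    (h1 : ρ < 1) (hf : DifferentiableOn ℂ f U) (hg : DifferentiableOn ℂ g U)
    (hfU : ∀ z ∈ U, ‖f z‖ ≤ ρ) (hgU : ∀ z ∈ U, ‖g z‖ ≤ ρ) :
    DifferentiableOn ℂ (fun z => qPoch (f z) (g z)) U := by
  have hd : ∀ n : ℕ, DifferentiableOn ℂ (fun z => -(f z * g z ^ n)) U := fun n =>
    (hf.mul (hg.pow n)).neg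
  have h := Summable.hasProdLocallyUniformlyOn_nat_one_add (f := fun n z => -(f z * g z ^ n)) hU
    (summable_geometric_of_lt_one h0 h1) (.of_forall fun n z hz => by
      rw [norm_neg, norm_mul, norm_pow]
      calc ‖f z‖ * ‖g z‖ ^ n ≤ 1 * ρ ^ n :=
            mul_le_mul ((hfU z hz).trans h1.le) (pow_le_pow_left₀ (norm_nonneg _) (hgU z hz) n)
              (by positivity) zero_le_one
        _ = ρ ^ n := one_mul _) (fun n => (hd n).continuousOn)
  refine (h.differentiableOn (.of_forall fun s => ?_) hU).congr fun z _ => ?_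
  · simpa [Finset.prod_fn] using DifferentiableOn.finsetProd (fun n _ => (hd n).const_add 1)
  · simp [qPoch, sub_eq_add_neg]

theorem norm_cexp_two_pi (z : ℂ) : ‖cexp (2 * π * I * z)‖ = Real.exp (-(2 * π * z.im)) := by
  rw [Complex.norm_exp]
  congr 1
  simp

/-- The factor 1 - ζ is split off because ζ may lie on the unit circle, while in the applications
the arguments of the remaining products stay in a fixed smaller disc. -/
theorem Zh_eq {ς τ : ℂ} (hτ : ‖cexp (2 * π * I * τ)‖ < 1) :
    Zh ς τ = (1 - cexp (2 * π * I * ς)) *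
      qPoch (cexp (2 * π * I * (ς + τ))) (cexp (2 * π * I * τ)) *
      qPoch (cexp (2 * π * I * (τ - ς))) (cexp (2 * π * I * τ)) := by
  have e1 : cexp (2 * π * I * (ς + τ)) = cexp (2 * π * I * ς) * cexp (2 * π * I * τ) := by
    rw [← Complex.exp_add]; congr 1; ring
  have e2 : cexp (2 * π * I * (τ - ς)) = (cexp (2 * π * I * ς))⁻¹ * cexp (2 * π * I * τ) := by
    rw [← Complex.exp_neg, ← Complex.exp_add]; congr 1; ring
  rw [Zh, qPoch_eq_mul hτ, e1, e2]

/-- Admissible coefficients of a factor `Ж(α τ + u; β τ + s)`. -/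
def Admissible (c κ α β u : ℝ) : Prop :=
  c ≤ β - α ∧ (c ≤ α ∨ α = 0 ∧ κ ≤ ‖1 - ex u‖)

section Factor

variable {c κ α β u s : ℝ}

theorem Admissible.nonneg (hc : 0 < c) (h : Admissible c κ α β u) : 0 ≤ α := by
  rcases h.2 with h | ⟨h, -⟩ <;> linarith

theorem im_affine (α u : ℝ) (τ : ℂ) : ((α : ℂ) * τ + u).im = α * τ.im := by simp

theorem norm_cexp_affine_le (hc : 0 < c) (hα : c ≤ α) {τ : ℂ} (hτ : 1 / 4 < τ.im) :
    ‖cexp (2 * π * I * ((α : ℂ) * τ + u))‖ ≤ Real.exp (-(π * c / 2)) := by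
  rw [norm_cexp_two_pi, im_affine, Real.exp_le_exp, neg_le_neg_iff]
  have : c * (1 / 4) ≤ α * τ.im := mul_le_mul hα hτ.le (by norm_num) (hc.le.trans hα)
  nlinarith [Real.pi_pos]

theorem exp_neg_lt_one (hc : 0 < c) : Real.exp (-(π * c / 2)) < 1 := by
  rw [Real.exp_lt_one_iff]
  have := mul_pos Real.pi_pos hc
  linarith

/-- The constant that bounds the factors with admissible coefficients. -/
noncomputable def factorBound (c κ : ℝ) : ℝ :=
  max 2 (max (1 - Real.exp (-(π * c / 2)))⁻¹ κ⁻¹) *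
    Real.exp (1 / (1 - Real.exp (-(π * c / 2))) ^ 2) ^ 2

theorem Zh_affine_eq (hc : 0 < c) (h : Admissible c κ α β u) {τ : ℂ} (hτ : 1 / 4 < τ.im) :
    Zh ((α : ℂ) * τ + u) ((β : ℂ) * τ + s) = (1 - cexp (2 * π * I * ((α : ℂ) * τ + u))) *
      qPoch (cexp (2 * π * I * (((α + β : ℝ) : ℂ) * τ + (u + s : ℝ))))
        (cexp (2 * π * I * ((β : ℂ) * τ + s))) *
      qPoch (cexp (2 * π * I * (((β - α : ℝ) : ℂ) * τ + (s - u : ℝ))))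
        (cexp (2 * π * I * ((β : ℂ) * τ + s))) := by
  have hβ : c ≤ β := by linarith [h.1, h.nonneg hc]
  rw [Zh_eq ((norm_cexp_affine_le hc hβ hτ).trans_lt (exp_neg_lt_one hc))]
  congr 3 <;> congr 2 <;> push_cast <;> ring

/-- A lower bound is needed as well because exponents may be negative. The two q-products are
covered by `qPoch_bounds`; for 1 - ζ either ζ decays with Im τ, or α = 0 and ζ = e(u) is a constant
at distance at least κ from 1. -/
theorem Zh_affine_bounds (hc : 0 < c) (hκ : 0 < κ) (h : Admissible c κ α β u) {τ : ℂ}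
    (hτ : 1 / 4 < τ.im) :
    (factorBound c κ)⁻¹ ≤ ‖Zh ((α : ℂ) * τ + u) ((β : ℂ) * τ + s)‖ ∧
      ‖Zh ((α : ℂ) * τ + u) ((β : ℂ) * τ + s)‖ ≤ factorBound c κ := by
  have hα := h.nonneg hc
  have hβ : c ≤ β := by linarith [h.1]
  have hρ := exp_neg_lt_one hc
  have hq := norm_cexp_affine_le (u := s) hc hβ hτ
  obtain ⟨l1, u1⟩ := qPoch_bounds hρ (norm_cexp_affine_le (u := u + s) hc
    (by linarith : c ≤ α + β) hτ) hq
  obtain ⟨l2, u2⟩ := qPoch_bounds hρ (norm_cexp_affine_le (u := s - u) hc h.1 hτ) hq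
  rw [Zh_affine_eq hc h hτ, norm_mul, norm_mul]
  set E := Real.exp (1 / (1 - Real.exp (-(π * c / 2))) ^ 2) with hE
  rw [Real.exp_neg, ← hE] at l1 l2
  set G := max 2 (max (1 - Real.exp (-(π * c / 2)))⁻¹ κ⁻¹) with hG
  have hG2 : 2 ≤ G := le_max_left _ _
  have hE0 : 0 < E := Real.exp_pos _
  have hu : ‖1 - cexp (2 * π * I * ((α : ℂ) * τ + u))‖ ≤ G := by
    refine le_trans ?_ hG2
    refine (norm_sub_le _ _).trans ?_
    rw [norm_one, norm_cexp_two_pi, im_affine]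
    have : Real.exp (-(2 * π * (α * τ.im))) ≤ 1 := by
      rw [Real.exp_le_one_iff, neg_nonpos]
      have : 0 ≤ α * τ.im := mul_nonneg hα (by linarith)
      positivity
    linarith
  have hl : G⁻¹ ≤ ‖1 - cexp (2 * π * I * ((α : ℂ) * τ + u))‖ := by
    rw [inv_le_comm₀ (by linarith)]
    · rcases h.2 with hc1 | ⟨rfl, hv⟩
      · refine le_trans ?_ ((le_max_left _ _).trans (le_max_right _ _))
        refine inv_anti₀ (by linarith) ?_
        have h1 := norm_sub_norm_le (1 : ℂ) (cexp (2 * π * I * ((α : ℂ) * τ + u)))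
        rw [norm_one] at h1
        linarith [norm_cexp_affine_le (u := u) hc hc1 hτ]
      · refine le_trans ?_ ((le_max_right _ _).trans (le_max_right _ _))
        refine inv_anti₀ hκ ?_
        simpa [ex] using hv
    · rcases h.2 with hc1 | ⟨rfl, hv⟩
      · have h1 := norm_sub_norm_le (1 : ℂ) (cexp (2 * π * I * ((α : ℂ) * τ + u)))
        rw [norm_one] at h1
        linarith [norm_cexp_affine_le (u := u) hc hc1 hτ]
      · refine hκ.trans_le ?_
        simpa [ex] using hv
  have e : factorBound c κ = G * E * E := by rw [factorBound]; ring
  rw [e, mul_inv, mul_inv]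
  have hG0 : 0 < G := by linarith
  constructor
  · gcongr
  · gcongr

theorem differentiableOn_Zh_affine (hc : 0 < c) (h : Admissible c κ α β u) :
    DifferentiableOn ℂ (fun τ : ℂ => Zh ((α : ℂ) * τ + u) ((β : ℂ) * τ + s))
      {τ : ℂ | 1 / 4 < τ.im} := by
  have hα := h.nonneg hc
  have hβ : c ≤ β := by linarith [h.1]
  have hU : IsOpen {τ : ℂ | 1 / 4 < τ.im} := isOpen_lt continuous_const Complex.continuous_im
  have hd : ∀ a b : ℝ, DifferentiableOn ℂ (fun τ : ℂ => cexp (2 * π * I * ((a : ℂ) * τ + b)))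
      {τ : ℂ | 1 / 4 < τ.im} := fun a b => by fun_prop
  refine DifferentiableOn.congr ?_ fun τ hτ => Zh_affine_eq hc h hτ
  refine (((hd α u).const_sub 1).mul ?_).mul ?_
  · exact differentiableOn_qPoch hU (Real.exp_pos _).le (exp_neg_lt_one hc) (hd _ _) (hd _ _)
      (fun z hz => norm_cexp_affine_le hc (by linarith) hz)
      (fun z hz => norm_cexp_affine_le hc hβ hz)
  · exact differentiableOn_qPoch hU (Real.exp_pos _).le (exp_neg_lt_one hc) (hd _ _) (hd _ _)
      (fun z hz => norm_cexp_affine_le hc h.1 hz)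
      (fun z hz => norm_cexp_affine_le hc hβ hz)

theorem factorBound_pos (c κ : ℝ) : 0 < factorBound c κ := by
  have : (0 : ℝ) < max 2 (max (1 - Real.exp (-(π * c / 2)))⁻¹ κ⁻¹) :=
    lt_of_lt_of_le two_pos (le_max_left _ _)
  unfold factorBound
  positivity

end Factor

theorem norm_zpow_le {w : ℂ} {B : ℝ} (hB : 0 < B) (hl : B⁻¹ ≤ ‖w‖) (hu : ‖w‖ ≤ B) (d : ℤ) :
    ‖w ^ d‖ ≤ B ^ d.natAbs := by
  rcases Int.natAbs_eq d with h | h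
  · rw [h, zpow_natCast, norm_pow, Int.natAbs_natCast]
    exact pow_le_pow_left₀ (norm_nonneg _) hu _
  · rw [h, zpow_neg, zpow_natCast, norm_inv, norm_pow, Int.natAbs_neg, Int.natAbs_natCast, ← inv_pow]
    refine pow_le_pow_left₀ (by positivity) ?_ _
    exact inv_le_of_inv_le₀ hB hl

/-- The product `∏ j, Ж(α_j τ + u_j; β_j τ + s_j)^{δ_j}`. -/
noncomputable def affineProd {J : ℕ} (δ : Fin J → ℤ) (α β u s : Fin J → ℝ) (τ : ℂ) : ℂ :=
  ∏ j, Zh ((α j : ℂ) * τ + u j) ((β j : ℂ) * τ + s j) ^ δ j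

/-- The bound depends only on c, κ and δ. The Lipschitz estimate on Im τ ≥ 1/2 is Cauchy's
inequality on discs of radius 1/8, which stay inside Im τ > 1/4. -/
theorem exists_affineProd_bounds {J : ℕ} (δ : Fin J → ℤ) {c κ : ℝ} (hc : 0 < c) (hκ : 0 < κ) :
    ∃ B : ℝ, 0 < B ∧ ∀ α β u s : Fin J → ℝ, (∀ j, Admissible c κ (α j) (β j) (u j)) →
      DifferentiableOn ℂ (affineProd δ α β u s) {τ : ℂ | 1 / 4 < τ.im} ∧
      (∀ τ : ℂ, 1 / 4 < τ.im → ‖affineProd δ α β u s τ‖ ≤ B) ∧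
      ∀ τ₁ τ₂ : ℂ, 1 / 2 ≤ τ₁.im → 1 / 2 ≤ τ₂.im →
        ‖affineProd δ α β u s τ₁ - affineProd δ α β u s τ₂‖ ≤ B * ‖τ₁ - τ₂‖ := by
  set B₀ := ∏ j, factorBound c κ ^ (δ j).natAbs with hB₀
  have hB₀pos : 0 < B₀ := Finset.prod_pos fun j _ => pow_pos (factorBound_pos c κ) _
  refine ⟨8 * B₀, by positivity, fun α β u s h => ?_⟩
  have hU : IsOpen {τ : ℂ | 1 / 4 < τ.im} := isOpen_lt continuous_const Complex.continuous_im
  have hdiff : DifferentiableOn ℂ (affineProd δ α β u s) {τ : ℂ | 1 / 4 < τ.im} := by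
    unfold affineProd
    refine DifferentiableOn.fun_finsetProd fun j _ τ hτ => ?_
    refine ((differentiableOn_Zh_affine (s := s j) hc (h j) τ hτ).zpow (Or.inl ?_))
    rw [← norm_ne_zero_iff]
    exact ((inv_pos.2 (factorBound_pos c κ)).trans_le
      (Zh_affine_bounds hc hκ (h j) hτ).1).ne'
  have hbd : ∀ τ : ℂ, 1 / 4 < τ.im → ‖affineProd δ α β u s τ‖ ≤ B₀ := by
    intro τ hτ
    rw [affineProd, norm_prod]
    refine Finset.prod_le_prod (fun _ _ => norm_nonneg _) fun j _ => ?_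
    obtain ⟨h1, h2⟩ := Zh_affine_bounds (s := s j) hc hκ (h j) hτ
    exact norm_zpow_le (factorBound_pos c κ) h1 h2 _
  refine ⟨hdiff, fun τ hτ => (hbd τ hτ).trans (by linarith), fun τ₁ τ₂ h₁ h₂ => ?_⟩
  have hconv : Convex ℝ {τ : ℂ | 1 / 2 ≤ τ.im} := convex_halfSpace_im_ge _
  refine hconv.norm_image_sub_le_of_norm_deriv_le (𝕜 := ℂ) (fun τ hτ => ?_) (fun τ hτ => ?_) h₂ h₁
  · refine hdiff.differentiableAt (hU.mem_nhds ?_)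
    exact lt_of_lt_of_le (by norm_num : (1 : ℝ) / 4 < 1 / 2) hτ
  · have hball : Metric.closedBall τ (1 / 8) ⊆ {τ : ℂ | 1 / 4 < τ.im} := by
      intro w hw
      rw [Metric.mem_closedBall, dist_eq_norm] at hw
      have h3 := (Complex.abs_im_le_norm (w - τ)).trans hw
      rw [Complex.sub_im, abs_le] at h3
      have h4 : (1 : ℝ) / 2 ≤ τ.im := hτ
      rw [Set.mem_ofPred_eq]
      linarith [h3.1]
    have := Complex.norm_deriv_le_of_forall_mem_sphere_norm_le (c := τ) (R := 1 / 8) (C := B₀)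
      (by norm_num) ((hdiff.mono hball).diffContOnCl_ball le_rfl)
      (fun w hw => hbd w (hball (Metric.sphere_subset_closedBall hw)))
    refine this.trans (le_of_eq ?_)
    ring


/-! ### The product at a Farey fraction -/

theorem Zh_add_int (ς τ : ℂ) (a b : ℤ) : Zh (ς + a) (τ + b) = Zh ς τ := by
  have e : ∀ (w : ℂ) (n : ℤ), cexp (2 * π * I * (w + n)) = cexp (2 * π * I * w) := by
    intro w n
    rw [Complex.exp_eq_exp_iff_exists_int]
    exact ⟨n, by ring⟩
  unfold Zh
  rw [e, e]

/-- At τ = (h + iz)/k the denominator k'mτ - m'h collapses to m'iz, and determinant one gives the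
rest. -/
theorem moebius_gammaMat {m h k : ℕ} {z : ℂ} (hm : 0 < m) (hk : 0 < k) (hhk : Nat.gcd h k = 1)
    (hz : z ≠ 0) :
    moebiusStar (gammaMat m h k) (m * ((h + I * z) / k)) = 1 / ((m / Nat.gcd m k : ℕ) * I * z) ∧
    moebius (gammaMat m h k) (m * ((h + I * z) / k)) =
      (hbar m h k - 1 / ((m / Nat.gcd m k : ℕ) * I * z)) / (k / Nat.gcd m k : ℕ) := by
  have hdet := gammaMat_det m h k hk hhk
  have hd0 : 0 < Nat.gcd m k := Nat.gcd_pos_of_pos_right m hk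
  have hdm := Nat.div_mul_cancel (Nat.gcd_dvd_left m k)
  have hdk := Nat.div_mul_cancel (Nat.gcd_dvd_right m k)
  have hk'0 : 0 < k / Nat.gcd m k := Nat.div_pos (Nat.gcd_le_right _ hk) hd0
  have hm'0 : 0 < m / Nat.gcd m k := Nat.div_pos (Nat.gcd_le_left _ hm) hd0
  rw [gammaMat, Matrix.det_fin_two_of] at hdet
  simp only [moebius, moebiusStar, gammaMat, Matrix.of_apply, Matrix.cons_val', Matrix.cons_val_zero,
    Matrix.cons_val_one, Matrix.cons_val_fin_one]
  set b := (hbar m h k * ((m / Nat.gcd m k * h : ℕ) : ℤ) + 1) / ((k / Nat.gcd m k : ℕ) : ℤ) with hb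
  clear_value b
  set d := Nat.gcd m k with hd
  clear_value d
  set m' := m / d with hm'
  set k' := k / d with hk'
  clear_value m' k'
  have hmr : (m : ℂ) = m' * d := by exact_mod_cast hdm.symm
  have hkr : (k : ℂ) = k' * d := by exact_mod_cast hdk.symm
  have hdr : (d : ℂ) ≠ 0 := by exact_mod_cast hd0.ne'
  have hm'r : (m' : ℂ) ≠ 0 := by exact_mod_cast hm'0.ne'
  have hk'r : (k' : ℂ) ≠ 0 := by exact_mod_cast hk'0.ne'
  have e : ((k' : ℤ) : ℂ) * (m * ((h + I * z) / k)) + ((-((m' * h : ℕ) : ℤ) : ℤ) : ℂ) =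
      m' * I * z := by
    rw [hmr, hkr]
    push_cast
    field_simp
    ring
  have hdetc : (hbar m h k : ℂ) * -(m' * h) - -(b : ℂ) * k' = 1 := by
    have := congrArg (Int.cast : ℤ → ℂ) hdet
    push_cast at this
    exact this
  rw [e]
  refine ⟨rfl, ?_⟩
  rw [hmr, hkr]
  push_cast
  field_simp
  linear_combination -hdetc

/-- The arguments of a factor, in terms of an inverse `x` of `-h`. -/
theorem factor_args {m r h k : ℕ} {x B y : ℤ} {z : ℂ} (hm : 0 < m) (hk : 0 < k) (hz : z ≠ 0)
    (hB : k * B = 1 + h * x)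
    (hy : ((k / Nat.gcd m k : ℕ) : ℤ) * y = (m / Nat.gcd m k : ℕ) * hbar m h k - x) :
    (r : ℂ) * ((h + I * z) / k) * moebiusStar (gammaMat m h k) (m * ((h + I * z) / k)) +
        lam m r h k * moebius (gammaMat m h k) (m * ((h + I * z) / k)) =
      (Nat.gcd m k * sig m r h k / m : ℝ) * (x / k + I / (k * z)) +
        ((lam m r h k * y + r * B : ℤ) / (m / Nat.gcd m k : ℕ) : ℝ) ∧
    moebius (gammaMat m h k) (m * ((h + I * z) / k)) =
      ((Nat.gcd m k : ℝ) ^ 2 / m : ℝ) * (x / k + I / (k * z)) +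
        (y / (m / Nat.gcd m k : ℕ) : ℝ) := by
  have hhk : Nat.gcd h k = 1 := by
    refine Nat.isCoprime_iff_coprime.1 (isCoprime_of_mul_modEq_neg_one (x := x) ?_)
    refine (Int.modEq_iff_dvd.2 ⟨-B, ?_⟩)
    linear_combination hB
  obtain ⟨e1, e2⟩ := moebius_gammaMat hm hk hhk hz
  have hd0 : 0 < Nat.gcd m k := Nat.gcd_pos_of_pos_right m hk
  have hdm := Nat.div_mul_cancel (Nat.gcd_dvd_left m k)
  have hdk := Nat.div_mul_cancel (Nat.gcd_dvd_right m k)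
  have hk'0 : 0 < k / Nat.gcd m k := Nat.div_pos (Nat.gcd_le_right _ hk) hd0
  have hm'0 : 0 < m / Nat.gcd m k := Nat.div_pos (Nat.gcd_le_left _ hm) hd0
  rw [e1, e2]
  unfold sig
  generalize lam m r h k = l
  generalize hbar m h k = H at hy ⊢
  set d := Nat.gcd m k with hd
  clear_value d
  set m' := m / d with hm'
  set k' := k / d with hk'
  clear_value m' k'
  have hmr : (m : ℂ) = m' * d := by exact_mod_cast hdm.symm
  have hkr : (k : ℂ) = k' * d := by exact_mod_cast hdk.symm
  have hdr : (d : ℂ) ≠ 0 := by exact_mod_cast hd0.ne'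
  have hm'r : (m' : ℂ) ≠ 0 := by exact_mod_cast hm'0.ne'
  have hk'r : (k' : ℂ) ≠ 0 := by exact_mod_cast hk'0.ne'
  have hBc : (k' : ℂ) * d * B = 1 + h * x := by
    rw [← hkr]; exact_mod_cast hB
  have hyc : (k' : ℂ) * y = m' * H - x := by exact_mod_cast hy
  have hI := Complex.I_sq
  push_cast
  rw [hmr, hkr]
  constructor
  · field_simp
    linear_combination (-(l : ℂ) * z * d * I) * hyc - (r : ℂ) * z * I * hBc -
      ((d : ℂ) * l - r * h) * hI
  · field_simp
    linear_combination (-z * I) * hyc - hI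

/-- The shift preserves γ and moves λ by r k'i, so the first argument of each factor Z moves by the
integer r i ħ. -/
theorem zhProd_add_mul {J : ℕ} (m r : Fin J → ℕ) (δ : Fin J → ℤ) {h k : ℕ} (i : ℕ) {z : ℂ}
    (hm : ∀ j, 0 < m j) (hk : 0 < k) (hhk : Nat.gcd h k = 1) (hz : z ≠ 0) :
    zhProd m r δ (h + k * i) k (((h + k * i : ℕ) + I * z) / k) =
      zhProd m r δ h k ((h + I * z) / k) := by
  unfold zhProd
  refine Finset.prod_congr rfl fun j _ => ?_
  have hhk' : Nat.gcd (h + k * i) k = 1 := by simpa using hhk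
  obtain ⟨e1, e2⟩ := moebius_gammaMat (hm j) hk hhk hz
  obtain ⟨f1, f2⟩ := moebius_gammaMat (hm j) hk hhk' hz
  have hmod : h + k * i ≡ h [MOD k] := by simp [Nat.ModEq]
  have hb := hbar_congr (m j) hmod
  have hs := sig_congr (m j) (r j) hk (h := h + k * i) (h' := h)
    ((Int.natCast_modEq_iff.2 hmod).of_dvd (Int.natCast_dvd_natCast.2 (Nat.gcd_dvd_right (m j) k)))
  rw [e1, e2, f1, f2, hb]
  have hd0 : 0 < Nat.gcd (m j) k := Nat.gcd_pos_of_pos_right (m j) hk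
  have hdm := Nat.div_mul_cancel (Nat.gcd_dvd_left (m j) k)
  have hdk := Nat.div_mul_cancel (Nat.gcd_dvd_right (m j) k)
  have hk'0 : 0 < k / Nat.gcd (m j) k := Nat.div_pos (Nat.gcd_le_right _ hk) hd0
  have hm'0 : 0 < m j / Nat.gcd (m j) k := Nat.div_pos (Nat.gcd_le_left _ (hm j)) hd0
  unfold sig at hs
  generalize hbar (m j) h k = H
  generalize lam (m j) (r j) (h + k * i) k = l₁ at hs ⊢
  generalize lam (m j) (r j) h k = l₂ at hs ⊢
  set d := Nat.gcd (m j) k with hd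
  clear_value d
  set m' := m j / d with hm'
  set k' := k / d with hk'
  clear_value m' k'
  have hl : l₁ = l₂ + r j * k' * i := by
    have hdz : (d : ℤ) ≠ 0 := by exact_mod_cast hd0.ne'
    apply mul_left_cancel₀ hdz
    have hkz : (k : ℤ) = k' * d := by exact_mod_cast hdk.symm
    push_cast at hs
    linear_combination hs + (r j * i : ℤ) * hkz
  have hkr : (k : ℂ) = k' * d := by exact_mod_cast hdk.symm
  have hdr : (d : ℂ) ≠ 0 := by exact_mod_cast hd0.ne'
  have hm'r : (m' : ℂ) ≠ 0 := by exact_mod_cast hm'0.ne'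
  have hk'r : (k' : ℂ) ≠ 0 := by exact_mod_cast hk'0.ne'
  have hlc : (l₁ : ℂ) = l₂ + r j * k' * i := by exact_mod_cast hl
  congr 1
  refine Eq.trans ?_ (Zh_add_int _ _ (r j * i * H) 0)
  rw [Int.cast_zero, add_zero]
  congr 1
  push_cast
  rw [hlc, hkr]
  field_simp
  ring

theorem norm_one_sub_ex_div_ge {n : ℕ} {v : ℤ} (hn : 0 < n) (hv : ¬ (n : ℤ) ∣ v) :
    2 / (n : ℝ) ≤ ‖1 - ex (v / n)‖ := by
  have hnz : (n : ℤ) ≠ 0 := by exact_mod_cast hn.ne'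
  obtain ⟨a, ha⟩ := Int.eq_ofNat_of_zero_le (Int.emod_nonneg v hnz)
  have ha0 : 0 < a := by
    rcases Nat.eq_zero_or_pos a with h | h
    · exact absurd (Int.dvd_of_emod_eq_zero (by rw [ha, h]; rfl)) hv
    · exact h
  have han : a < n := by
    have := Int.emod_lt_of_pos v (by exact_mod_cast hn : (0 : ℤ) < n)
    omega
  have hnr : (0 : ℝ) < n := by exact_mod_cast hn
  have e : ex (v / n) = ex (a / n) := by
    refine ex_eq_ex (v / n) ?_
    have h1 : (v : ℝ) = n * ((v / n : ℤ) : ℝ) + a := by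
      have := Int.mul_ediv_add_emod v n
      rw [ha] at this
      exact_mod_cast this.symm
    rw [h1]
    field_simp
    ring
  have h4 := four_le_mul_norm_exp_sub_one ha0 han
  have h5 : (1 : ℝ) / a + 1 / (n - a) ≤ 2 := by
    have h6 : (1 : ℝ) ≤ a := by exact_mod_cast ha0
    have h7 : (1 : ℝ) ≤ n - a := by
      have : ((a + 1 : ℕ) : ℝ) ≤ n := by exact_mod_cast han
      push_cast at this
      linarith
    have := (div_le_one (by linarith)).2 h6
    have := (div_le_one (by linarith)).2 h7
    linarith
  rw [e, norm_sub_rev, div_le_iff₀ hnr, ex]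
  push_cast
  set X := ‖cexp (2 * π * I * (a / n)) - 1‖ with hX
  have hX0 : 0 ≤ X := norm_nonneg _
  have h6 : (n : ℝ) * (1 / a + 1 / (n - a)) * X ≤ n * 2 * X := by gcongr
  linarith

theorem affineProd_add_int {J : ℕ} (δ : Fin J → ℤ) {α β u s : Fin J → ℝ} {T : ℤ}
    (hα : ∀ j, ∃ a : ℤ, α j * T = a) (hβ : ∀ j, ∃ b : ℤ, β j * T = b) (τ : ℂ) :
    affineProd δ α β u s (τ + T) = affineProd δ α β u s τ := by
  unfold affineProd
  refine Finset.prod_congr rfl fun j _ => ?_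
  obtain ⟨a, ha⟩ := hα j
  obtain ⟨b, hb⟩ := hβ j
  have hac : (α j : ℂ) * T = a := by exact_mod_cast congrArg (Complex.ofReal) ha
  have hbc : (β j : ℂ) * T = b := by exact_mod_cast congrArg (Complex.ofReal) hb
  rw [← Zh_add_int (α j * τ + u j) _ a b]
  congr 2
  · linear_combination hac
  · linear_combination hbc

/-- The product around `h / k` is a bounded Lipschitz function of `x / k + i / (k z)`, where `x` is
an inverse of `-h`, that depends only on a residue class of `h`. -/
theorem exists_zhProd_eq {J : ℕ} (m r : Fin J → ℕ) (δ : Fin J → ℤ)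
    (hr : ∀ j, 1 ≤ r j ∧ r j < m j) :
    ∃ B : ℝ, 0 < B ∧ ∀ k M : ℕ, 0 < k → (∀ j, m j ∣ M) → ∃ Q : ℕ → ℂ → ℂ, (∀ t,
      ContinuousOn (Q t) {τ : ℂ | 1 / 4 < τ.im} ∧
      (∀ τ : ℂ, 1 / 4 < τ.im → ‖Q t τ‖ ≤ B) ∧
      (∀ τ₁ τ₂ : ℂ, 1 / 2 ≤ τ₁.im → 1 / 2 ≤ τ₂.im → ‖Q t τ₁ - Q t τ₂‖ ≤ B * ‖τ₁ - τ₂‖) ∧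
      (∀ T : ℤ, (∀ j, ((m j / Nat.gcd (m j) k : ℕ) : ℤ) ∣ T) → ∀ τ, Q t (τ + T) = Q t τ)) ∧
      ∀ (h : ℕ) (x : ℤ) (z : ℂ), h * x ≡ -1 [ZMOD (M * k : ℕ)] → z ≠ 0 →
        zhProd m r δ h k ((h + I * z) / k) = Q (h % M) (x / k + I / (k * z)) := by
  have hm : ∀ j, 0 < m j := fun j => by have := hr j; omega
  -- A common lower bound for all 1/m_j; the added 1 keeps the denominator positive when J = 0.
  set c : ℝ := 1 / ((∑ j, m j : ℕ) + 1) with hc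
  have hc0 : 0 < c := by positivity
  have hcm : ∀ j, c ≤ 1 / (m j : ℝ) := by
    intro j
    have h1 : (0 : ℝ) < m j := by exact_mod_cast hm j
    refine one_div_le_one_div_of_le h1 ?_
    have h2 : m j ≤ ∑ j, m j := Finset.single_le_sum (f := m) (fun _ _ => Nat.zero_le _)
      (Finset.mem_univ j)
    have : (m j : ℝ) ≤ (∑ j, m j : ℕ) := by exact_mod_cast h2
    linarith
  obtain ⟨B, hB, hprop⟩ := exists_affineProd_bounds δ hc0 hc0
  refine ⟨B, hB, fun k M hk hM => ?_⟩
  have hkMk : (k : ℤ) ∣ ((M * k : ℕ) : ℤ) := ⟨M, by push_cast; ring⟩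
  have hMMk : (M : ℤ) ∣ ((M * k : ℕ) : ℤ) := ⟨k, by push_cast; ring⟩
  have hd0 : ∀ j, 0 < Nat.gcd (m j) k := fun j => Nat.gcd_pos_of_pos_right _ hk
  have hdm := fun j => Nat.div_mul_cancel (Nat.gcd_dvd_left (m j) k)
  have hm'0 : ∀ j, 0 < m j / Nat.gcd (m j) k :=
    fun j => Nat.div_pos (Nat.gcd_le_left _ (hm j)) (hd0 j)
  have hmr : ∀ j, (m j : ℝ) = (m j / Nat.gcd (m j) k : ℕ) * (Nat.gcd (m j) k : ℕ) :=
    fun j => by exact_mod_cast (hdm j).symm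
  suffices H : ∀ t, ∃ Qt : ℂ → ℂ, (ContinuousOn Qt {τ : ℂ | 1 / 4 < τ.im} ∧
      (∀ τ : ℂ, 1 / 4 < τ.im → ‖Qt τ‖ ≤ B) ∧
      (∀ τ₁ τ₂ : ℂ, 1 / 2 ≤ τ₁.im → 1 / 2 ≤ τ₂.im → ‖Qt τ₁ - Qt τ₂‖ ≤ B * ‖τ₁ - τ₂‖) ∧
      (∀ T : ℤ, (∀ j, ((m j / Nat.gcd (m j) k : ℕ) : ℤ) ∣ T) → ∀ τ, Qt (τ + T) = Qt τ)) ∧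
      ∀ (h : ℕ) (x : ℤ) (z : ℂ), h * x ≡ -1 [ZMOD (M * k : ℕ)] → h % M = t → z ≠ 0 →
        zhProd m r δ h k ((h + I * z) / k) = Qt (x / k + I / (k * z)) by
    choose Q hQ1 hQ2 using H
    exact ⟨Q, hQ1, fun h x z hx hz => hQ2 _ h x z hx rfl hz⟩
  intro t
  by_cases hex : ∃ (h : ℕ) (x : ℤ), h * x ≡ -1 [ZMOD (M * k : ℕ)] ∧ h % M = t
  swap
  · refine ⟨fun _ => 0, ⟨continuousOn_const, fun _ _ => by simpa using hB.le,
      fun τ₁ τ₂ _ _ => by rw [sub_zero, norm_zero]; positivity, fun _ _ _ => rfl⟩,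
      fun h x z hx ht _ => absurd ⟨h, x, hx, ht⟩ hex⟩
  obtain ⟨h₀, x₀, hx₀, ht₀⟩ := hex
  choose y₀ hy₀ using fun j => exists_hbar_quotient (m := m j) hk (hx₀.of_dvd hkMk)
  have hcoM : IsCoprime (h₀ : ℤ) M := isCoprime_of_mul_modEq_neg_one (hx₀.of_dvd hMMk)
  -- With d = gcd(m_j, k) and σ = dλ*, the slopes are α = dσ/m and β = d²/m, and 0 ≤ σ ≤ d - 1 gives
  -- β - α ≥ 1/m. If σ = 0, then ζ = e(λy₀/m'), and this is not 1: otherwise m' ∣ λ, hence m ∣ rh₀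
  -- and m ∣ r, against 1 ≤ r < m.
  have hadm : ∀ j, Admissible c c ((Nat.gcd (m j) k : ℝ) * sig (m j) (r j) h₀ k / m j)
      ((Nat.gcd (m j) k : ℝ) ^ 2 / m j)
      ((lam (m j) (r j) h₀ k * y₀ j : ℤ) / (m j / Nat.gcd (m j) k : ℕ)) := by
    intro j
    have hs0 := sig_nonneg (m j) (r j) h₀ k hk
    have hs1 := sig_lt (m j) (r j) h₀ k hk
    have hmj : (0 : ℝ) < m j := by exact_mod_cast hm j
    have hd1 : (1 : ℝ) ≤ Nat.gcd (m j) k := by exact_mod_cast hd0 j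
    refine ⟨(hcm j).trans ?_, ?_⟩
    · rw [← sub_div]
      refine div_le_div_of_nonneg_right ?_ hmj.le
      have : (1 : ℝ) ≤ Nat.gcd (m j) k - sig (m j) (r j) h₀ k := by
        have : (1 : ℤ) ≤ Nat.gcd (m j) k - sig (m j) (r j) h₀ k := by omega
        exact_mod_cast this
      nlinarith
    · rcases hs0.eq_or_lt with hs | hs
      · right
        refine ⟨by rw [← hs]; simp, ?_⟩
        refine le_trans ?_ (norm_one_sub_ex_div_ge (hm'0 j) ?_)
        · have h1 : ((m j / Nat.gcd (m j) k : ℕ) : ℝ) ≤ m j := by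
            exact_mod_cast Nat.div_le_self _ _
          have h2 : (0 : ℝ) < (m j / Nat.gcd (m j) k : ℕ) := by exact_mod_cast hm'0 j
          calc c ≤ 1 / (m j : ℝ) := hcm j
            _ ≤ 2 / (m j : ℝ) := by gcongr; norm_num
            _ ≤ _ := by gcongr
        · intro hdvd
          have hm'M : ((m j / Nat.gcd (m j) k : ℕ) : ℤ) ∣ M := Int.natCast_dvd_natCast.2
            ((Nat.div_dvd_of_dvd (Nat.gcd_dvd_left _ _)).trans (hM j))
          have hxco : IsCoprime (x₀ : ℤ) (m j / Nat.gcd (m j) k : ℕ) :=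
            isCoprime_of_mul_modEq_neg_one (x := h₀)
              (by rw [mul_comm]; exact (hx₀.of_dvd hMMk).of_dvd hm'M)
          have hyco : IsCoprime (y₀ j) (m j / Nat.gcd (m j) k : ℕ) := by
            have h1 : IsCoprime (((k / Nat.gcd (m j) k : ℕ) : ℤ) * y₀ j)
                (m j / Nat.gcd (m j) k : ℕ) := by
              rw [hy₀ j]
              obtain ⟨a, b, hab⟩ := hxco
              exact ⟨-a, a * hbar (m j) h₀ k + b, by linear_combination hab⟩
            exact h1.of_mul_left_right
          have h2 := hyco.symm.dvd_of_dvd_mul_right hdvd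
          have h3 : (m j : ℤ) ∣ r j * h₀ := by
            have h4 : (Nat.gcd (m j) k : ℤ) * lam (m j) (r j) h₀ k = r j * h₀ := by
              unfold sig at hs
              linarith
            rw [← h4]
            obtain ⟨q, hq⟩ := h2
            refine ⟨q, ?_⟩
            rw [hq]
            have : (m j : ℤ) = (m j / Nat.gcd (m j) k : ℕ) * (Nat.gcd (m j) k : ℕ) := by
              exact_mod_cast (hdm j).symm
            linear_combination (-q) * this
          have h5 : (m j : ℤ) ∣ r j := (hcoM.of_isCoprime_of_dvd_right
            (Int.natCast_dvd_natCast.2 (hM j))).symm.dvd_of_dvd_mul_right h3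
          have h6 := Nat.le_of_dvd (hr j).1 (Int.natCast_dvd_natCast.1 h5)
          exact absurd (hr j).2 (by omega)
      · left
        refine (hcm j).trans (div_le_div_of_nonneg_right ?_ hmj.le)
        have : (1 : ℝ) ≤ sig (m j) (r j) h₀ k := by exact_mod_cast hs
        nlinarith
  set s₀ : Fin J → ℝ := fun j => (y₀ j : ℝ) / (m j / Nat.gcd (m j) k : ℕ) with hs₀
  obtain ⟨hd, hb, hl⟩ := hprop _ _ _ s₀ hadm
  refine ⟨_, ⟨hd.continuousOn, hb, hl, fun T hT => affineProd_add_int δ (fun j => ?_)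
    (fun j => ?_)⟩, ?_⟩
  · obtain ⟨q, hq⟩ := hT j
    refine ⟨sig (m j) (r j) h₀ k * q, ?_⟩
    have h1 : ((m j / Nat.gcd (m j) k : ℕ) : ℝ) ≠ 0 := by exact_mod_cast (hm'0 j).ne'
    have h2 : (Nat.gcd (m j) k : ℝ) ≠ 0 := by exact_mod_cast (hd0 j).ne'
    rw [hmr j, hq]
    generalize ((m j / Nat.gcd (m j) k : ℕ)) = m' at h1 ⊢
    push_cast
    field_simp
  · obtain ⟨q, hq⟩ := hT j
    refine ⟨Nat.gcd (m j) k * q, ?_⟩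
    have h1 : ((m j / Nat.gcd (m j) k : ℕ) : ℝ) ≠ 0 := by exact_mod_cast (hm'0 j).ne'
    have h2 : (Nat.gcd (m j) k : ℝ) ≠ 0 := by exact_mod_cast (hd0 j).ne'
    rw [hmr j, hq]
    generalize ((m j / Nat.gcd (m j) k : ℕ)) = m' at h1 ⊢
    push_cast
    field_simp
  · intro h x z hx ht hz
    have hcong : (h : ℤ) ≡ h₀ [ZMOD M] := by
      exact Int.natCast_modEq_iff.2 (ht.trans ht₀.symm)
    have hxx : x ≡ x₀ [ZMOD M] :=
      modEq_of_mul_modEq_neg_one (hx.of_dvd hMMk) (hx₀.of_dvd hMMk) hcong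
    choose y hy using fun j => exists_hbar_quotient (m := m j) hk (hx.of_dvd hkMk)
    obtain ⟨b, hb⟩ := hx.dvd
    obtain ⟨e, he⟩ := hcong.symm.dvd
    unfold zhProd affineProd
    refine Finset.prod_congr rfl fun j _ => ?_
    obtain ⟨a1, a2⟩ := factor_args (r := r j) (B := -(M * b)) (hm j) hk hz
      (by push_cast at hb; linear_combination hb) (hy j)
    rw [mul_assoc ((r j : ℂ)), ← mul_assoc ((r j : ℂ)), a1, a2]
    obtain ⟨hl, hsig⟩ := lam_sub_lam (r := r j) hk (hM j) he
    obtain ⟨ey, hey⟩ := (hbar_quotient_congr hk (hM j) hxx (hy j) (hy₀ j)).symm.dvd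
    obtain ⟨M', hM'⟩ := hM j
    rw [hsig]
    have hmz : (m j : ℤ) = (m j / Nat.gcd (m j) k : ℕ) * (Nat.gcd (m j) k : ℕ) := by
      exact_mod_cast (hdm j).symm
    have hMz : (M : ℤ) = (m j / Nat.gcd (m j) k : ℕ) * (Nat.gcd (m j) k : ℕ) * M' := by
      rw [← hmz]; exact_mod_cast hM'
    have h1 : ((m j / Nat.gcd (m j) k : ℕ) : ℂ) ≠ 0 := by exact_mod_cast (hm'0 j).ne'
    set m' := m j / Nat.gcd (m j) k with hm'
    set d := Nat.gcd (m j) k with hd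
    have hll : lam (m j) (r j) h k = lam (m j) (r j) h₀ k + r j * m' * M' * e := by
      have hdz : (d : ℤ) ≠ 0 := by exact_mod_cast (hd0 j).ne'
      apply mul_left_cancel₀ hdz
      rw [hMz] at hl
      linear_combination hl
    have hyy : y j = y₀ j + m' * ey := by linarith
    congr 1
    -- Since m_j ∣ M and both h ≡ h₀ and x ≡ x₀ modulo M, passing to the representative h₀ moves
    -- both arguments of Z by integers.
    rw [← Zh_add_int (((d * sig (m j) (r j) h₀ k / m j : ℝ) : ℂ) * (x / k + I / (k * z)) +
      (((lam (m j) (r j) h₀ k * y₀ j : ℤ) / (m' : ℝ) : ℝ) : ℂ)) _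
      (lam (m j) (r j) h₀ k * ey + r j * M' * e * y j - r j * d * M' * b) ey]
    congr 1
    · rw [hll, hyy, hMz]
      push_cast
      field_simp
      ring
    · rw [hs₀]
      dsimp only
      rw [← hm', hyy]
      push_cast
      field_simp
      ring


/-! ### Farey arcs -/

/-- The length of the half of the Farey arc at `h / k` to the right, in terms of an inverse `x`
of `-h`. -/
noncomputable def arcEnd (N k : ℕ) (x : ℤ) : ℝ :=
  1 / ((k : ℝ) * ((k : ℝ) + ((N - (N - x) % k : ℤ) : ℝ)))

/-- By determinant one, a fraction strictly between h/k and a/b has denominator k·A + b·B with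
integers A, B ≥ 1, hence at least k + b > N. -/
theorem fareyNext_eq {N h k a b : ℕ} (hN : 1 ≤ N) (hk : 0 < k) (hkN : k ≤ N)
    (hab : a * k = 1 + b * h) (hb1 : N < b + k) (hb2 : b ≤ N) :
    fareyNext N ((h : ℚ) / k) = (a : ℚ) / b := by
  have hb0 : 0 < b := by omega
  refine (fareyNext_isLeast N hN _).unique ⟨⟨?_, ?_⟩, ?_⟩
  · rw [div_lt_div_iff₀ (by exact_mod_cast hk) (by exact_mod_cast hb0)]
    exact_mod_cast (by linarith : h * b < a * k)
  · have h1 : ((((a : ℚ)) / (b : ℚ)).den : ℤ) ∣ (b : ℤ) := by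
      have := Rat.den_dvd a b
      simpa [Rat.divInt_eq_div] using this
    exact (Nat.le_of_dvd hb0 (Int.natCast_dvd_natCast.1 h1)).trans hb2
  · rintro p ⟨hp, hpN⟩
    by_contra hlt
    rw [not_le, lt_div_iff₀ (by exact_mod_cast hb0)] at hlt
    rw [div_lt_iff₀ (by exact_mod_cast hk)] at hp
    have hd0 : (0 : ℚ) < p.den := by exact_mod_cast p.pos
    have hnum : p * p.den = p.num := Rat.mul_den_eq_num p
    have i1 : (p.num : ℤ) * b + 1 ≤ a * p.den := by
      have : (p.num : ℚ) * b < a * p.den := by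
        rw [← hnum]; nlinarith
      exact_mod_cast this
    have i2 : (h : ℤ) * p.den + 1 ≤ p.num * k := by
      have : (h : ℚ) * p.den < p.num * k := by
        rw [← hnum]; nlinarith
      exact_mod_cast this
    have habz : (a : ℤ) * k = 1 + b * h := by exact_mod_cast hab
    have e : (p.den : ℤ) = k * (a * p.den - p.num * b) + b * (p.num * k - h * p.den) := by
      linear_combination (-(p.den : ℤ)) * habz
    have : (k : ℤ) + b ≤ p.den := by
      rw [e]
      have hkz : (0 : ℤ) ≤ k := by positivity
      have hbz : (0 : ℤ) ≤ b := by positivity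
      nlinarith
    have : k + b ≤ p.den := by exact_mod_cast this
    omega

theorem fareyPrev_eq {N h k b : ℕ} {a : ℤ} (hN : 1 ≤ N) (hk : 0 < k) (hkN : k ≤ N)
    (hab : a * k + 1 = b * h) (hb1 : N < b + k) (hb2 : b ≤ N) :
    fareyPrev N ((h : ℚ) / k) = (a : ℚ) / b := by
  have hb0 : 0 < b := by omega
  refine (fareyPrev_isGreatest N hN _).unique ⟨⟨?_, ?_⟩, ?_⟩
  · rw [div_lt_div_iff₀ (by exact_mod_cast hb0) (by exact_mod_cast hk)]
    exact_mod_cast (by linarith : a * k < h * b)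
  · have h1 : (((a : ℚ) / (b : ℤ)).den : ℤ) ∣ (b : ℤ) := by
      have := Rat.den_dvd a b
      simpa [Rat.divInt_eq_div] using this
    exact (Nat.le_of_dvd hb0 (by exact_mod_cast h1)).trans hb2
  · rintro p ⟨hp, hpN⟩
    by_contra hlt
    rw [not_le, div_lt_iff₀ (by exact_mod_cast hb0)] at hlt
    rw [lt_div_iff₀ (by exact_mod_cast hk)] at hp
    have hd0 : (0 : ℚ) < p.den := by exact_mod_cast p.pos
    have hnum : p * p.den = p.num := Rat.mul_den_eq_num p
    have i1 : a * p.den + 1 ≤ (p.num : ℤ) * b := by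
      have : a * p.den < (p.num : ℚ) * b := by
        rw [← hnum]; nlinarith
      exact_mod_cast this
    have i2 : p.num * k + 1 ≤ (h : ℤ) * p.den := by
      have : p.num * k < (h : ℚ) * p.den := by
        rw [← hnum]; nlinarith
      exact_mod_cast this
    have e : (p.den : ℤ) = k * (p.num * b - a * p.den) + b * (h * p.den - p.num * k) := by
      linear_combination (p.den : ℤ) * hab
    have : (k : ℤ) + b ≤ p.den := by
      rw [e]
      have hkz : (0 : ℤ) ≤ k := by positivity
      have hbz : (0 : ℤ) ≤ b := by positivity
      nlinarith
    have : k + b ≤ p.den := by exact_mod_cast this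
    omega

theorem num_den_natCast_div {a : ℤ} {b : ℕ} (hb : 0 < b) (hab : IsCoprime a b) :
    ((a : ℚ) / b).num = a ∧ ((a : ℚ) / b).den = b := by
  have hco : Nat.Coprime a.natAbs (b : ℤ).natAbs := Int.isCoprime_iff_gcd_eq_one.1 hab
  have hb' : (0 : ℤ) < b := by exact_mod_cast hb
  have h1 := Rat.num_div_eq_of_coprime hb' hco
  have h2 := Rat.den_div_eq_of_coprime hb' hco
  push_cast at h1 h2
  exact ⟨h1, by exact_mod_cast h2⟩

/-- This b is the largest integer at most N that is congruent to x modulo k, so it lies in (N - k,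
N]. -/
theorem exists_denominator {N k : ℕ} (hk : 0 < k) (hkN : k ≤ N) (x : ℤ) :
    ∃ b : ℕ, (b : ℤ) = N - (N - x) % k ∧ N < b + k ∧ b ≤ N ∧ (k : ℤ) ∣ b - x := by
  have h1 := Int.emod_nonneg (N - x : ℤ) (by exact_mod_cast hk.ne' : (k : ℤ) ≠ 0)
  have h2 := Int.emod_lt_of_pos (N - x : ℤ) (by exact_mod_cast hk : (0 : ℤ) < k)
  obtain ⟨b, hb⟩ := Int.eq_ofNat_of_zero_le (by omega : (0 : ℤ) ≤ N - (N - x) % k)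
  refine ⟨b, hb.symm, by omega, by omega, ?_⟩
  rw [← hb]
  refine ⟨(N - x) / k, ?_⟩
  linear_combination (-1 : ℤ) * Int.emod_add_mul_ediv (N - x) k

/-- From b ≡ x follows bh ≡ -1 modulo k, so a = (1 + bh)/k is an integer and a/b is the right
neighbour. The mediant exceeds h/k by 1/(k(k + b)). On the left the sign of x is reversed. -/
theorem thetaRight_eq {N h k : ℕ} {x : ℤ} (hk : 0 < k) (hkN : k ≤ N) (hx : h * x ≡ -1 [ZMOD k]) :
    thetaRight N h k = arcEnd N k x := by
  obtain ⟨b, hb, hb1, hb2, hbx⟩ := exists_denominator hk hkN x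
  have hb0 : 0 < b := by omega
  obtain ⟨q, hq⟩ := hbx
  obtain ⟨p, hp⟩ := hx.symm.dvd
  have habz : (h * q + p : ℤ) * k = 1 + b * h := by
    linear_combination -hp - (h : ℤ) * hq
  have ha0 : (0 : ℤ) ≤ h * q + p := by
    by_contra hneg
    have hkz : (0 : ℤ) < k := by exact_mod_cast hk
    have : (0 : ℤ) ≤ b * h := by positivity
    nlinarith
  obtain ⟨a, ha⟩ := Int.eq_ofNat_of_zero_le ha0
  rw [ha] at habz
  have hab : a * k = 1 + b * h := by exact_mod_cast habz
  obtain ⟨n1, d1⟩ := num_den_natCast_div (a := a) hb0 ⟨k, -h, by linear_combination habz⟩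
  obtain ⟨n2, d2⟩ := num_den_natCast_div (a := h) hk ⟨-b, a, by linear_combination habz⟩
  push_cast at n1 d1 n2 d2
  rw [thetaRight, fareyNext_eq (by omega) hk hkN hab hb1 hb2, mediant, n1, d1, n2, d2, arcEnd,
    ← hb]
  have hkr : (k : ℝ) ≠ 0 := by exact_mod_cast hk.ne'
  have hs : (k : ℝ) + b ≠ 0 := by positivity
  have habr : (a : ℝ) * k = 1 + b * h := by exact_mod_cast hab
  push_cast
  field_simp
  linear_combination habr

theorem thetaLeft_eq {N h k : ℕ} {x : ℤ} (hk : 0 < k) (hkN : k ≤ N) (hx : h * x ≡ -1 [ZMOD k]) :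
    thetaLeft N h k = arcEnd N k (-x) := by
  obtain ⟨b, hb, hb1, hb2, hbx⟩ := exists_denominator hk hkN (-x)
  have hb0 : 0 < b := by omega
  obtain ⟨q, hq⟩ := hbx
  obtain ⟨p, hp⟩ := hx.symm.dvd
  obtain ⟨a, ha⟩ : ∃ a : ℤ, a = h * q - p := ⟨_, rfl⟩
  have hab : a * k + 1 = b * h := by
    rw [ha]
    linear_combination hp - (h : ℤ) * hq
  obtain ⟨n1, d1⟩ := num_den_natCast_div (a := a) hb0 ⟨-k, h, by linear_combination -hab⟩
  obtain ⟨n2, d2⟩ := num_den_natCast_div (a := h) hk ⟨b, -a, by linear_combination -hab⟩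
  push_cast at n1 d1 n2 d2
  rw [thetaLeft, fareyPrev_eq (by omega) hk hkN hab hb1 hb2, mediant, n1, d1, n2, d2, arcEnd,
    ← hb]
  have hkr : (k : ℝ) ≠ 0 := by exact_mod_cast hk.ne'
  have hs : (k : ℝ) + b ≠ 0 := by positivity
  have habr : (a : ℝ) * k + 1 = b * h := by exact_mod_cast hab
  have hs' : (b : ℝ) + k ≠ 0 := by positivity
  push_cast
  field_simp
  linear_combination -((k : ℝ) + b) * habr

theorem arcEnd_bounds {N k : ℕ} (hk : 0 < k) (hkN : k ≤ N) (x : ℤ) :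
    0 ≤ arcEnd N k x ∧ arcEnd N k x ≤ 1 / (k * N) := by
  obtain ⟨b, hb, hb1, -, -⟩ := exists_denominator hk hkN x
  rw [arcEnd, ← hb]
  have hkr : (0 : ℝ) < k := by exact_mod_cast hk
  have hN : (0 : ℝ) < N := by exact_mod_cast hk.trans_le hkN
  refine ⟨by push_cast; positivity, ?_⟩
  have : (N : ℝ) ≤ k + (b : ℤ) := by
    have : N ≤ k + b := by omega
    exact_mod_cast this
  gcongr

theorem arcEnd_congr {N k : ℕ} {x y : ℤ} (h : x ≡ y [ZMOD k]) : arcEnd N k x = arcEnd N k y := by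
  rw [arcEnd, arcEnd, (h.sub_left (N : ℤ)).eq]

/-- As x grows by one, so does the denominator b of the neighbour, except when b = N and it falls
back to N - k + 1. The latter happens once per period. -/
theorem abs_arcEnd_succ_sub_le {N k : ℕ} (hk : 0 < k) (hkN : k ≤ N) (x : ℤ) :
    |arcEnd N k (x + 1) - arcEnd N k x| ≤
      1 / (k * N ^ 2) + if (k : ℤ) ∣ N - x then 1 / ((k : ℝ) * N) else 0 := by
  have hkr : (0 : ℝ) < k := by exact_mod_cast hk
  have hN : (0 : ℝ) < N := by exact_mod_cast hk.trans_le hkN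
  split_ifs with hd
  · obtain ⟨h1, h2⟩ := arcEnd_bounds hk hkN x
    obtain ⟨h3, h4⟩ := arcEnd_bounds hk hkN (x + 1)
    have : (0 : ℝ) ≤ 1 / (k * N ^ 2) := by positivity
    rw [abs_le]
    constructor <;> linarith
  · obtain ⟨b, hb, hb1, hb2, -⟩ := exists_denominator hk hkN x
    have hmod : (N - (x + 1) : ℤ) % k = (N - x) % k - 1 := by
      have h1 := Int.emod_nonneg (N - x : ℤ) (by exact_mod_cast hk.ne' : (k : ℤ) ≠ 0)
      have h2 := Int.emod_lt_of_pos (N - x : ℤ) (by exact_mod_cast hk : (0 : ℤ) < k)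
      have h3 : (N - x : ℤ) % k ≠ 0 := fun h => hd (Int.dvd_of_emod_eq_zero h)
      have h4 : (N - (x + 1) : ℤ) ≡ (N - x) % k - 1 [ZMOD k] := by
        have := (Int.mod_modEq (N - x : ℤ) k).symm.sub_right 1
        refine Int.ModEq.trans ?_ this
        rw [show (N - (x + 1) : ℤ) = N - x - 1 by ring]
      rw [h4.eq]
      exact Int.emod_eq_of_lt (by omega) (by omega)
    have e : (N - (N - (x + 1)) % k : ℤ) = b + 1 := by rw [hmod]; omega
    rw [arcEnd, arcEnd, e, ← hb, add_zero]
    push_cast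
    have hNb : (N : ℝ) ≤ k + b := by
      have : N ≤ k + b := by omega
      exact_mod_cast this
    have h0 : (0 : ℝ) < k + b := by linarith
    have e2 : (1 : ℝ) / (k * (k + (b + 1))) - 1 / (k * (k + b)) =
        -(1 / (k * ((k + b) * (k + (b + 1))))) := by
      field_simp
      ring
    rw [e2, abs_neg, abs_of_nonneg (by positivity)]
    gcongr
    nlinarith

/-- The part of the integrand over a Farey arc that does not depend on `h`. -/
noncomputable def arcKernel (Ω D : ℝ) (n N k : ℕ) (φ : ℝ) : ℂ :=
  cexp ((π : ℂ) / (12 * (k : ℂ)) * ((Ω : ℂ) * zVar N k φ + (D : ℂ) * (zVar N k φ)⁻¹)) *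
    (cexp (-2 * π * I * (n : ℂ) * (φ : ℂ)) * cexp (2 * π * (n : ℂ) * (rho N : ℂ)))

theorem rho_pos {N : ℕ} (hN : 0 < N) : 0 < rho N := by
  have : (0 : ℝ) < N := by exact_mod_cast hN
  unfold rho
  positivity

theorem zVar_re (N k : ℕ) (φ : ℝ) : (zVar N k φ).re = k * rho N := by simp [zVar]

theorem zVar_im (N k : ℕ) (φ : ℝ) : (zVar N k φ).im = -(k * φ) := by simp [zVar]

theorem zVar_ne_zero {N k : ℕ} (hk : 0 < k) (hN : 0 < N) (φ : ℝ) : zVar N k φ ≠ 0 := by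
  intro h
  have h1 := zVar_re N k φ
  rw [h, Complex.zero_re] at h1
  have : (0 : ℝ) < k := by exact_mod_cast hk
  have := mul_pos this (rho_pos hN)
  linarith

theorem continuous_zVar (N k : ℕ) : Continuous (zVar N k) := by
  unfold zVar
  fun_prop

theorem continuous_arcKernel {Ω D : ℝ} {n N k : ℕ} (hk : 0 < k) (hN : 0 < N) :
    Continuous (arcKernel Ω D n N k) := by
  have h1 := continuous_zVar N k
  have h2 : Continuous fun φ => (zVar N k φ)⁻¹ := h1.inv₀ (zVar_ne_zero hk hN)
  unfold arcKernel
  fun_prop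

/-- Here Δ ≤ 0 enters: since Re(1/z) ≥ 0, its exponential has norm at most 1. The other factors have
norm independent of φ because Re z = kϱ. -/
theorem norm_arcKernel_le {Ω D : ℝ} {n N k : ℕ} (hk : 0 < k) (hN : 0 < N) (hD : D ≤ 0) (φ : ℝ) :
    ‖arcKernel Ω D n N k φ‖ ≤ Real.exp (2 * π / N ^ 2 * (n + Ω / 24)) := by
  have hkr : (0 : ℝ) < k := by exact_mod_cast hk
  have hre : 0 ≤ ((zVar N k φ)⁻¹).re := by
    rw [Complex.inv_re, zVar_re]
    exact div_nonneg (mul_nonneg hkr.le (rho_pos hN).le) (Complex.normSq_nonneg _)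
  have e1 : (π : ℂ) / (12 * (k : ℂ)) = ((π / (12 * k) : ℝ) : ℂ) := by push_cast; ring
  have e2 : -2 * π * I * (n : ℂ) * (φ : ℂ) = ((-2 * π * n * φ : ℝ) : ℂ) * I := by push_cast; ring
  have e3 : 2 * π * (n : ℂ) * (rho N : ℂ) = ((2 * π * n * rho N : ℝ) : ℂ) := by push_cast; ring
  rw [arcKernel, norm_mul, norm_mul, e2, Complex.norm_exp_ofReal_mul_I, one_mul, e3, e1,
    Complex.norm_exp, Complex.norm_exp, Complex.ofReal_re, ← Real.exp_add, Real.exp_le_exp,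
    Complex.re_ofReal_mul, Complex.add_re, Complex.re_ofReal_mul, Complex.re_ofReal_mul, zVar_re]
  have h1 : D * ((zVar N k φ)⁻¹).re ≤ 0 := mul_nonpos_of_nonpos_of_nonneg hD hre
  have h2 : π / (12 * k) * (Ω * (k * rho N) + D * ((zVar N k φ)⁻¹).re) ≤
      π / (12 * k) * (Ω * (k * rho N)) := by
    refine mul_le_mul_of_nonneg_left (by linarith) ?_
    positivity
  refine (add_le_add_left h2 _).trans (le_of_eq ?_)
  have hNr : (0 : ℝ) < N := by exact_mod_cast hN
  unfold rho
  field_simp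
  ring

/-- The imaginary part is ϱ/(k²ϱ² + k²φ²), and both terms below are at most ϱ, by k ≤ N and by the
length of the arc. -/
theorem half_le_im {N k : ℕ} (hk : 0 < k) (hkN : k ≤ N) (x : ℤ) {φ : ℝ}
    (hφ : |φ| ≤ 1 / (k * N)) :
    1 / 2 ≤ ((x : ℂ) / k + I / (k * zVar N k φ)).im := by
  have hN : 0 < N := hk.trans_le hkN
  have hkr : (0 : ℝ) < k := by exact_mod_cast hk
  have hNr : (0 : ℝ) < N := by exact_mod_cast hN
  have hkNr : (k : ℝ) ≤ N := by exact_mod_cast hkN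
  have e : ((x : ℂ) / k + I / (k * zVar N k φ)).im = rho N / (k ^ 2 * (rho N ^ 2 + φ ^ 2)) := by
    have e1 : (x : ℂ) / k = ((x / k : ℝ) : ℂ) := by push_cast; rfl
    have e2 : I / (k * zVar N k φ) = I * (((1 / k : ℝ) : ℂ) * (zVar N k φ)⁻¹) := by
      have := zVar_ne_zero hk hN φ
      push_cast
      field_simp
    rw [Complex.add_im, e1, Complex.ofReal_im, zero_add, e2, Complex.I_mul_im,
      Complex.re_ofReal_mul, Complex.inv_re, Complex.normSq_apply, zVar_re, zVar_im]
    have := rho_pos hN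
    field_simp
  rw [e]
  have hρ := rho_pos hN
  have h1 : (k : ℝ) ^ 2 * rho N ^ 2 ≤ rho N := by
    have : (k : ℝ) ^ 2 * rho N ≤ 1 := by
      unfold rho
      rw [mul_one_div, div_le_one (by positivity)]
      exact pow_le_pow_left₀ hkr.le hkNr 2
    calc (k : ℝ) ^ 2 * rho N ^ 2 = (k ^ 2 * rho N) * rho N := by ring
      _ ≤ 1 * rho N := by gcongr
      _ = rho N := one_mul _
  have h2 : (k : ℝ) ^ 2 * φ ^ 2 ≤ rho N := by
    have h3 : φ ^ 2 ≤ (1 / (k * N : ℝ)) ^ 2 := by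
      rw [← sq_abs]
      exact pow_le_pow_left₀ (abs_nonneg _) hφ 2
    calc (k : ℝ) ^ 2 * φ ^ 2 ≤ k ^ 2 * (1 / (k * N : ℝ)) ^ 2 := by gcongr
      _ = rho N := by unfold rho; field_simp
  rw [div_le_div_iff₀ two_pos (by positivity)]
  linarith

/-- The integral over the Farey arc in terms of an inverse `x` of `-h`. -/
noncomputable def arcPsi (Ω D : ℝ) (n N k : ℕ) (Q : ℂ → ℂ) (x : ℤ) : ℂ :=
  ∫ φ in (-arcEnd N k (-x))..(arcEnd N k x),
    arcKernel Ω D n N k φ * Q (x / k + I / (k * zVar N k φ))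

theorem abs_le_of_mem_uIcc {a b c φ : ℝ} (ha : |a| ≤ c) (hb : |b| ≤ c) (h : φ ∈ Set.uIcc a b) :
    |φ| ≤ c := by
  rw [abs_le] at *
  rcases Set.mem_uIcc.1 h with h | h <;> constructor <;> linarith [h.1, h.2, ha.1, ha.2, hb.1, hb.2]

/-! ### Size and variation of the arc integral as a function of the inverse -/

section Psi

variable {Ω D : ℝ} {n N k : ℕ} {Q : ℂ → ℂ} {B : ℝ}

theorem continuousOn_arc (hk : 0 < k) (hkN : k ≤ N)
    (hQ : ContinuousOn Q {τ : ℂ | 1 / 4 < τ.im}) (x : ℤ) {a b : ℝ} (ha : |a| ≤ 1 / (k * N))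
    (hb : |b| ≤ 1 / (k * N)) :
    ContinuousOn (fun φ : ℝ => arcKernel Ω D n N k φ * Q (x / k + I / (k * zVar N k φ)))
      (Set.uIcc a b) := by
  have hN : 0 < N := hk.trans_le hkN
  refine (continuous_arcKernel hk hN).continuousOn.mul (hQ.comp (t := {τ : ℂ | 1 / 4 < τ.im}) ?_
    fun φ hφ => ?_)
  · refine Continuous.continuousOn (continuous_const.add (continuous_const.div
      (continuous_const.mul (continuous_zVar N k)) fun φ => ?_))
    exact mul_ne_zero (by exact_mod_cast hk.ne') (zVar_ne_zero hk hN φ)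
  · exact lt_of_lt_of_le (by norm_num) (half_le_im hk hkN x (abs_le_of_mem_uIcc ha hb hφ))

theorem norm_integral_arc_le (hk : 0 < k) (hkN : k ≤ N) (hD : D ≤ 0)
    (hQ : ∀ τ : ℂ, 1 / 4 < τ.im → ‖Q τ‖ ≤ B) (x : ℤ) {a b : ℝ} (ha : |a| ≤ 1 / (k * N))
    (hb : |b| ≤ 1 / (k * N)) :
    ‖∫ φ in a..b, arcKernel Ω D n N k φ * Q (x / k + I / (k * zVar N k φ))‖ ≤
      Real.exp (2 * π / N ^ 2 * (n + Ω / 24)) * B * |b - a| := by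
  refine intervalIntegral.norm_integral_le_of_norm_le_const fun φ hφ => ?_
  rw [norm_mul]
  refine mul_le_mul (norm_arcKernel_le hk (hk.trans_le hkN) hD φ) (hQ _ ?_) (norm_nonneg _)
    (Real.exp_pos _).le
  exact lt_of_lt_of_le (by norm_num)
    (half_le_im hk hkN x (abs_le_of_mem_uIcc ha hb (Set.uIoc_subset_uIcc hφ)))

theorem abs_arcEnd_le (hk : 0 < k) (hkN : k ≤ N) (x : ℤ) : |arcEnd N k x| ≤ 1 / (k * N) := by
  rw [abs_of_nonneg (arcEnd_bounds hk hkN x).1]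
  exact (arcEnd_bounds hk hkN x).2

theorem norm_arcPsi_le (hk : 0 < k) (hkN : k ≤ N) (hD : D ≤ 0) (hB : 0 ≤ B)
    (hQ : ∀ τ : ℂ, 1 / 4 < τ.im → ‖Q τ‖ ≤ B) (x : ℤ) :
    ‖arcPsi Ω D n N k Q x‖ ≤ Real.exp (2 * π / N ^ 2 * (n + Ω / 24)) * B * (2 / (k * N)) := by
  refine (norm_integral_arc_le hk hkN hD hQ x (by rw [abs_neg]; exact abs_arcEnd_le hk hkN _)
    (abs_arcEnd_le hk hkN _)).trans ?_
  gcongr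
  rw [sub_neg_eq_add]
  refine (abs_add_le _ _).trans ?_
  have h1 := abs_arcEnd_le hk hkN x
  have h2 := abs_arcEnd_le hk hkN (-x)
  calc _ ≤ 1 / ((k : ℝ) * N) + 1 / (k * N) := add_le_add h1 h2
    _ = _ := by ring

/-- Two terms account for the motion of the ends; on the common arc the argument of Q moves by 1/k
and the Lipschitz bound applies. -/
theorem norm_arcPsi_succ_sub_le (hk : 0 < k) (hkN : k ≤ N) (hD : D ≤ 0) (hB : 0 ≤ B)
    (hQc : ContinuousOn Q {τ : ℂ | 1 / 4 < τ.im}) (hQ : ∀ τ : ℂ, 1 / 4 < τ.im → ‖Q τ‖ ≤ B)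
    (hQl : ∀ τ₁ τ₂ : ℂ, 1 / 2 ≤ τ₁.im → 1 / 2 ≤ τ₂.im → ‖Q τ₁ - Q τ₂‖ ≤ B * ‖τ₁ - τ₂‖) (x : ℤ) :
    ‖arcPsi Ω D n N k Q (x + 1) - arcPsi Ω D n N k Q x‖ ≤
      Real.exp (2 * π / N ^ 2 * (n + Ω / 24)) * B * (|arcEnd N k (x + 1) - arcEnd N k x| +
        |arcEnd N k (-(x + 1)) - arcEnd N k (-x)| + 2 / (k * N) * (1 / k)) := by
  set G := Real.exp (2 * π / N ^ 2 * (n + Ω / 24)) with hG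
  have hG0 : 0 < G := Real.exp_pos _
  have hN : 0 < N := hk.trans_le hkN
  have hR := fun y : ℤ => abs_arcEnd_le hk hkN y
  have hL : ∀ y : ℤ, |-arcEnd N k y| ≤ 1 / (k * N) := fun y => by rw [abs_neg]; exact hR y
  set F : ℤ → ℝ → ℂ := fun y φ => arcKernel Ω D n N k φ * Q (y / k + I / (k * zVar N k φ)) with hF
  have hint : ∀ (y : ℤ) (a b : ℝ), |a| ≤ 1 / (k * N) → |b| ≤ 1 / (k * N) →
      IntervalIntegrable (F y) MeasureTheory.volume a b := fun y a b ha hb =>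
    (continuousOn_arc hk hkN hQc y ha hb).intervalIntegrable
  have e : arcPsi Ω D n N k Q (x + 1) - arcPsi Ω D n N k Q x =
      ((∫ φ in (-arcEnd N k (-(x + 1)))..(-arcEnd N k (-x)), F (x + 1) φ) +
        ∫ φ in (arcEnd N k x)..(arcEnd N k (x + 1)), F (x + 1) φ) +
        ∫ φ in (-arcEnd N k (-x))..(arcEnd N k x), (F (x + 1) φ - F x φ) := by
    rw [intervalIntegral.integral_sub (hint _ _ _ (hL _) (hR _)) (hint _ _ _ (hL _) (hR _))]
    have h1 := intervalIntegral.integral_add_adjacent_intervals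
      (hint (x + 1) (-arcEnd N k (-(x + 1))) (-arcEnd N k (-x)) (hL _) (hL _))
      (hint (x + 1) (-arcEnd N k (-x)) (arcEnd N k x) (hL _) (hR _))
    have h2 := intervalIntegral.integral_add_adjacent_intervals
      (hint (x + 1) (-arcEnd N k (-(x + 1))) (arcEnd N k x) (hL _) (hR _))
      (hint (x + 1) (arcEnd N k x) (arcEnd N k (x + 1)) (hR _) (hR _))
    have h3 : arcPsi Ω D n N k Q (x + 1) =
        ∫ φ in (-arcEnd N k (-(x + 1)))..(arcEnd N k (x + 1)), F (x + 1) φ := rfl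
    have h4 : arcPsi Ω D n N k Q x = ∫ φ in (-arcEnd N k (-x))..(arcEnd N k x), F x φ := rfl
    rw [h3, h4, ← h2, ← h1]
    ring
  rw [e]
  have b1 := norm_integral_arc_le (Ω := Ω) (n := n) hk hkN hD hQ (x + 1) (hL (-(x + 1))) (hL (-x))
  have b2 := norm_integral_arc_le (Ω := Ω) (n := n) hk hkN hD hQ (x + 1) (hR x) (hR (x + 1))
  have hkr : (0 : ℝ) < k := by exact_mod_cast hk
  have b3 : ‖∫ φ in (-arcEnd N k (-x))..(arcEnd N k x), (F (x + 1) φ - F x φ)‖ ≤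
      G * (B * (1 / k)) * |arcEnd N k x - -arcEnd N k (-x)| := by
    refine intervalIntegral.norm_integral_le_of_norm_le_const fun φ hφ => ?_
    have hφ' := abs_le_of_mem_uIcc (hL _) (hR _) (Set.uIoc_subset_uIcc hφ)
    rw [hF]
    dsimp only
    rw [← mul_sub, norm_mul]
    refine mul_le_mul (norm_arcKernel_le hk hN hD φ) ?_ (norm_nonneg _) hG0.le
    refine (hQl _ _ (half_le_im hk hkN _ hφ') (half_le_im hk hkN _ hφ')).trans (le_of_eq ?_)
    congr 1
    have e2 : ((x + 1 : ℤ) : ℂ) / k + I / (k * zVar N k φ) - (x / k + I / (k * zVar N k φ)) =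
        ((1 / k : ℝ) : ℂ) := by
      push_cast
      ring
    rw [e2, Complex.norm_real, Real.norm_of_nonneg (by positivity)]
  have b4 : |arcEnd N k x - -arcEnd N k (-x)| ≤ 2 / (k * N) := by
    rw [sub_neg_eq_add]
    refine (abs_add_le _ _).trans ((add_le_add (hR x) (hR (-x))).trans (le_of_eq ?_))
    ring
  have b5 : |(-arcEnd N k (-x)) - (-arcEnd N k (-(x + 1)))| =
      |arcEnd N k (-(x + 1)) - arcEnd N k (-x)| := by
    congr 1
    ring
  rw [b5] at b1
  calc _ ≤ _ := norm_add_le _ _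
    _ ≤ _ := add_le_add (norm_add_le _ _) le_rfl
    _ ≤ G * B * |arcEnd N k (-(x + 1)) - arcEnd N k (-x)| +
        G * B * |arcEnd N k (x + 1) - arcEnd N k x| + G * (B * (1 / k)) * (2 / (k * N)) :=
      add_le_add (add_le_add b1 b2) (b3.trans (by gcongr))
    _ = _ := by ring

theorem arcPsi_congr {x y : ℤ} (hk : 0 < k) (h : x ≡ y [ZMOD k])
    (hQ : ∀ τ, Q (τ + ((y - x) / k : ℤ)) = Q τ) :
    arcPsi Ω D n N k Q y = arcPsi Ω D n N k Q x := by
  unfold arcPsi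
  rw [arcEnd_congr h.symm, arcEnd_congr h.symm.neg]
  congr 1
  funext φ
  rw [← hQ (x / k + I / (k * zVar N k φ))]
  congr 2
  obtain ⟨q, hq⟩ := h.dvd
  have hkz : (k : ℤ) ≠ 0 := by exact_mod_cast hk.ne'
  have hkc : (k : ℂ) ≠ 0 := by exact_mod_cast hk.ne'
  rw [hq, Int.mul_ediv_cancel_left _ hkz]
  have hy : (y : ℂ) = x + k * q := by
    have : y = x + k * q := by linarith
    rw [this]
    push_cast
    ring
  rw [hy, add_div, mul_div_cancel_left₀ _ hkc]
  ring

end Psi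


/-! ### The bounds for all orders -/

/-- The contribution of the arc at `h / k`. -/
noncomputable def arcTerm {J : ℕ} (m r : Fin J → ℕ) (δ : Fin J → ℤ) (D : ℝ) (n N h k : ℕ) : ℂ :=
  cexp (-2 * π * I * (n : ℂ) * (h : ℂ) / (k : ℂ)) * multiplier m r δ h k *
    arcIntegral m r δ D n N h k

theorem S_eq_sum_arcTerm {J : ℕ} (m r : Fin J → ℕ) (δ : Fin J → ℤ) (ϰ ℓ n N : ℕ) :
    S m r δ ϰ ℓ n N = ∑ k ∈ (Finset.Icc 1 N).filter (fun k => k ≡ ℓ [MOD modulus m]),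
      ∑ h ∈ (Finset.range k).filter (fun h => Nat.gcd h k = 1 ∧ h ≡ ϰ [MOD ℓ]),
        arcTerm m r δ (Delta m r δ ϰ ℓ) n N h k := by
  simp only [S, arcTerm, multiplier, mul_assoc]

/-- The contribution of an arc in terms of a lift `h` of its residue and an inverse `x`
of `-h`. -/
theorem arcTerm_mod_eq {J : ℕ} {m r : Fin J → ℕ} {δ : Fin J → ℤ} (hm : ∀ j, 0 < m j) {D : ℝ}
    {n N k M h : ℕ} {x : ℤ} {Q : ℕ → ℂ → ℂ} (hk : 0 < k) (hkN : k ≤ N)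
    (hx : h * x ≡ -1 [ZMOD (M * k : ℕ)])
    (hQ : ∀ z : ℂ, z ≠ 0 → zhProd m r δ h k ((h + I * z) / k) = Q (h % M) (x / k + I / (k * z))) :
    arcTerm m r δ D n N (h % k) k =
      ex (-(n : ℝ) * h / k) * multiplier m r δ h k *
        arcPsi (Omega m r δ) D n N k (Q (h % M)) x := by
  have hN : 0 < N := hk.trans_le hkN
  have hhk : Nat.gcd h k = 1 := Nat.isCoprime_iff_coprime.1
    (isCoprime_of_mul_modEq_neg_one (hx.of_dvd ⟨M, by push_cast; ring⟩))
  have hkc : (k : ℂ) ≠ 0 := by exact_mod_cast hk.ne'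
  obtain ⟨h₀, hh₀⟩ : ∃ h₀, h₀ = h % k := ⟨_, rfl⟩
  have hh : h = h₀ + k * (h / k) := by rw [hh₀, Nat.mod_add_div]
  have hh₀k : Nat.gcd h₀ k = 1 := by rw [hh₀, ← Nat.gcd_rec, Nat.gcd_comm, hhk]
  have hx₀ : h₀ * x ≡ -1 [ZMOD k] := by
    refine Int.ModEq.trans ?_ (hx.of_dvd ⟨M, by push_cast; ring⟩)
    refine Int.ModEq.mul_right _ (Int.natCast_modEq_iff.2 ?_)
    rw [hh₀]
    exact Nat.mod_modEq h k
  have hmult := multiplier_add_mul m r δ h₀ k (h / k) hm hk hh₀k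
  rw [← hh] at hmult
  have hexp : cexp (-2 * π * I * (n : ℂ) * (h₀ : ℂ) / (k : ℂ)) = ex (-(n : ℝ) * h / k) := by
    have e1 : cexp (-2 * π * I * (n : ℂ) * (h₀ : ℂ) / (k : ℂ)) = ex (-(n : ℝ) * h₀ / k) := by
      rw [ex]
      congr 1
      push_cast
      ring
    rw [e1]
    generalize h / k = q at hh
    refine ex_eq_ex (n * q) ?_
    have hkr : (k : ℝ) ≠ 0 := by exact_mod_cast hk.ne'
    have : (h : ℝ) = h₀ + k * q := by exact_mod_cast hh
    rw [this]
    push_cast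
    field_simp
    ring
  have hint : arcIntegral m r δ D n N h₀ k = arcPsi (Omega m r δ) D n N k (Q (h % M)) x := by
    rw [arcIntegral, arcPsi, thetaLeft_eq hk hkN hx₀, thetaRight_eq hk hkN hx₀]
    congr 1
    funext φ
    have hz := zVar_ne_zero hk hN φ
    have h1 := zhProd_add_mul m r δ (h / k) hm hk hh₀k hz
    rw [← hh, hQ _ hz] at h1
    rw [tauVar, ← h1, arcKernel]
    ring
  rw [← hh₀, arcTerm, ← hmult, hexp, hint]

theorem exists_lift {M k h : ℕ} (hM : 0 < M) (hk : 0 < k) (hhk : Nat.gcd h k = 1) (hlt : h < k) :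
    ∃ (g : ℕ) (x : ℤ), g * x ≡ -1 [ZMOD (M * k : ℕ)] ∧ g % k = h := by
  have : NeZero k := ⟨hk.ne'⟩
  have : NeZero (M * k) := ⟨(Nat.mul_pos hM hk).ne'⟩
  have hd : k ∣ M * k := Dvd.intro_left M rfl
  obtain ⟨u, hu⟩ := ZMod.unitsMap_surjective hd (ZMod.unitOfCoprime h hhk)
  refine ⟨(u : ZMod (M * k)).val, -(((u⁻¹ : (ZMod (M * k))ˣ) : ZMod (M * k)).val : ℤ), ?_, ?_⟩
  · rw [← ZMod.intCast_eq_intCast_iff]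
    simp
  · have h1 : (((u : ZMod (M * k)).val : ℕ) : ZMod k) = (h : ZMod k) := by
      have h2 := congrArg Units.val hu
      rw [ZMod.unitsMap_val, ZMod.coe_unitOfCoprime] at h2
      rw [← h2, ZMod.natCast_val]
    have h3 := (ZMod.natCast_eq_natCast_iff' _ _ _).1 h1
    rw [h3, Nat.mod_eq_of_lt hlt]

theorem modulus_pos {J : ℕ} {m : Fin J → ℕ} (hm : ∀ j, 0 < m j) : 0 < modulus m := by
  refine Nat.pos_of_ne_zero fun h => ?_
  rw [modulus, Finset.lcm_eq_zero_iff] at h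
  obtain ⟨j, -, hj⟩ := h
  exact (hm j).ne' hj

theorem dvd_modulus {J : ℕ} (m : Fin J → ℕ) (j : Fin J) : m j ∣ modulus m :=
  Finset.dvd_lcm (Finset.mem_univ j)

theorem exists_norm_arcTerm_le {J : ℕ} (m r : Fin J → ℕ) (δ : Fin J → ℤ)
    (hr : ∀ j, 1 ≤ r j ∧ r j < m j) :
    ∃ B : ℝ, 0 < B ∧ ∀ (D : ℝ) (n N h k : ℕ), D ≤ 0 → 0 < k → k ≤ N → h < k → Nat.gcd h k = 1 →
      ‖arcTerm m r δ D n N h k‖ ≤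
        Real.exp (2 * π / N ^ 2 * (n + Omega m r δ / 24)) * B * (2 / (k * N)) := by
  have hm : ∀ j, 0 < m j := fun j => by have := hr j; omega
  obtain ⟨B, hB, H⟩ := exists_zhProd_eq m r δ hr
  refine ⟨B, hB, fun D n N h k hD hk hkN hlt hhk => ?_⟩
  obtain ⟨Q, hQ, hQe⟩ := H k (modulus m) hk (dvd_modulus m)
  obtain ⟨g, x, hx, hg⟩ := exists_lift (modulus_pos hm) hk hhk hlt
  have e := arcTerm_mod_eq (δ := δ) (r := r) (D := D) (n := n) hm hk hkN hx
    (fun z hz => hQe g x z hx hz)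
  rw [← hg, e, norm_mul, norm_mul, norm_ex, norm_multiplier, one_mul, one_mul]
  exact norm_arcPsi_le hk hkN hD hB.le (hQ _).2.1 x

/-- Each arc is O(G/(kN)), where G is the exponential, and there are at most k numerators for each
of at most N denominators. -/
theorem exists_norm_S_le {J : ℕ} (m r : Fin J → ℕ) (δ : Fin J → ℤ)
    (hr : ∀ j, 1 ≤ r j ∧ r j < m j) :
    ∃ B : ℝ, 0 < B ∧ ∀ ϰ ℓ n N : ℕ, Delta m r δ ϰ ℓ ≤ 0 → 1 ≤ N →
      ‖S m r δ ϰ ℓ n N‖ ≤ B * Real.exp (2 * π / (N : ℝ) ^ 2 * (n + Omega m r δ / 24)) := by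
  obtain ⟨B, hB, H⟩ := exists_norm_arcTerm_le m r δ hr
  refine ⟨2 * B, by positivity, fun ϰ ℓ n N hD hN => ?_⟩
  set G := Real.exp (2 * π / (N : ℝ) ^ 2 * (n + Omega m r δ / 24)) with hG
  have hG0 : 0 < G := Real.exp_pos _
  have hNr : (0 : ℝ) < N := by exact_mod_cast hN
  rw [S_eq_sum_arcTerm]
  calc _ ≤ ∑ k ∈ (Finset.Icc 1 N).filter (fun k => k ≡ ℓ [MOD modulus m]), G * B * (2 / N) := by
        refine norm_sum_le_of_le _ fun k hk => ?_
        rw [Finset.mem_filter, Finset.mem_Icc] at hk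
        have hk0 : 0 < k := hk.1.1
        have hkr : (0 : ℝ) < k := by exact_mod_cast hk0
        calc _ ≤ ∑ h ∈ (Finset.range k).filter (fun h => Nat.gcd h k = 1 ∧ h ≡ ϰ [MOD ℓ]),
              G * B * (2 / (k * N)) := by
              refine norm_sum_le_of_le _ fun h hh => ?_
              rw [Finset.mem_filter, Finset.mem_range] at hh
              exact H _ n N h k hD hk0 hk.1.2 hh.1 hh.2.1
          _ ≤ ∑ h ∈ Finset.range k, G * B * (2 / (k * N)) :=
              Finset.sum_le_sum_of_subset_of_nonneg (Finset.filter_subset _ _)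
                fun _ _ _ => by positivity
          _ = G * B * (2 / N) := by
              rw [Finset.sum_const, Finset.card_range, nsmul_eq_mul]
              field_simp
    _ ≤ ∑ k ∈ Finset.Icc 1 N, G * B * (2 / N) :=
        Finset.sum_le_sum_of_subset_of_nonneg (Finset.filter_subset _ _)
          fun _ _ _ => by positivity
    _ = 2 * B * G := by
        rw [Finset.sum_const, Nat.card_Icc, nsmul_eq_mul, Nat.add_sub_cancel]
        field_simp

theorem exp_div_floor_sqrt_sq_le {X : ℝ} (hX : 0 < X) (h : 1 ≤ ⌊√X⌋₊) :
    Real.exp (X / (⌊√X⌋₊ : ℝ) ^ 2) ≤ Real.exp 4 := by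
  have h1 : (1 : ℝ) ≤ ⌊√X⌋₊ := by exact_mod_cast h
  have h2 := Nat.lt_floor_add_one (√X)
  have h3 : X = √X ^ 2 := (Real.sq_sqrt hX.le).symm
  have h4 : √X ^ 2 ≤ (2 * (⌊√X⌋₊ : ℝ)) ^ 2 :=
    pow_le_pow_left₀ (Real.sqrt_nonneg X) (by linarith) 2
  rw [Real.exp_le_exp, div_le_iff₀ (by positivity)]
  linarith


/-! ### Integrality of the exponents -/

/-- Since m ∣ L, gcd(m, k) = gcd(m, ℓ), and this divides gcd(ℓ, k). So ℓ/gcd(ℓ, k) divides ℓ/gcd(m,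
ℓ), which is prime to m/gcd(m, ℓ). -/
theorem coprime_div_gcd_of_modEq {m k ℓ L : ℕ} (hmL : m ∣ L) (hm : 0 < m)
    (h : k ≡ ℓ [MOD L]) :
    Nat.Coprime (m / Nat.gcd m k) (ℓ / Nat.gcd ℓ k) := by
  have hg : Nat.gcd m k = Nat.gcd m ℓ := by
    rw [Nat.gcd_comm m k, Nat.gcd_comm m ℓ]
    exact (h.of_dvd hmL).gcd_eq
  have hd : Nat.gcd m k ∣ Nat.gcd ℓ k :=
    Nat.dvd_gcd (by rw [hg]; exact Nat.gcd_dvd_right _ _) (Nat.gcd_dvd_right _ _)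
  have hco : Nat.Coprime (m / Nat.gcd m k) (ℓ / Nat.gcd m k) := by
    rw [hg]
    exact Nat.coprime_div_gcd_div_gcd (Nat.gcd_pos_of_pos_left _ hm)
  refine hco.coprime_dvd_right ?_
  exact Nat.div_dvd_div_left (Nat.gcd_dvd_left ℓ k) hd

/-- Only primes 2 and 3 matter. If such a prime divides t, then X is prime to it and the
divisibility is automatic; if not, u may contain the prime (4 or 3) and still be prime to t. -/
theorem exists_coprime_multiplier (t : ℕ) : ∃ u : ℕ, Nat.Coprime u t ∧ ∀ X : ℤ,
    (2 ∣ t → IsCoprime X 2) → (3 ∣ t → IsCoprime X 3) →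
      (12 : ℤ) ∣ u * (1 - X ^ 2) ∧ (2 : ℤ) ∣ u * (1 + X) := by
  have h2 : ∃ u : ℕ, Nat.Coprime u t ∧ ∀ X : ℤ, (2 ∣ t → IsCoprime X 2) →
      (4 : ℤ) ∣ u * (1 - X ^ 2) ∧ (2 : ℤ) ∣ u * (1 + X) := by
    by_cases ht : 2 ∣ t
    · refine ⟨1, Nat.coprime_one_left t, fun X hX => ?_⟩
      obtain ⟨a, b, h⟩ := hX ht
      obtain ⟨c, rfl⟩ : ∃ c, X = 2 * c + 1 := by
        rcases Int.even_or_odd' X with ⟨c, hc | hc⟩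
        · exfalso
          have : (2 : ℤ) ∣ 1 := ⟨a * c + b, by rw [← h, hc]; ring⟩
          norm_num at this
        · exact ⟨c, hc⟩
      exact ⟨⟨-(c ^ 2 + c), by push_cast; ring⟩, ⟨c + 1, by push_cast; ring⟩⟩
    · refine ⟨4, ?_, fun X _ => ⟨⟨1 - X ^ 2, by push_cast; ring⟩, ⟨2 * (1 + X), by push_cast; ring⟩⟩⟩
      have : Nat.Coprime 2 t := (Nat.Prime.coprime_iff_not_dvd Nat.prime_two).2 ht
      simpa using this.pow_left 2
  have h3 : ∃ u : ℕ, Nat.Coprime u t ∧ ∀ X : ℤ, (3 ∣ t → IsCoprime X 3) →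
      (3 : ℤ) ∣ u * (1 - X ^ 2) := by
    by_cases ht : 3 ∣ t
    · refine ⟨1, Nat.coprime_one_left t, fun X hX => ?_⟩
      obtain ⟨a, b, h⟩ := hX ht
      have h0 : X % 3 = 0 ∨ X % 3 = 1 ∨ X % 3 = 2 := by omega
      rcases h0 with h0 | h0 | h0
      · obtain ⟨c, rfl⟩ := Int.dvd_of_emod_eq_zero h0
        exfalso
        have : (3 : ℤ) ∣ 1 := ⟨a * c + b, by linarith⟩
        norm_num at this
      · obtain ⟨c, hc⟩ : ∃ c, X = 3 * c + 1 := ⟨X / 3, by omega⟩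
        exact ⟨-(3 * c ^ 2 + 2 * c), by rw [hc]; push_cast; ring⟩
      · obtain ⟨c, hc⟩ : ∃ c, X = 3 * c + 2 := ⟨X / 3, by omega⟩
        exact ⟨-(3 * c ^ 2 + 4 * c + 1), by rw [hc]; push_cast; ring⟩
    · exact ⟨3, (Nat.Prime.coprime_iff_not_dvd Nat.prime_three).2 ht,
        fun X _ => ⟨1 - X ^ 2, by push_cast; ring⟩⟩
  obtain ⟨u₂, hu₂, H₂⟩ := h2
  obtain ⟨u₃, hu₃, H₃⟩ := h3
  refine ⟨u₂ * u₃, hu₂.mul_left hu₃, fun X hX2 hX3 => ⟨?_, ?_⟩⟩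
  · have e : ((u₂ * u₃ : ℕ) : ℤ) * (1 - X ^ 2) = u₃ * (u₂ * (1 - X ^ 2)) := by push_cast; ring
    have e3 := (H₃ X hX3).mul_left (u₂ : ℤ)
    rw [mul_left_comm] at e3
    rw [e]
    exact IsCoprime.mul_dvd (x := 4) (y := 3) ⟨1, -1, by norm_num⟩ ((H₂ X hX2).1.mul_left _) e3
  · have e : ((u₂ * u₃ : ℕ) : ℤ) * (1 + X) = u₃ * (u₂ * (1 + X)) := by push_cast; ring
    rw [e]
    exact ((H₂ X hX2).2).mul_left _

/-- The difference of the exponents of one factor has a denominator coprime to `t`. -/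
theorem exists_int_exponent_sub {m r k u h W : ℕ} (hm : 0 < m) (hk : 0 < k)
    (hW : m / Nat.gcd m k ∣ W) (h12 : (12 : ℤ) ∣ u * (1 - ((h * (m / Nat.gcd m k) : ℕ) : ℤ) ^ 2))
    (h2 : (2 : ℤ) ∣ u * (1 + ((h * (m / Nat.gcd m k) : ℕ) : ℤ))) :
    ∃ z : ℤ, (u * W : ℝ) * ((Nat.gcd m k : ℝ) ^ 2 / (12 * m) +
      ((sig m r h k : ℝ) ^ 2 - Nat.gcd m k * sig m r h k) / (2 * m) -
      (h : ℝ) ^ 2 * ((m : ℝ) / 12 - r / 2 + r ^ 2 / (2 * m))) = z := by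
  have hd0 : 0 < Nat.gcd m k := Nat.gcd_pos_of_pos_right m hk
  have hdm := Nat.div_mul_cancel (Nat.gcd_dvd_left m k)
  have hm'0 : 0 < m / Nat.gcd m k := Nat.div_pos (Nat.gcd_le_left _ hm) hd0
  have hsig : (sig m r h k : ℝ) = Nat.gcd m k * lam m r h k - r * h := by
    unfold sig; push_cast; ring
  rw [hsig]
  generalize lam m r h k = l
  set d := Nat.gcd m k with hd
  clear_value d
  set m' := m / d with hm'
  clear_value m'
  obtain ⟨w, rfl⟩ := hW
  obtain ⟨a, ha⟩ := h12
  obtain ⟨b, hb⟩ := h2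
  obtain ⟨p, hp⟩ : (2 : ℤ) ∣ l * (l - 1) := (Int.even_mul_pred_self l).two_dvd
  -- After inserting σ = dλ - rh the terms in r² cancel. What remains, times m', consists of d(1 -
  -- (hm')²)/12, dλ(λ - 1)/2, -rhλ and rh(1 + hm')/2; u makes each of these integral.
  refine ⟨w * (d * a + u * d * p - u * r * h * l + r * h * b), ?_⟩
  have har : (u : ℝ) * (1 - ((h : ℝ) * m') ^ 2) = 12 * a := by exact_mod_cast ha
  have hbr : (u : ℝ) * (1 + (h : ℝ) * m') = 2 * b := by exact_mod_cast hb
  have hpr : (l : ℝ) * (l - 1) = 2 * p := by exact_mod_cast hp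
  have hmr : (m : ℝ) = m' * d := by exact_mod_cast hdm.symm
  have hdr : (d : ℝ) ≠ 0 := by positivity
  have hm'r : (m' : ℝ) ≠ 0 := by positivity
  have ea : (a : ℝ) = (u : ℝ) * (1 - ((h : ℝ) * m') ^ 2) / 12 := by linarith
  have eb : (b : ℝ) = (u : ℝ) * (1 + (h : ℝ) * m') / 2 := by linarith
  have ep : (p : ℝ) = (l : ℝ) * (l - 1) / 2 := by linarith
  rw [hmr]
  push_cast
  rw [ea, eb, ep]
  field_simp
  ring

/-- If a multiple of `Ω / 24` by `t` and a suitable multiple of `Δ / 24` are integers, then so is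
`Ω / 24`. -/
theorem exists_int_Omega {J : ℕ} {m r : Fin J → ℕ} {δ : Fin J → ℤ} (hm : ∀ j, 0 < m j)
    {k t h : ℕ} (hk : 0 < k) (ht : ∀ j, Nat.Coprime (m j / Nat.gcd (m j) k) t)
    (hh6 : Nat.Coprime h 6) (hht : Nat.Coprime h t) {z z' : ℤ}
    (hE : ((∏ j, m j / Nat.gcd (m j) k : ℕ) : ℝ) * (-(Delta m r δ h k) / 24) = z)
    (hΩ : (t : ℝ) * (Omega m r δ / 24) = z') : ∃ y : ℤ, Omega m r δ / 24 = y := by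
  obtain ⟨u, hut, hu⟩ := exists_coprime_multiplier t
  set W := ∏ j, m j / Nat.gcd (m j) k with hW
  have hWt : Nat.Coprime W t := Nat.Coprime.prod_left fun j _ => ht j
  have key : ∀ j, ∃ z : ℤ, (u * W : ℝ) * ((Nat.gcd (m j) k : ℝ) ^ 2 / (12 * m j) +
      ((sig (m j) (r j) h k : ℝ) ^ 2 - Nat.gcd (m j) k * sig (m j) (r j) h k) / (2 * m j) -
      (h : ℝ) ^ 2 * ((m j : ℝ) / 12 - r j / 2 + r j ^ 2 / (2 * m j))) = z := by
    intro j
    have hp : ∀ p : ℕ, p ∣ 6 → p ∣ t →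
        IsCoprime ((h * (m j / Nat.gcd (m j) k) : ℕ) : ℤ) (p : ℤ) := fun p hp6 hpt =>
      Nat.isCoprime_iff_coprime.2
        ((hh6.coprime_dvd_right hp6).mul_left ((ht j).coprime_dvd_right hpt))
    obtain ⟨h12, h2⟩ := hu _ (hp 2 (by norm_num)) (hp 3 (by norm_num))
    exact exists_int_exponent_sub (hm j) hk (Finset.dvd_prod_of_mem _ (Finset.mem_univ j))
      h12 h2
  choose y hy using key
  have hdiff : (u * W : ℝ) * (-(Delta m r δ h k) / 24 - (h : ℝ) ^ 2 * (Omega m r δ / 24)) =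
      ((∑ j, δ j * y j : ℤ) : ℝ) := by
    rw [Delta_eq_sum_sig m r δ hk, Omega_div_eq_sum m r δ hm, Finset.mul_sum,
      ← Finset.sum_sub_distrib, Finset.mul_sum]
    push_cast
    refine Finset.sum_congr rfl fun j _ => ?_
    rw [← hy j]
    ring
  -- The factor uWh² is prime to t, so Bézout combines this integrality with that of t·Ω/24.
  have hQ : ((u * W * h ^ 2 : ℕ) : ℝ) * (Omega m r δ / 24) = ((u * z - ∑ j, δ j * y j : ℤ) : ℝ) := by
    push_cast at hdiff ⊢
    linear_combination (u : ℝ) * hE - hdiff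
  have hco : IsCoprime ((u * W * h ^ 2 : ℕ) : ℤ) t :=
    Nat.isCoprime_iff_coprime.2 ((hut.mul_left hWt).mul_left (hht.pow_left 2))
  obtain ⟨a, b, hab⟩ := hco
  have habr : (a : ℝ) * ((u * W * h ^ 2 : ℕ) : ℝ) + b * t = 1 := by exact_mod_cast hab
  refine ⟨a * (u * z - ∑ j, δ j * y j) + b * z', ?_⟩
  have : ((a * (u * z - ∑ j, δ j * y j) + b * z' : ℤ) : ℝ) =
      a * ((u * z - ∑ j, δ j * y j : ℤ) : ℝ) + b * z' := by push_cast; ring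
  rw [this, ← hQ, ← hΩ]
  linear_combination (-(Omega m r δ / 24)) * habr

theorem exists_int_mul_Delta {J : ℕ} (m r : Fin J → ℕ) (δ : Fin J → ℤ) (hm : ∀ j, 0 < m j)
    {h k M : ℕ} (hk : 0 < k) (hmM : ∀ j, 24 * m j ∣ M) :
    ∃ z : ℤ, (M : ℝ) * (-(Delta m r δ h k) / 24) = z := by
  have key : ∀ j, ∃ z : ℤ, (M : ℝ) * ((Nat.gcd (m j) k : ℝ) ^ 2 / (12 * m j) +
      ((sig (m j) (r j) h k : ℝ) ^ 2 - Nat.gcd (m j) k * sig (m j) (r j) h k) / (2 * m j)) = z := by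
    intro j
    obtain ⟨w, hw⟩ := hmM j
    refine ⟨w * (2 * (Nat.gcd (m j) k : ℤ) ^ 2 + 12 * (sig (m j) (r j) h k ^ 2 -
      Nat.gcd (m j) k * sig (m j) (r j) h k)), ?_⟩
    have : (m j : ℝ) ≠ 0 := by exact_mod_cast (hm j).ne'
    rw [hw]
    push_cast
    field_simp
    ring
  choose y hy using key
  refine ⟨∑ j, δ j * y j, ?_⟩
  rw [Delta_eq_sum_sig m r δ hk, Finset.mul_sum]
  push_cast
  refine Finset.sum_congr rfl fun j _ => ?_
  rw [← hy j]
  ring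

theorem exists_int_mul_Omega {J : ℕ} (m r : Fin J → ℕ) (δ : Fin J → ℤ) (hm : ∀ j, 0 < m j)
    {M : ℕ} (hmM : ∀ j, 24 * m j ∣ M) : ∃ z : ℤ, (M : ℝ) * (Omega m r δ / 24) = z := by
  have key : ∀ j, ∃ z : ℤ, (M : ℝ) * ((m j : ℝ) / 12 - r j / 2 + r j ^ 2 / (2 * m j)) = z := by
    intro j
    obtain ⟨w, hw⟩ := hmM j
    refine ⟨w * (2 * (m j : ℤ) ^ 2 - 12 * m j * r j + 12 * r j ^ 2), ?_⟩
    have : (m j : ℝ) ≠ 0 := by exact_mod_cast (hm j).ne'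
    rw [hw]
    push_cast
    field_simp
    ring
  choose y hy using key
  refine ⟨∑ j, δ j * y j, ?_⟩
  rw [Omega_div_eq_sum m r δ hm, Finset.mul_sum]
  push_cast
  refine Finset.sum_congr rfl fun j _ => ?_
  rw [← hy j]
  ring

theorem abs_Delta_div_le {J : ℕ} (m r : Fin J → ℕ) (δ : Fin J → ℤ) (hm : ∀ j, 0 < m j)
    {h k : ℕ} (hk : 0 < k) :
    |-(Delta m r δ h k) / 24| ≤ ∑ j, |(δ j : ℝ)| * m j := by
  rw [Delta_eq_sum_sig m r δ hk]
  refine (Finset.abs_sum_le_sum_abs _ _).trans (Finset.sum_le_sum fun j _ => ?_)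
  rw [abs_mul]
  refine mul_le_mul_of_nonneg_left ?_ (abs_nonneg _)
  have hs0 : (0 : ℝ) ≤ sig (m j) (r j) h k := by exact_mod_cast sig_nonneg (m j) (r j) h k hk
  have hs1 : (sig (m j) (r j) h k : ℝ) ≤ Nat.gcd (m j) k := by
    exact_mod_cast (sig_lt (m j) (r j) h k hk).le
  have hd : (Nat.gcd (m j) k : ℝ) ≤ m j := by exact_mod_cast Nat.gcd_le_left k (hm j)
  have hmr : (0 : ℝ) < m j := by exact_mod_cast hm j
  generalize (sig (m j) (r j) h k : ℝ) = σ at *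
  generalize (Nat.gcd (m j) k : ℝ) = d at *
  have e : d ^ 2 / (12 * m j) + (σ ^ 2 - d * σ) / (2 * m j) =
      (d ^ 2 + 6 * (σ ^ 2 - d * σ)) / (12 * m j) := by
    field_simp
    ring
  rw [e, abs_div, abs_of_pos (by positivity : (0 : ℝ) < 12 * m j), div_le_iff₀ (by positivity),
    abs_le]
  have h1 : d ^ 2 ≤ (m j : ℝ) ^ 2 := pow_le_pow_left₀ (hs0.trans hs1) hd 2
  have h2 : σ ^ 2 - d * σ ≤ 0 := by nlinarith
  have h3 : -d ^ 2 ≤ σ ^ 2 - d * σ := by nlinarith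
  constructor <;> nlinarith


/-! ### The two factors of the bilinear sum -/

theorem norm_ex_sub_ex_le (x y : ℝ) : ‖ex x - ex y‖ ≤ 2 * π * |x - y| := by
  have e : ex x - ex y = ex y * (cexp (I * ((2 * π * (x - y) : ℝ) : ℂ)) - 1) := by
    rw [mul_sub, mul_one, ex, ex, ← Complex.exp_add]
    congr 2
    push_cast
    ring
  rw [e, norm_mul, norm_ex, one_mul]
  refine (Real.norm_exp_I_mul_ofReal_sub_one_le).trans (le_of_eq ?_)
  rw [Real.norm_eq_abs, abs_mul, abs_of_pos Real.two_pi_pos]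

section Cyclic

variable {K : ℕ} [NeZero K]

theorem cyclicVariation_val {F : ℤ → ℂ} (hF : ∀ x y : ℤ, x ≡ y [ZMOD K] → F x = F y) :
    cyclicVariation (fun x : ZMod K => F x.val) =
      ∑ y ∈ Finset.range K, ‖F (y + 1) - F y‖ := by
  rw [cyclicVariation, ← sum_zmod_val (K := K) (fun y : ℕ => ‖F (y + 1) - F y‖)]
  refine Finset.sum_congr rfl fun x _ => ?_
  rw [hF ((x + 1).val : ℤ) (x.val + 1)]
  rw [← ZMod.intCast_eq_intCast_iff]
  simp

theorem cyclicVariation_comp_neg (f : ZMod K → ℂ) :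
    cyclicVariation (fun x => f (-x)) = cyclicVariation f := by
  unfold cyclicVariation
  rw [← Equiv.sum_comp (Equiv.subLeft (-1 : ZMod K)) fun x => ‖f (x + 1) - f x‖]
  refine Finset.sum_congr rfl fun x _ => ?_
  rw [norm_sub_rev, Equiv.subLeft_apply, show -1 - x + 1 = -x by ring,
    show -1 - x = -(x + 1) by ring]

theorem sum_eq_zero_of_shift {f : ZMod K → ℂ} {s : ZMod K} {c : ℂ} (hc : c ≠ 1)
    (h : ∀ x, f (x + s) = c * f x) : ∑ x, f x = 0 := by
  have h1 : ∑ x, f x = c * ∑ x, f x := by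
    rw [Finset.mul_sum, ← Equiv.sum_comp (Equiv.addRight s) f]
    exact Finset.sum_congr rfl fun x _ => h x
  have h2 : (c - 1) * ∑ x, f x = 0 := by linear_combination -h1
  exact (mul_eq_zero.1 h2).resolve_left (sub_ne_zero.2 hc)

end Cyclic

theorem sum_range_mul_eq {R : Type*} [AddCommMonoid R] (M k : ℕ) (F : ℕ → R) :
    ∑ y ∈ Finset.range (M * k), F y =
      ∑ i ∈ Finset.range M, ∑ y ∈ Finset.range k, F (i * k + y) := by
  induction M with
  | zero => simp
  | succ M ih => rw [add_mul, one_mul, Finset.sum_range_add, ih, Finset.sum_range_succ]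

theorem sum_range_ite_dvd {k : ℕ} (hk : 0 < k) (M : ℕ) (c : ℤ) (b : ℝ) :
    ∑ y ∈ Finset.range (M * k), (if (k : ℤ) ∣ c - y then b else 0) = M * b := by
  have : NeZero k := ⟨hk.ne'⟩
  have h1 : ∀ i : ℕ, ∑ y ∈ Finset.range k, (if (k : ℤ) ∣ c - ((i * k + y : ℕ) : ℤ) then b else 0) =
      b := by
    intro i
    rw [← sum_zmod_val (K := k) (fun y : ℕ => if (k : ℤ) ∣ c - ((i * k + y : ℕ) : ℤ) then b else 0)]
    have h2 : ∀ x : ZMod k, (k : ℤ) ∣ c - ((i * k + x.val : ℕ) : ℤ) ↔ (c : ZMod k) = x := by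
      intro x
      rw [← ZMod.intCast_zmod_eq_zero_iff_dvd, Int.cast_sub, sub_eq_zero]
      simp
    simp_rw [h2]
    simp
  rw [sum_range_mul_eq]
  simp_rw [h1]
  simp

/-- The factor of the contribution of an arc that depends on the numerator, in the residue class
of `w`. -/
noncomputable def numeratorFactor (α : ℝ) (w ϰ ℓ k : ℕ) (y : ℤ) : ℂ :=
  (if (w : ℤ) ≡ ϰ + k * (y / k) [ZMOD ℓ] then 1 else 0) * ex (-α * y / k)

section Numerator

variable {α : ℝ} {w ϰ ℓ k M : ℕ}

theorem norm_numeratorFactor_le (y : ℤ) : ‖numeratorFactor α w ϰ ℓ k y‖ ≤ 1 := by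
  rw [numeratorFactor, norm_mul, norm_ex, mul_one]
  split_ifs <;> simp

theorem numeratorFactor_add_mul (hk : 0 < k) {t : ℤ} (ht : (ℓ : ℤ) ∣ k * t) (y : ℤ) :
    numeratorFactor α w ϰ ℓ k (y + k * t) = ex (-α * t) * numeratorFactor α w ϰ ℓ k y := by
  have hkz : (k : ℤ) ≠ 0 := by exact_mod_cast hk.ne'
  have hkr : (k : ℝ) ≠ 0 := by exact_mod_cast hk.ne'
  have h1 : (w : ℤ) ≡ ϰ + k * ((y + k * t) / k) [ZMOD ℓ] ↔ (w : ℤ) ≡ ϰ + k * (y / k) [ZMOD ℓ] := by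
    rw [Int.add_mul_ediv_left _ _ hkz]
    have h2 : (ϰ + k * (y / k + t) : ℤ) ≡ ϰ + k * (y / k) [ZMOD ℓ] := by
      refine Int.ModEq.symm (Int.modEq_iff_dvd.2 ?_)
      have e : (ϰ + k * (y / k + t) - (ϰ + k * (y / k)) : ℤ) = k * t := by ring
      rwa [e]
    exact ⟨fun h => h.trans h2, fun h => h.trans h2.symm⟩
  have h3 : ex (-α * ((y + k * t : ℤ) : ℝ) / k) = ex (-α * t) * ex (-α * y / k) := by
    rw [← ex_add]
    congr 1
    push_cast
    field_simp
    ring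
  rw [numeratorFactor, numeratorFactor, h3]
  simp only [h1]
  ring

theorem numeratorFactor_congr (hk : 0 < k) (hℓ : ℓ ∣ M) {z : ℤ} (hz : (M : ℝ) * α = z) {x y : ℤ}
    (h : x ≡ y [ZMOD (M * k : ℕ)]) :
    numeratorFactor α w ϰ ℓ k x = numeratorFactor α w ϰ ℓ k y := by
  obtain ⟨q, hq⟩ := h.dvd
  have e : y = x + k * (M * q) := by
    push_cast at hq
    linear_combination hq
  have h1 : ex (-α * ((M * q : ℤ) : ℝ)) = 1 := by
    rw [ex_eq_one_iff]
    refine ⟨-(z * q), ?_⟩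
    push_cast
    rw [← hz]
    ring
  rw [e, numeratorFactor_add_mul hk, h1, one_mul]
  exact ((Int.natCast_dvd_natCast.2 hℓ).mul_right q).mul_left _

/-- The congruence condition sees y only through ⌊y/k⌋, so it can change only when k ∣ y + 1; the
phase moves by α/k. -/
theorem norm_numeratorFactor_succ_sub_le (hk : 0 < k) (y : ℤ) :
    ‖numeratorFactor α w ϰ ℓ k (y + 1) - numeratorFactor α w ϰ ℓ k y‖ ≤
      (if (k : ℤ) ∣ -1 - y then 1 else 0) + 2 * π * |α| / k := by
  have hkz : (0 : ℤ) < k := by exact_mod_cast hk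
  have hkr : (0 : ℝ) < k := by exact_mod_cast hk
  have hex : ‖ex (-α * ((y + 1 : ℤ) : ℝ) / k) - ex (-α * y / k)‖ ≤ 2 * π * |α| / k := by
    refine (norm_ex_sub_ex_le _ _).trans (le_of_eq ?_)
    have e : -α * ((y + 1 : ℤ) : ℝ) / k - -α * y / k = -(α / k) := by push_cast; ring
    rw [e, abs_neg, abs_div, abs_of_pos hkr]
    ring
  unfold numeratorFactor
  by_cases hd : (k : ℤ) ∣ -1 - y
  · rw [if_pos hd]
    have hχ : ∀ p q : Prop, [Decidable p] → [Decidable q] →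
        ‖(if p then (1 : ℂ) else 0) - if q then 1 else 0‖ ≤ 1 := by
      intro p q _ _
      split_ifs <;> simp
    have hχ' : ∀ p : Prop, [Decidable p] → ‖(if p then (1 : ℂ) else 0)‖ ≤ 1 := by
      intro p _
      split_ifs <;> simp
    have e : ∀ a b c d : ℂ, a * b - c * d = (a - c) * b + c * (b - d) := fun _ _ _ _ => by ring
    rw [e]
    refine (norm_add_le _ _).trans (add_le_add ?_ ?_)
    · rw [norm_mul, norm_ex, mul_one]
      exact hχ _ _
    · rw [norm_mul]
      calc _ ≤ 1 * ‖ex (-α * ((y + 1 : ℤ) : ℝ) / k) - ex (-α * y / k)‖ :=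
            mul_le_mul_of_nonneg_right (hχ' _) (norm_nonneg _)
        _ ≤ _ := by rwa [one_mul]
  · rw [if_neg hd]
    have hdiv : (y + 1) / (k : ℤ) = y / k := by
      have h1 := Int.emod_nonneg y hkz.ne'
      have h2 := Int.emod_lt_of_pos y hkz
      have h3 := Int.mul_ediv_add_emod y k
      have h4 : y % k + 1 ≠ k := fun h => hd ⟨-(y / k + 1), by linear_combination h3 - h⟩
      exact ((Int.ediv_emod_unique (r := y % k + 1) hkz).2 ⟨by linarith, by omega, by omega⟩).1
    rw [hdiv, ← mul_sub, norm_mul, zero_add]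
    calc _ ≤ 1 * ‖ex (-α * ((y + 1 : ℤ) : ℝ) / k) - ex (-α * y / k)‖ := by
          refine mul_le_mul_of_nonneg_right ?_ (norm_nonneg _)
          split_ifs <;> simp
      _ ≤ _ := by rwa [one_mul]

theorem sum_norm_numeratorFactor_succ_sub_le (hk : 0 < k) :
    ∑ y ∈ Finset.range (M * k),
      ‖numeratorFactor α w ϰ ℓ k (y + 1) - numeratorFactor α w ϰ ℓ k y‖ ≤
        M * (1 + 2 * π * |α|) := by
  have hkr : (0 : ℝ) < k := by exact_mod_cast hk
  refine (Finset.sum_le_sum fun (y : ℕ) _ => norm_numeratorFactor_succ_sub_le hk (y : ℤ)).trans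
    (le_of_eq ?_)
  rw [Finset.sum_add_distrib, sum_range_ite_dvd hk, Finset.sum_const, Finset.card_range,
    nsmul_eq_mul]
  push_cast
  field_simp

/-- On a block of k consecutive y the condition is constant, and the phases form a geometric
progression with ratio e(-α/k), a k-th root of unity different from 1. -/
theorem sum_numeratorFactor_eq_zero (hk : 0 < k) {a : ℤ} (ha : α = a) (hka : ¬ (k : ℤ) ∣ a) :
    ∑ y ∈ Finset.range (M * k), numeratorFactor α w ϰ ℓ k y = 0 := by
  have hkz : (k : ℤ) ≠ 0 := by exact_mod_cast hk.ne'
  have hkr : (k : ℝ) ≠ 0 := by exact_mod_cast hk.ne'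
  rw [sum_range_mul_eq]
  refine Finset.sum_eq_zero fun i _ => ?_
  have h1 : ∀ y ∈ Finset.range k, numeratorFactor α w ϰ ℓ k ((i * k + y : ℕ) : ℤ) =
      (if (w : ℤ) ≡ ϰ + k * i [ZMOD ℓ] then 1 else 0) * ex (-α / k) ^ y := by
    intro y hy
    have h2 : ((i * k + y : ℕ) : ℤ) / k = i := by
      have : (i * k + y) / k = i := by
        rw [add_comm, Nat.add_mul_div_right _ _ hk, Nat.div_eq_of_lt (Finset.mem_range.1 hy),
          zero_add]
      exact_mod_cast congrArg (Nat.cast : ℕ → ℤ) this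
    rw [numeratorFactor, h2, ← ex_nat_mul]
    congr 1
    refine ex_eq_ex (-(a * i)) ?_
    rw [ha]
    push_cast
    field_simp
    ring
  rw [Finset.sum_congr rfl h1, ← Finset.mul_sum]
  have h3 : ex (-α / k) ≠ 1 := by
    rw [Ne, ex_eq_one_iff]
    rintro ⟨q, hq⟩
    refine hka ⟨-q, ?_⟩
    rw [ha, div_eq_iff hkr] at hq
    have : (-a : ℤ) = q * k := by exact_mod_cast hq
    linear_combination -this
  rw [geom_sum_eq h3, ← ex_nat_mul]
  have h4 : ex (k * (-α / k)) = 1 := by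
    rw [ex_eq_one_iff]
    refine ⟨-a, ?_⟩
    rw [ha]
    push_cast
    field_simp
  rw [h4, sub_self, zero_div, mul_zero]

end Numerator

/-- The factor of the contribution of an arc that depends on an inverse `x` of minus the
numerator. -/
noncomputable def inverseFactor (e Ω D : ℝ) (n N k : ℕ) (Q : ℂ → ℂ) (x : ℤ) : ℂ :=
  ex (e * x / k) * arcPsi Ω D n N k Q x

section Inverse

variable {e Ω D : ℝ} {n N k : ℕ} {Q : ℂ → ℂ} {B : ℝ}

theorem inverseFactor_add_mul (hk : 0 < k) {T : ℤ} (hQ : ∀ τ, Q (τ + T) = Q τ) (x : ℤ) :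
    inverseFactor e Ω D n N k Q (x + k * T) = ex (e * T) * inverseFactor e Ω D n N k Q x := by
  have hkz : (k : ℤ) ≠ 0 := by exact_mod_cast hk.ne'
  have hkr : (k : ℝ) ≠ 0 := by exact_mod_cast hk.ne'
  have h1 : arcPsi Ω D n N k Q (x + k * T) = arcPsi Ω D n N k Q x := by
    refine arcPsi_congr hk (Int.modEq_iff_dvd.2 ⟨T, by ring⟩) fun τ => ?_
    rw [add_sub_cancel_left, Int.mul_ediv_cancel_left _ hkz, hQ]
  rw [inverseFactor, inverseFactor, h1, ← mul_assoc, ← ex_add]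
  congr 2
  push_cast
  field_simp
  ring

theorem inverseFactor_congr (hk : 0 < k) {M : ℕ} (hQ : ∀ (q : ℤ) (τ : ℂ), Q (τ + (M * q : ℤ)) = Q τ)
    {z : ℤ} (hz : (M : ℝ) * e = z) {x y : ℤ} (h : x ≡ y [ZMOD (M * k : ℕ)]) :
    inverseFactor e Ω D n N k Q x = inverseFactor e Ω D n N k Q y := by
  obtain ⟨q, hq⟩ := h.dvd
  have h0 : y = x + k * (M * q) := by
    push_cast at hq
    linear_combination hq
  have h1 : ex (e * ((M * q : ℤ) : ℝ)) = 1 := by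
    rw [ex_eq_one_iff]
    refine ⟨z * q, ?_⟩
    push_cast
    rw [← hz]
    ring
  rw [h0, inverseFactor_add_mul hk (hQ q), h1, one_mul]

theorem norm_inverseFactor_le (hk : 0 < k) (hkN : k ≤ N) (hD : D ≤ 0) (hB : 0 ≤ B)
    (hQ : ∀ τ : ℂ, 1 / 4 < τ.im → ‖Q τ‖ ≤ B) (x : ℤ) :
    ‖inverseFactor e Ω D n N k Q x‖ ≤
      Real.exp (2 * π / N ^ 2 * (n + Ω / 24)) * B * (2 / (k * N)) := by
  rw [inverseFactor, norm_mul, norm_ex, one_mul]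
  exact norm_arcPsi_le hk hkN hD hB hQ x

/-- The M jumps contribute M/(kN), and the Mk regular steps at most M/N² ≤ M/(kN). -/
theorem sum_abs_arcEnd_succ_sub_le (hk : 0 < k) (hkN : k ≤ N) (M : ℕ) :
    ∑ y ∈ Finset.range (M * k), |arcEnd N k ((y : ℤ) + 1) - arcEnd N k y| ≤ M * (2 / (k * N)) := by
  have hkr : (0 : ℝ) < k := by exact_mod_cast hk
  have hkNr : (k : ℝ) ≤ N := by exact_mod_cast hkN
  have hN : (0 : ℝ) < N := hkr.trans_le hkNr
  refine (Finset.sum_le_sum fun (y : ℕ) _ => abs_arcEnd_succ_sub_le hk hkN (y : ℤ)).trans ?_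
  rw [Finset.sum_add_distrib, sum_range_ite_dvd hk, Finset.sum_const, Finset.card_range,
    nsmul_eq_mul]
  have h1 : ((M * k : ℕ) : ℝ) * (1 / (k * N ^ 2)) ≤ M * (1 / (k * N)) := by
    have e1 : ((M * k : ℕ) : ℝ) * (1 / (k * N ^ 2)) = M * (1 / (N * N)) := by
      push_cast
      field_simp
    rw [e1]
    gcongr
  calc _ ≤ (M : ℝ) * (1 / (k * N)) + M * (1 / (k * N)) := by gcongr
    _ = _ := by ring

theorem sum_abs_arcEnd_neg_succ_sub_le (hk : 0 < k) (hkN : k ≤ N) (M : ℕ) :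
    ∑ y ∈ Finset.range (M * k), |arcEnd N k (-((y : ℤ) + 1)) - arcEnd N k (-y)| ≤
      M * (2 / (k * N)) := by
  refine le_trans (le_of_eq ?_) (sum_abs_arcEnd_succ_sub_le hk hkN M)
  rw [← Finset.sum_range_reflect]
  refine Finset.sum_congr rfl fun y hy => ?_
  have hy' := Finset.mem_range.1 hy
  obtain ⟨c, hc⟩ : ∃ c : ℕ, M * k = y + 1 + c := ⟨M * k - (y + 1), by omega⟩
  have e1 : M * k - 1 - y = c := by omega
  have hcz : (M * k : ℤ) = y + 1 + c := by exact_mod_cast hc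
  rw [e1, abs_sub_comm]
  congr 2 <;> refine arcEnd_congr (Int.modEq_iff_dvd.2 ⟨M, ?_⟩) <;> linear_combination -hcz

theorem sum_norm_inverseFactor_succ_sub_le (hk : 0 < k) (hkN : k ≤ N) (hD : D ≤ 0) (hB : 0 ≤ B)
    (hQc : ContinuousOn Q {τ : ℂ | 1 / 4 < τ.im}) (hQ : ∀ τ : ℂ, 1 / 4 < τ.im → ‖Q τ‖ ≤ B)
    (hQl : ∀ τ₁ τ₂ : ℂ, 1 / 2 ≤ τ₁.im → 1 / 2 ≤ τ₂.im → ‖Q τ₁ - Q τ₂‖ ≤ B * ‖τ₁ - τ₂‖) (M : ℕ) :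
    ∑ y ∈ Finset.range (M * k),
      ‖inverseFactor e Ω D n N k Q ((y : ℤ) + 1) - inverseFactor e Ω D n N k Q y‖ ≤
        Real.exp (2 * π / N ^ 2 * (n + Ω / 24)) * B * (2 / (k * N)) * (M * (3 + 2 * π * |e|)) := by
  have hkr : (0 : ℝ) < k := by exact_mod_cast hk
  set G := Real.exp (2 * π / N ^ 2 * (n + Ω / 24)) with hG
  have hG0 : 0 < G := Real.exp_pos _
  have hterm : ∀ y : ℕ,
      ‖inverseFactor e Ω D n N k Q ((y : ℤ) + 1) - inverseFactor e Ω D n N k Q y‖ ≤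
        G * B * (|arcEnd N k ((y : ℤ) + 1) - arcEnd N k y| +
          |arcEnd N k (-((y : ℤ) + 1)) - arcEnd N k (-y)|) +
        G * B * (2 / (k * N)) * ((1 + 2 * π * |e|) / k) := by
    intro y
    have e1 : ∀ a b c d : ℂ, a * b - c * d = a * (b - d) + (a - c) * d := fun _ _ _ _ => by ring
    rw [inverseFactor, inverseFactor, e1]
    have h1 := norm_arcPsi_succ_sub_le (Ω := Ω) (n := n) hk hkN hD hB hQc hQ hQl (y : ℤ)
    have h2 := norm_arcPsi_le (Ω := Ω) (n := n) hk hkN hD hB hQ (y : ℤ)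
    rw [← hG] at h1 h2
    have h3 : ‖ex (e * ((y + 1 : ℤ) : ℝ) / k) - ex (e * (y : ℤ) / k)‖ ≤ 2 * π * |e| / k := by
      refine (norm_ex_sub_ex_le _ _).trans (le_of_eq ?_)
      have e2 : e * ((y + 1 : ℤ) : ℝ) / k - e * (y : ℤ) / k = e / k := by push_cast; ring
      rw [e2, abs_div, abs_of_pos hkr]
      ring
    calc _ ≤ _ := norm_add_le _ _
      _ ≤ G * B * (|arcEnd N k ((y : ℤ) + 1) - arcEnd N k y| +
          |arcEnd N k (-((y : ℤ) + 1)) - arcEnd N k (-y)| + 2 / (k * N) * (1 / k)) +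
          2 * π * |e| / k * (G * B * (2 / (k * N))) := by
        rw [norm_mul, norm_mul, norm_ex, one_mul]
        gcongr
      _ = _ := by ring
  refine (Finset.sum_le_sum fun y _ => hterm y).trans ?_
  rw [Finset.sum_add_distrib, ← Finset.mul_sum, Finset.sum_add_distrib, Finset.sum_const,
    Finset.card_range, nsmul_eq_mul]
  have h1 := sum_abs_arcEnd_succ_sub_le hk hkN M
  have h2 := sum_abs_arcEnd_neg_succ_sub_le hk hkN M
  calc _ ≤ G * B * (M * (2 / (k * N)) + M * (2 / (k * N))) +
        ((M * k : ℕ) : ℝ) * (G * B * (2 / (k * N)) * ((1 + 2 * π * |e|) / k)) := by gcongr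
    _ = _ := by
      push_cast
      field_simp
      ring

end Inverse


/-! ### The sum over the numerators -/

theorem sum_coprime_eq_sum_units {R : Type*} [AddCommMonoid R] {k : ℕ} [NeZero k] (g : ℕ → R) :
    ∑ h ∈ (Finset.range k).filter (fun h => Nat.gcd h k = 1), g h =
      ∑ v : (ZMod k)ˣ, g (v : ZMod k).val := by
  symm
  refine Finset.sum_nbij (fun v : (ZMod k)ˣ => (v : ZMod k).val) (fun v _ => ?_)
    (fun a _ b _ h => Units.ext (ZMod.val_injective k h)) (fun h hh => ?_) fun _ _ => rfl
  · rw [Finset.mem_filter, Finset.mem_range]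
    exact ⟨ZMod.val_lt _, ZMod.val_coe_unit_coprime v⟩
  · rw [Finset.mem_coe, Finset.mem_filter, Finset.mem_range] at hh
    refine ⟨ZMod.unitOfCoprime h hh.2, by simp, ?_⟩
    dsimp only
    rw [ZMod.coe_unitOfCoprime, ZMod.val_cast_of_lt hh.1]

theorem val_mod_eq_of_mem_unitsOver {K k : ℕ} [NeZero K] [NeZero k] (hkK : k ∣ K) {v : (ZMod k)ˣ}
    {u : (ZMod K)ˣ} (hu : u ∈ unitsOver hkK v) : (u : ZMod K).val % k = (v : ZMod k).val := by
  rw [mem_unitsOver] at hu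
  rw [← hu, ZMod.unitsMap_val, ← ZMod.natCast_val, ZMod.val_natCast]

/-- All units modulo k have the same positive number of lifts modulo K, so summing over the lifts
can only enlarge the norm; the lifts are then sorted by their class modulo M. -/
theorem norm_sum_numerators_le {K k M : ℕ} [NeZero K] [NeZero k] [NeZero M] (hkK : k ∣ K)
    (hMK : M ∣ K) (p : ℕ → Prop) [DecidablePred p] (f : ℕ → ℂ) :
    ‖∑ h ∈ (Finset.range k).filter (fun h => Nat.gcd h k = 1 ∧ p h), f h‖ ≤
      ∑ w : (ZMod M)ˣ, ‖∑ u ∈ unitsOver hMK w,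
        if p ((u : ZMod K).val % k) then f ((u : ZMod K).val % k) else 0‖ := by
  classical
  set g : ℕ → ℂ := fun h => if p h then f h else 0 with hg
  have h1 : ∑ h ∈ (Finset.range k).filter (fun h => Nat.gcd h k = 1 ∧ p h), f h =
      ∑ v : (ZMod k)ˣ, g (v : ZMod k).val := by
    rw [← sum_coprime_eq_sum_units, ← Finset.filter_filter, Finset.sum_filter]
  have h2 : ∑ u : (ZMod K)ˣ, g ((u : ZMod K).val % k) =
      ((unitsOver hkK (1 : (ZMod k)ˣ)).card : ℂ) * ∑ v : (ZMod k)ˣ, g (v : ZMod k).val := by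
    rw [← Finset.sum_fiberwise_of_maps_to (s := Finset.univ) (t := Finset.univ)
      (g := ZMod.unitsMap hkK) (fun _ _ => Finset.mem_univ _), Finset.mul_sum]
    refine Finset.sum_congr rfl fun v _ => ?_
    rw [← card_unitsOver hkK v, ← nsmul_eq_mul, ← Finset.sum_const]
    exact Finset.sum_congr rfl fun u hu => by rw [val_mod_eq_of_mem_unitsOver hkK hu]
  have h3 : ∑ u : (ZMod K)ˣ, g ((u : ZMod K).val % k) =
      ∑ w : (ZMod M)ˣ, ∑ u ∈ unitsOver hMK w, g ((u : ZMod K).val % k) :=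
    (Finset.sum_fiberwise_of_maps_to (s := Finset.univ) (t := Finset.univ)
      (g := ZMod.unitsMap hMK) (fun _ _ => Finset.mem_univ _) _).symm
  have hcard : 1 ≤ (unitsOver hkK (1 : (ZMod k)ˣ)).card :=
    Finset.card_pos.2 ⟨1, by rw [mem_unitsOver, map_one]⟩
  have hcard' : (1 : ℝ) ≤ (unitsOver hkK (1 : (ZMod k)ˣ)).card := by exact_mod_cast hcard
  rw [h1]
  calc ‖∑ v : (ZMod k)ˣ, g (v : ZMod k).val‖
      ≤ (unitsOver hkK (1 : (ZMod k)ˣ)).card * ‖∑ v : (ZMod k)ˣ, g (v : ZMod k).val‖ :=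
        le_mul_of_one_le_left (norm_nonneg _) hcard'
    _ = ‖∑ w : (ZMod M)ˣ, ∑ u ∈ unitsOver hMK w, g ((u : ZMod K).val % k)‖ := by
        rw [← h3, h2, norm_mul, Complex.norm_natCast]
    _ ≤ _ := norm_sum_le _ _

/-- One of the two factors has mean value zero. -/
theorem sum_mul_sum_eq_zero {J : ℕ} {m r : Fin J → ℕ} {δ : Fin J → ℤ} (hm : ∀ j, 0 < m j)
    {k M w ϰ ℓ n N : ℕ} {D : ℝ} {Q : ℂ → ℂ} [NeZero (M * k)] (hk : 0 < k)
    (hmM : ∀ j, 24 * m j ∣ M) (h24 : 24 ∣ M) (hℓM : ℓ ∣ M) (hkℓ : k ≡ ℓ [MOD modulus m])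
    (hw : Nat.Coprime w M) (hα : 0 < (n : ℝ) + Omega m r δ / 24)
    (hαk : (n : ℝ) + Omega m r δ / 24 < k)
    (hQ : ∀ T : ℤ, (∀ j, ((m j / Nat.gcd (m j) k : ℕ) : ℤ) ∣ T) → ∀ τ, Q (τ + T) = Q τ) :
    (∑ x : ZMod (M * k), numeratorFactor ((n : ℝ) + Omega m r δ / 24) w ϰ ℓ k x.val) *
      ∑ x : ZMod (M * k),
        inverseFactor (-(Delta m r δ w k) / 24) (Omega m r δ) D n N k Q x.val = 0 := by
  set α := (n : ℝ) + Omega m r δ / 24 with hαdef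
  obtain ⟨zM, hzM⟩ := exists_int_mul_Omega m r δ hm hmM
  have hMα : (M : ℝ) * α = ((M * n + zM : ℤ) : ℝ) := by
    push_cast
    rw [hαdef, ← hzM]
    ring
  obtain ⟨zD, hzD⟩ := exists_int_mul_Delta m r δ hm (h := w) hk hmM
  have hmodval : ∀ (x : ZMod (M * k)) (s : ℤ),
      ((x + (s : ZMod (M * k))).val : ℤ) ≡ x.val + s [ZMOD (M * k : ℕ)] := by
    intro x s
    rw [← ZMod.intCast_eq_intCast_iff]
    simp
  -- The least t with ℓ ∣ kt: translation by kt preserves the congruence condition and multiplies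
  -- the first factor by e(-αt).
  obtain ⟨t, ht⟩ : ∃ t, t = ℓ / Nat.gcd ℓ k := ⟨_, rfl⟩
  have hℓt : Nat.gcd ℓ k * t = ℓ := by rw [ht, Nat.mul_div_cancel' (Nat.gcd_dvd_left ℓ k)]
  by_cases h1 : ex (-α * (t : ℤ)) = 1
  swap
  · refine mul_eq_zero_of_left (sum_eq_zero_of_shift (s := ((k * t : ℤ) : ZMod (M * k))) h1
      fun x => ?_) _
    rw [numeratorFactor_congr hk hℓM hMα (hmodval x _), numeratorFactor_add_mul hk]
    obtain ⟨q, hq⟩ := Nat.gcd_dvd_right ℓ k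
    refine ⟨q, ?_⟩
    have e1 : (k : ℤ) = Nat.gcd ℓ k * q := by exact_mod_cast hq
    have e2 : (Nat.gcd ℓ k : ℤ) * t = ℓ := by exact_mod_cast hℓt
    rw [← e2]
    linear_combination (t : ℤ) * e1
  -- Translation by k∏ m_j/gcd(m_j, k) moves the argument of Q by a period and multiplies the second
  -- factor by this phase.
  by_cases h2 : ex (-(Delta m r δ w k) / 24 * ((∏ j, m j / Nat.gcd (m j) k : ℕ) : ℤ)) = 1
  swap
  · refine mul_eq_zero_of_right _ (sum_eq_zero_of_shift
      (s := ((k * ((∏ j, m j / Nat.gcd (m j) k : ℕ) : ℤ) : ℤ) : ZMod (M * k))) h2 fun x => ?_)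
    rw [inverseFactor_congr hk (fun q τ => hQ _ (fun j => ?_) τ) hzD (hmodval x _),
      inverseFactor_add_mul hk]
    · exact hQ _ fun j =>
        Int.natCast_dvd_natCast.2 (Finset.dvd_prod_of_mem _ (Finset.mem_univ j))
    · refine Dvd.dvd.mul_right (Int.natCast_dvd_natCast.2 ?_) q
      exact (Nat.div_dvd_of_dvd (Nat.gcd_dvd_left _ _)).trans
        ((Dvd.intro_left 24 rfl).trans (hmM j))
  rw [ex_eq_one_iff] at h1 h2
  obtain ⟨z₁, hz₁⟩ := h1
  obtain ⟨z₂, hz₂⟩ := h2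
  have htM : t ∣ M := (Dvd.intro_left _ hℓt).trans hℓM
  -- Both phases are now trivial, and this forces Ω/24 to be an integer.
  obtain ⟨y, hy⟩ := exists_int_Omega (r := r) (δ := δ) (t := t) (h := w) (z := z₂)
    (z' := -z₁ - t * n) hm hk
    (fun j => by rw [ht]; exact coprime_div_gcd_of_modEq (dvd_modulus m j) (hm j) hkℓ)
    (hw.coprime_dvd_right ((by norm_num : 6 ∣ 24).trans h24)) (hw.coprime_dvd_right htM)
    (by rw [← hz₂, Int.cast_natCast, mul_comm]) (by
      push_cast
      rw [← hz₁, hαdef]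
      push_cast
      ring)
  have hαint : α = ((n + y : ℤ) : ℝ) := by
    rw [hαdef, hy]
    push_cast
    ring
  refine mul_eq_zero_of_left ?_ _
  refine (sum_zmod_val (K := M * k) fun x : ℕ => numeratorFactor α w ϰ ℓ k x).trans
    (sum_numeratorFactor_eq_zero hk hαint ?_)
  intro hdvd
  rw [hαint] at hα hαk
  have p1 : (0 : ℤ) < n + y := by exact_mod_cast hα
  have p2 : (n + y : ℤ) < k := by exact_mod_cast hαk
  exact absurd (Int.le_of_dvd p1 hdvd) (by omega)

/-- The contribution of an arc as a product of two factors. -/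
theorem arcTerm_eq_mul {J : ℕ} {m r : Fin J → ℕ} {δ : Fin J → ℤ} (hm : ∀ j, 0 < m j) {D : ℝ}
    {n N k M h w ϰ ℓ : ℕ} {x : ℤ} {Q : ℕ → ℂ → ℂ} {c : ℕ → ℂ} (hk : 0 < k) (hkN : k ≤ N)
    (hmM : ∀ j, m j ∣ M) (hℓM : ℓ ∣ M) (hx : h * x ≡ -1 [ZMOD (M * k : ℕ)]) (hw : h % M = w)
    (hQ : ∀ z : ℂ, z ≠ 0 → zhProd m r δ h k ((h + I * z) / k) = Q (h % M) (x / k + I / (k * z)))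
    (hc : multiplier m r δ h k = c (h % M) * (ex (-(Omega m r δ / 24) * h / k) *
      ex (-(Delta m r δ h k) / 24 * x / k))) :
    (if h % k ≡ ϰ [MOD ℓ] then arcTerm m r δ D n N (h % k) k else 0) =
      c w * (numeratorFactor ((n : ℝ) + Omega m r δ / 24) w ϰ ℓ k h *
        inverseFactor (-(Delta m r δ w k) / 24) (Omega m r δ) D n N k (Q w) x) := by
  have hwh : (h : ℤ) ≡ w [ZMOD M] := by
    rw [← hw]
    exact Int.natCast_modEq_iff.2 (Nat.mod_modEq h M).symm
  -- As h mod k = h - k⌊h/k⌋ and h ≡ w modulo ℓ, the condition on the reduced numerator depends on w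
  -- and ⌊h/k⌋ only.
  have hiff : h % k ≡ ϰ [MOD ℓ] ↔ (w : ℤ) ≡ ϰ + k * ((h : ℤ) / k) [ZMOD ℓ] := by
    have h1 : (h : ℤ) ≡ w [ZMOD ℓ] := hwh.of_dvd (Int.natCast_dvd_natCast.2 hℓM)
    have h2 : (((h % k : ℕ) : ℤ)) + k * ((h : ℤ) / k) = h := by
      rw [Int.natCast_mod]
      exact Int.emod_add_mul_ediv _ _
    rw [← Int.natCast_modEq_iff]
    constructor
    · intro h3
      have h5 := h3.add_right (k * ((h : ℤ) / k))
      rw [h2] at h5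
      exact h1.symm.trans h5
    · intro h3
      refine Int.ModEq.add_right_cancel' (k * ((h : ℤ) / k)) ?_
      rw [h2]
      exact h1.trans h3
  rw [arcTerm_mod_eq (r := r) (δ := δ) (D := D) (n := n) hm hk hkN hx hQ, hc,
    Delta_congr m r δ hk hmM hwh, hw, numeratorFactor, inverseFactor]
  have he : ex (-((n : ℝ) + Omega m r δ / 24) * (h : ℤ) / k) =
      ex (-(n : ℝ) * h / k) * ex (-(Omega m r δ / 24) * h / k) := by
    rw [← ex_add]
    congr 1
    push_cast
    ring
  rw [he]
  simp only [hiff]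
  split_ifs <;> ring


/-! ### Convergence to zero -/

theorem exists_norm_sum_numerators_le {J : ℕ} {m r : Fin J → ℕ} {δ : Fin J → ℤ}
    (hr : ∀ j, 1 ≤ r j ∧ r j < m j) {D : ℝ} (hD : D ≤ 0) (ϰ : ℕ) {ℓ n : ℕ} (hℓ : 1 ≤ ℓ)
    (hα : 0 < (n : ℝ) + Omega m r δ / 24) :
    ∃ C : ℝ, 0 ≤ C ∧ ∀ k N : ℕ, 0 < k → k ≤ N → k ≡ ℓ [MOD modulus m] →
      (n : ℝ) + Omega m r δ / 24 < k →
      ‖∑ h ∈ (Finset.range k).filter (fun h => Nat.gcd h k = 1 ∧ h ≡ ϰ [MOD ℓ]),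
        arcTerm m r δ D n N h k‖ ≤ C * ((k : ℝ) ^ (-(1 / 8) : ℝ) / N) := by
  have hm : ∀ j, 0 < m j := fun j => by have := hr j; omega
  set α := (n : ℝ) + Omega m r δ / 24 with hαdef
  -- 24m_j ∣ M makes the multiplier linear on classes, and ℓ ∣ M lets the class decide the
  -- congruence modulo ℓ. M does not depend on k.
  obtain ⟨M, hMdef⟩ : ∃ M, M = 24 * modulus m * ℓ := ⟨_, rfl⟩
  have hM : 0 < M := by
    rw [hMdef]
    exact Nat.mul_pos (Nat.mul_pos (by norm_num) (modulus_pos hm)) hℓ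
  have hmM : ∀ j, 24 * m j ∣ M := fun j => by
    rw [hMdef]
    exact (Nat.mul_dvd_mul_left 24 (dvd_modulus m j)).mul_right ℓ
  have hmM' : ∀ j, m j ∣ M := fun j => (Dvd.intro_left 24 rfl).trans (hmM j)
  have h24 : 24 ∣ M := by
    rw [hMdef, mul_assoc]
    exact Dvd.intro _ rfl
  have hℓM : ℓ ∣ M := by
    rw [hMdef]
    exact Dvd.intro_left _ rfl
  have : NeZero M := ⟨hM.ne'⟩
  obtain ⟨B, hB, HQ⟩ := exists_zhProd_eq m r δ hr
  obtain ⟨C₀, hC₀, HC⟩ := exists_norm_sum_unitsOver_mul_inv_le M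
  obtain ⟨zM, hzM⟩ := exists_int_mul_Omega m r δ hm hmM
  have hMα : (M : ℝ) * α = ((M * n + zM : ℤ) : ℝ) := by
    push_cast
    rw [hαdef, ← hzM]
    ring
  set E₀ := ∑ j, |(δ j : ℝ)| * m j with hE₀
  have hE₀0 : 0 ≤ E₀ := Finset.sum_nonneg fun j _ => by positivity
  set A := 1 + M * (1 + 2 * π * |α|) with hA
  have hA0 : 0 ≤ A := by positivity
  set V := 1 + M * (3 + 2 * π * E₀) with hV
  have hV0 : 0 ≤ V := by positivity
  set G := Real.exp (2 * π * α) with hG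
  have hG0 : 0 < G := Real.exp_pos _
  refine ⟨M * (C₀ * A * (G * B * 2 * V) * (M : ℝ) ^ (7 / 8 : ℝ)), by positivity,
    fun k N hk hkN hkℓ hαk => ?_⟩
  have hkr : (0 : ℝ) < k := by exact_mod_cast hk
  have hkNr : (k : ℝ) ≤ N := by exact_mod_cast hkN
  have hN1 : (1 : ℝ) ≤ N := by exact_mod_cast hk.trans_le hkN
  have hNr : (0 : ℝ) < N := by linarith
  have : NeZero k := ⟨hk.ne'⟩
  have : NeZero (M * k) := ⟨(Nat.mul_pos hM hk).ne'⟩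
  obtain ⟨Q, hQ, hQe⟩ := HQ k M hk hmM'
  obtain ⟨c, hc1, hc⟩ := exists_multiplier_eq m r δ hm hk hM hmM
  have hMK : M ∣ M * k := Dvd.intro k rfl
  have hkK : k ∣ M * k := Dvd.intro_left M rfl
  have hGN : Real.exp (2 * π / (N : ℝ) ^ 2 * (n + Omega m r δ / 24)) ≤ G := by
    rw [hG, Real.exp_le_exp, ← hαdef]
    have : 2 * π / (N : ℝ) ^ 2 ≤ 2 * π := div_le_self (by positivity) (one_le_pow₀ hN1)
    gcongr
  set b₀ := G * B * (2 / (k * N)) with hb₀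
  have hb₀0 : 0 ≤ b₀ := by positivity
  have key : ∀ w : (ZMod M)ˣ, ‖∑ u ∈ unitsOver hMK w,
      if (u : ZMod (M * k)).val % k ≡ ϰ [MOD ℓ] then
        arcTerm m r δ D n N ((u : ZMod (M * k)).val % k) k else 0‖ ≤
      C₀ * A * (b₀ * V) * ((M * k : ℕ) : ℝ) ^ (7 / 8 : ℝ) := by
    intro w
    obtain ⟨t, ht⟩ : ∃ t, t = (w : ZMod M).val := ⟨_, rfl⟩
    have htM : Nat.Coprime t M := by rw [ht]; exact ZMod.val_coe_unit_coprime w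
    obtain ⟨hQc, hQb, hQl, hQp⟩ := hQ t
    set e := -(Delta m r δ t k) / 24 with he
    obtain ⟨zD, hzD⟩ := exists_int_mul_Delta m r δ hm (h := t) hk hmM
    have heE : |e| ≤ E₀ := abs_Delta_div_le m r δ hm hk
    have hQM : ∀ (q : ℤ) (τ : ℂ), Q t (τ + (M * q : ℤ)) = Q t τ := fun q τ => by
      refine hQp _ (fun j => Dvd.dvd.mul_right (Int.natCast_dvd_natCast.2 ?_) q) τ
      exact (Nat.div_dvd_of_dvd (Nat.gcd_dvd_left _ _)).trans (hmM' j)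
    set a : ZMod (M * k) → ℂ := fun y => numeratorFactor α t ϰ ℓ k y.val with ha
    set b : ZMod (M * k) → ℂ := fun y => inverseFactor e (Omega m r δ) D n N k (Q t) y.val with hb
    have hterm : ∀ u ∈ unitsOver hMK w, (if (u : ZMod (M * k)).val % k ≡ ϰ [MOD ℓ] then
        arcTerm m r δ D n N ((u : ZMod (M * k)).val % k) k else 0) =
        c t * (a u * b (-((u⁻¹ : (ZMod (M * k))ˣ) : ZMod (M * k)))) := by
      intro u hu
      have hx : (((u : ZMod (M * k)).val : ℕ) : ℤ) *
          ((-((u⁻¹ : (ZMod (M * k))ˣ) : ZMod (M * k))).val : ℤ) ≡ -1 [ZMOD (M * k : ℕ)] := by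
        rw [← ZMod.intCast_eq_intCast_iff]
        simp
      exact arcTerm_eq_mul hm hk hkN hmM' hℓM hx
        (by rw [val_mod_eq_of_mem_unitsOver hMK hu, ht]) (fun z hz => hQe _ _ z hx hz) (hc _ _ hx)
    have hacongr : ∀ x y : ℤ, x ≡ y [ZMOD (M * k : ℕ)] →
        numeratorFactor α t ϰ ℓ k x = numeratorFactor α t ϰ ℓ k y :=
      fun x y h => numeratorFactor_congr hk hℓM hMα h
    have hbcongr : ∀ x y : ℤ, x ≡ y [ZMOD (M * k : ℕ)] →
        inverseFactor e (Omega m r δ) D n N k (Q t) x =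
          inverseFactor e (Omega m r δ) D n N k (Q t) y :=
      fun x y h => inverseFactor_congr hk hQM hzD h
    have hb₀' : Real.exp (2 * π / (N : ℝ) ^ 2 * (n + Omega m r δ / 24)) * B * (2 / (k * N)) ≤ b₀ := by
      rw [hb₀]
      gcongr
    have ha1 : ∀ x, ‖a x‖ ≤ A := fun x => (norm_numeratorFactor_le _).trans (by
      rw [hA]
      have : (0 : ℝ) ≤ M * (1 + 2 * π * |α|) := by positivity
      linarith)
    have ha2 : cyclicVariation a ≤ A := by
      rw [ha, cyclicVariation_val hacongr]
      refine (sum_norm_numeratorFactor_succ_sub_le hk).trans ?_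
      rw [hA]
      linarith
    have hb1 : ∀ x, ‖b x‖ ≤ b₀ * V := fun x =>
      ((norm_inverseFactor_le hk hkN hD hB.le hQb _).trans hb₀').trans
        (le_mul_of_one_le_right hb₀0 (by
          rw [hV]
          have : (0 : ℝ) ≤ M * (3 + 2 * π * E₀) := by positivity
          linarith))
    have hb2 : cyclicVariation b ≤ b₀ * V := by
      rw [hb, cyclicVariation_val hbcongr]
      refine (sum_norm_inverseFactor_succ_sub_le hk hkN hD hB.le hQc hQb hQl M).trans ?_
      refine mul_le_mul hb₀' ?_ (by positivity) hb₀0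
      rw [hV]
      have : (M : ℝ) * (3 + 2 * π * |e|) ≤ M * (3 + 2 * π * E₀) := by gcongr
      linarith
    have hzero : (∑ x, a x) * ∑ x, b (-x) = 0 := by
      rw [show ∑ x, b (-x) = ∑ x, b x from Equiv.sum_comp (Equiv.neg (ZMod (M * k))) b]
      exact sum_mul_sum_eq_zero hm hk hmM h24 hℓM hkℓ htM hα hαk hQp
    rw [Finset.sum_congr rfl hterm, ← Finset.mul_sum, norm_mul]
    have := HC (M * k) hMK w a (fun x => b (-x)) A (b₀ * V) ha1 ha2 (fun x => hb1 _)
      (by rw [cyclicVariation_comp_neg]; exact hb2) hzero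
    exact (mul_le_of_le_one_left (norm_nonneg _) (hc1 t)).trans this
  refine (norm_sum_numerators_le hkK hMK (fun h => h ≡ ϰ [MOD ℓ])
    (fun h => arcTerm m r δ D n N h k)).trans ((Finset.sum_le_sum fun w _ => key w).trans ?_)
  rw [Finset.sum_const, nsmul_eq_mul, Finset.card_univ, ZMod.card_units_eq_totient]
  -- The second factor has size and variation O(1/(kN)), so K^(7/8) leaves k^(-1/8)/N.
  have hpow : ((M * k : ℕ) : ℝ) ^ (7 / 8 : ℝ) =
      (M : ℝ) ^ (7 / 8 : ℝ) * ((k : ℝ) ^ (-(1 / 8) : ℝ) * k) := by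
    rw [Nat.cast_mul, Real.mul_rpow (Nat.cast_nonneg M) hkr.le]
    congr 1
    nth_rewrite 3 [← Real.rpow_one (k : ℝ)]
    rw [← Real.rpow_add hkr]
    norm_num
  have htot : (M.totient : ℝ) ≤ M := by exact_mod_cast Nat.totient_le M
  calc _ ≤ (M : ℝ) * (C₀ * A * (b₀ * V) * ((M * k : ℕ) : ℝ) ^ (7 / 8 : ℝ)) := by gcongr
    _ = _ := by
      rw [hpow, hb₀]
      field_simp

/-- The norm of S is at most the mean of the first N terms of a null sequence, so Cesàro applies.
The finitely many k ≤ α, for which the mean value argument fails, are covered by the trivial bound.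
-/
theorem tendsto_S {J : ℕ} {m r : Fin J → ℕ} {δ : Fin J → ℤ}
    (hr : ∀ j, 1 ≤ r j ∧ r j < m j) {ϰ ℓ n : ℕ} (hℓ : 1 ≤ ℓ) (hD : Delta m r δ ϰ ℓ ≤ 0)
    (hα : 0 < (n : ℝ) + Omega m r δ / 24) :
    Tendsto (fun N : ℕ => S m r δ ϰ ℓ n N) atTop (𝓝 0) := by
  obtain ⟨C, hC, H⟩ := exists_norm_sum_numerators_le hr hD ϰ hℓ hα
  obtain ⟨B, hB, HB⟩ := exists_norm_arcTerm_le m r δ hr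
  set α := (n : ℝ) + Omega m r δ / 24 with hαdef
  set β : ℕ → ℝ := fun i => if α < ((i + 1 : ℕ) : ℝ) then C * ((i + 1 : ℕ) : ℝ) ^ (-(1 / 8) : ℝ)
    else Real.exp (2 * π * α) * B * 2 with hβ
  have hβ0 : ∀ i, 0 ≤ β i := fun i => by
    rw [hβ]
    dsimp only
    split_ifs <;> positivity
  have hβlim : Tendsto β atTop (𝓝 0) := by
    have h1 : Tendsto (fun i : ℕ => C * ((i + 1 : ℕ) : ℝ) ^ (-(1 / 8) : ℝ)) atTop (𝓝 0) := by
      have h2 := (tendsto_rpow_neg_atTop (by norm_num : (0 : ℝ) < 1 / 8)).comp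
        (tendsto_natCast_atTop_atTop.comp (tendsto_add_atTop_nat 1))
      simpa using h2.const_mul C
    refine h1.congr' ?_
    have h3 : Tendsto (fun i : ℕ => ((i + 1 : ℕ) : ℝ)) atTop atTop :=
      tendsto_natCast_atTop_atTop.comp (tendsto_add_atTop_nat 1)
    filter_upwards [h3.eventually_gt_atTop α] with i hi
    rw [hβ]
    dsimp only
    rw [if_pos hi]
  refine squeeze_zero_norm' ?_ hβlim.cesaro
  filter_upwards [eventually_ge_atTop 1] with N hN
  have hN1 : (1 : ℝ) ≤ N := by exact_mod_cast hN
  have hNr : (0 : ℝ) < N := by linarith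
  rw [S_eq_sum_arcTerm]
  calc _ ≤ ∑ k ∈ (Finset.Icc 1 N).filter (fun k => k ≡ ℓ [MOD modulus m]),
        (N : ℝ)⁻¹ * β (k - 1) := by
        refine norm_sum_le_of_le _ fun k hk => ?_
        rw [Finset.mem_filter, Finset.mem_Icc] at hk
        obtain ⟨⟨hk1, hkN⟩, hkℓ⟩ := hk
        have hkr : (0 : ℝ) < k := by exact_mod_cast hk1
        rw [hβ]
        dsimp only
        rw [Nat.sub_add_cancel hk1]
        split_ifs with hαk
        · exact (H k N hk1 hkN hkℓ hαk).trans (le_of_eq (by ring))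
        · have hG : Real.exp (2 * π / (N : ℝ) ^ 2 * (n + Omega m r δ / 24)) ≤
              Real.exp (2 * π * α) := by
            rw [Real.exp_le_exp, ← hαdef]
            have : 2 * π / (N : ℝ) ^ 2 ≤ 2 * π := div_le_self (by positivity) (one_le_pow₀ hN1)
            gcongr
          calc _ ≤ ∑ h ∈ (Finset.range k).filter (fun h => Nat.gcd h k = 1 ∧ h ≡ ϰ [MOD ℓ]),
                Real.exp (2 * π * α) * B * (2 / (k * N)) := by
                refine norm_sum_le_of_le _ fun h hh => ?_
                rw [Finset.mem_filter, Finset.mem_range] at hh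
                refine (HB _ n N h k hD hk1 hkN hh.1 hh.2.1).trans ?_
                gcongr
            _ ≤ ∑ h ∈ Finset.range k, Real.exp (2 * π * α) * B * (2 / (k * N)) :=
                Finset.sum_le_sum_of_subset_of_nonneg (Finset.filter_subset _ _)
                  fun _ _ _ => by positivity
            _ = _ := by
                rw [Finset.sum_const, Finset.card_range, nsmul_eq_mul]
                field_simp
    _ ≤ ∑ k ∈ Finset.Icc 1 N, (N : ℝ)⁻¹ * β (k - 1) :=
        Finset.sum_le_sum_of_subset_of_nonneg (Finset.filter_subset _ _)
          fun k _ _ => mul_nonneg (by positivity) (hβ0 _)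
    _ = (N : ℝ)⁻¹ * ∑ i ∈ Finset.range N, β i := by
        rw [← Finset.mul_sum]
        congr 1
        refine Finset.sum_nbij' (fun k => k - 1) (fun i => i + 1) ?_ ?_ ?_ ?_ fun _ _ => rfl <;>
          intro i hi <;> simp only [Finset.mem_Icc, Finset.mem_range] at hi ⊢ <;> omega

end FareyProduct

/-! ### Conclusion -/

theorem mainTheorem3 {J : ℕ} (m r : Fin J → ℕ) (δ : Fin J → ℤ)
    (hr : ∀ j, 1 ≤ r j ∧ r j < m j) (hδ : ∀ j, δ j ≠ 0) :
    ∃ C : ℝ, ∀ ϰ ℓ : ℕ, (ϰ, ℓ) ∈ FareyProduct.minorPairs m r δ →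
      ∀ n : ℕ, 0 < n → -(FareyProduct.Omega m r δ) / 24 < (n : ℝ) →
        (∀ N : ℕ, 1 ≤ N →
          ‖FareyProduct.S m r δ ϰ ℓ n N‖ ≤
            C * Real.exp (2 * π / (N : ℝ) ^ 2 * ((n : ℝ) + FareyProduct.Omega m r δ / 24))) ∧
        Tendsto (fun N : ℕ => FareyProduct.S m r δ ϰ ℓ n N) atTop (𝓝 0) ∧
        ‖FareyProduct.S m r δ ϰ ℓ n
            ⌊√(2 * π * ((n : ℝ) + FareyProduct.Omega m r δ / 24))⌋₊‖ ≤ C := by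
  obtain ⟨B, hB, H⟩ := FareyProduct.exists_norm_S_le m r δ hr
  have h4 : (1 : ℝ) ≤ Real.exp 4 := Real.one_le_exp (by norm_num)
  -- The factor e⁴ is needed for the third assertion: ⌊√X⌋ ≥ 1 gives √X ≤ 2⌊√X⌋, hence X/⌊√X⌋² ≤ 4.
  refine ⟨B * Real.exp 4, fun ϰ ℓ hmem n _ hn => ?_⟩
  obtain ⟨hℓ, -, -, hD⟩ := hmem
  have hα : 0 < (n : ℝ) + FareyProduct.Omega m r δ / 24 := by linarith
  refine ⟨fun N hN => (H ϰ ℓ n N hD hN).trans ?_, FareyProduct.tendsto_S hr hℓ hD hα, ?_⟩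
  · gcongr
    exact le_mul_of_one_le_right hB.le h4
  · set X := 2 * π * ((n : ℝ) + FareyProduct.Omega m r δ / 24) with hX
    have hX0 : 0 < X := by positivity
    -- For X < 1 the order is 0 and the sum is empty.
    rcases Nat.eq_zero_or_pos ⌊√X⌋₊ with h0 | h1
    · have hS : FareyProduct.S m r δ ϰ ℓ n 0 = 0 := by simp [FareyProduct.S]
      rw [h0, hS, norm_zero]
      positivity
    · refine (H ϰ ℓ n _ hD h1).trans ?_
      have e : 2 * π / (⌊√X⌋₊ : ℝ) ^ 2 * ((n : ℝ) + FareyProduct.Omega m r δ / 24) =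
          X / (⌊√X⌋₊ : ℝ) ^ 2 := by
        rw [hX]
        ring
      rw [e]
      exact mul_le_mul_of_nonneg_left (FareyProduct.exp_div_floor_sqrt_sq_le hX0 h1) hB.le
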